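/- A Boolean relation is a set $R\subseteq\{0,1\}^r$ for some $r\in\mathbb N$; a Boolean constraint language $\Gamma$ is a (finite or infinite) set of Boolean relations. A formula $\mathcal F$ over $\Gamma$ is a finite multiset of constraints $R(x_1,\dots,x_r)$ with $R\in\Gamma$ and (possibly repeated) variables $x_i$. The cost $f_{\mathcal F}(\alpha)$ of an assignment $\alpha$ is the number of constraints of $\mathcal F$, counted with multiplicity, that $\alpha$ violates. Min SAT$(\Gamma)$, parameterized by $k$, asks, given a formula $\mathcal F$ over $\Gamma$ and $k\in\mathbb N$, whether some assignment $\alpha$ has $f_{\mathcal F}(\alpha)\le k$ (relations are given in the input by their truth tables, which is immaterial for finite $\Gamma$). Min SAT$(\Gamma)$ is trivial if every formula over $\Gamma$ is satisfiable, or no nonempty formula over $\Gamma$ is satisfiable, or every formula over $\Gamma$ is satisfied by the all-$0$ assignment, or every formula over $\Gamma$ is satisfied by the all-$1$ assignment. Min SAT$(\Gamma)$ supports crisp $(x\ne y)$ if for every $k\in\mathbb N$ there is a formula $\mathcal F$ over $\Gamma$ on the variables $x,y$ and possibly a set $Z$ of auxiliary variables such that $\min_{Z}f_{\mathcal F}(x,y,Z)=0$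 if $x\neq y$ and $\min_{Z}f_{\mathcal F}(x,y,Z)>k$ if $x=y$. The Gaifman graph $G_R$ of $R\subseteq\{0,1\}^r$ has vertex set $\{1,\dots,r\}$, and distinct $i,j$ are adjacent iff there are $a,b\in\{0,1\}$ such that no $t\in R$ has $t_i=a$ and $t_j=b$. $2K_2$ denotes the graph consisting of two disjoint edges. A parameterized problem is W[1]-hard if every problem in W[1] has an fpt-reduction to it (many-one, computable in time $f(k)\cdot n^{O(1)}$, with output parameter at most $g(k)$, for computable $f,g$), where W[1] is the class of problems that have an fpt-reduction to weighted $d$-CNF satisfiability (is there a satisfying assignment with exactly $k$ variables true?, parameter $k$) for some constant $d$. **Statement.** Let $\Gamma$ be a Boolean constraint language such that Min SAT$(\Gamma)$ supports crisp $(x\neq y)$, and suppose that some $R\in\Gamma$ has a Gaifman graph $G_R$ that contains $2K_2$ as an induced subgraph. Then Min SAT$(\Gamma)$ is trivial or W[1]-hard. -/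

import Mathlib

/-!
Parameterized problems, fpt-reductions, W[1]-hardness, and the problem Min SAT.
-/

namespace MinSat

/-! ### Parameterized problems and fpt-reductions -/

/-- A parameterized decision problem: instances, encoded injectively as binary strings, each with
a parameter, and a set of yes-instances. -/
structure ParamProblem where
  Inst : Type
  enc : Inst → List Bool
  enc_injective : Function.Injective enc
  param : Inst → ℕ
  yes : Set Inst

/-- There is an fpt-reduction from `P` to `Q`: a map `φ` on instances that preserves and reflects
yes-instances, whose output parameter is at most `g k`, and that a Turing machine computes in at
most `f k * (n + 1) ^ c` steps, where `k` is the parameter and `n` the encoding length of the given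
instance, and `f`, `g` are computable. -/
def FPTReducible (P Q : ParamProblem) : Prop :=
  ∃ (φ : P.Inst → Q.Inst) (f g : ℕ → ℕ) (c : ℕ) (M : Turing.TM2ComputableAux Bool Bool),
    Computable f ∧ Computable g ∧
    (∀ x, x ∈ P.yes ↔ φ x ∈ Q.yes) ∧
    (∀ x, Q.param (φ x) ≤ g (P.param x)) ∧
    ∀ x, Nonempty (Turing.TM2OutputsInTime M.tm
      ((P.enc x).map M.inputAlphabet.symm)
      (some ((Q.enc (φ x)).map M.outputAlphabet.symm))
      (f (P.param x) * ((P.enc x).length + 1) ^ c))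

/-! ### Encoding of lists of natural numbers as binary strings -/

/-- The list `[n₁, n₂, …]` is encoded as `1 ⋯ 1 0 1 ⋯ 1 0 ⋯` with blocks of `nᵢ` ones. -/
def encNats (l : List ℕ) : List Bool :=
  l.flatMap fun n => List.replicate n true ++ [false]

theorem encNats_injective : Function.Injective encNats := by
  have key : ∀ (m n : ℕ) (s t : List Bool),
      List.replicate m true ++ false :: s = List.replicate n true ++ false :: t →
        m = n ∧ s = t := by
    intro m
    induction m with
    | zero =>
      intro n s t h
      cases n with
      | zero => simpa using h
      | succ n => simp [List.replicate_succ] at h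
    | succ m ih =>
      intro n s t h
      cases n with
      | zero => simp [List.replicate_succ] at h
      | succ n =>
        simp only [List.replicate_succ, List.cons_append, List.cons.injEq, true_and] at h
        obtain ⟨h1, h2⟩ := ih n s t h
        exact ⟨by rw [h1], h2⟩
  intro l
  induction l with
  | nil =>
    intro l' h
    cases l' with
    | nil => rfl
    | cons a l' => simp [encNats] at h
  | cons a l ih =>
    intro l' h
    cases l' with
    | nil => simp [encNats] at h
    | cons b l' =>
      simp only [encNats, List.flatMap_cons, List.append_assoc, List.singleton_append] at h
      obtain ⟨h1, h2⟩ := key _ _ _ _ h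
      rw [h1, ih h2]

theorem flatMap_injective_of_prefix {α β : Type} (e : α → List β) (hne : ∀ a, e a ≠ [])
    (he : ∀ a b s t, e a ++ s = e b ++ t → a = b ∧ s = t) :
    Function.Injective fun l : List α => l.flatMap e := by
  intro l
  induction l with
  | nil =>
    intro l' h
    cases l' with
    | nil => rfl
    | cons a l' => simp [hne] at h
  | cons a l ih =>
    intro l' h
    cases l' with
    | nil => simp [hne] at h
    | cons b l' =>
      simp only [List.flatMap_cons] at h
      obtain ⟨h1, h2⟩ := he _ _ _ _ h
      rw [h1, ih h2]

/-! ### The class W[1]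

W[1] is the closure under fpt-reductions of the weighted satisfiability problems for `d`-CNF
formulas, `d` ranging over all constants, parameterized by the weight. -/

/-- A `d`-CNF formula on the variables `0, …, numVars - 1` with a target weight. The literal
`(v, true)` is `v`, the literal `(v, false)` is the negation of `v`. -/
structure WSatInst (d : ℕ) where
  numVars : ℕ
  clauses : List (List (Fin numVars × Bool))
  width_le : ∀ C ∈ clauses, C.length ≤ d
  weight : ℕ

def encClause {n : ℕ} (C : List (Fin n × Bool)) : List ℕ :=
  C.length :: C.flatMap fun l => [(l.1 : ℕ), l.2.toNat]

def WSatInst.code {d : ℕ} (I : WSatInst d) : List ℕ :=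
  I.weight :: I.numVars :: I.clauses.flatMap encClause

theorem WSatInst.code_injective (d : ℕ) : Function.Injective (WSatInst.code (d := d)) := by
  have hlit : ∀ (n : ℕ) (C D : List (Fin n × Bool)) (s t : List ℕ), C.length = D.length →
      (C.flatMap fun l => [(l.1 : ℕ), l.2.toNat]) ++ s =
        (D.flatMap fun l => [(l.1 : ℕ), l.2.toNat]) ++ t → C = D ∧ s = t := by
    intro n C
    induction C with
    | nil =>
      intro D s t hl h
      cases D with
      | nil => simpa using h
      | cons b D => simp at hl
    | cons a C ih =>
      intro D s t hl h
      cases D with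
      | nil => simp at hl
      | cons b D =>
        simp only [List.flatMap_cons, List.cons_append, List.nil_append, List.cons.injEq] at h
        obtain ⟨h1, h2, h3⟩ := h
        obtain ⟨h4, h5⟩ := ih D s t (by simpa using hl) h3
        have h6 : a.2 = b.2 := by
          cases ha : a.2 <;> cases hb : b.2 <;> simp_all
        exact ⟨by rw [h4, Prod.ext (Fin.ext h1) h6], h5⟩
  rintro ⟨n, cl, hw, k⟩ ⟨n', cl', hw', k'⟩ h
  simp only [WSatInst.code, List.cons.injEq] at h
  obtain ⟨rfl, rfl, h⟩ := h
  have := flatMap_injective_of_prefix (encClause (n := n)) (by simp [encClause])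
    (by
      intro a b s t hab
      simp only [encClause, List.cons_append, List.cons.injEq] at hab
      exact hlit n a b s t hab.1 hab.2) h
  subst this
  rfl

/-- Weighted `d`-CNF satisfiability: is there a satisfying assignment that sets exactly `weight`
variables (those in `S`) to true? -/
def WSat (d : ℕ) : ParamProblem where
  Inst := WSatInst d
  enc I := encNats I.code
  enc_injective := encNats_injective.comp (WSatInst.code_injective d)
  param I := I.weight
  yes := {I | ∃ S : Finset (Fin I.numVars), S.card = I.weight ∧
    ∀ C ∈ I.clauses, ∃ l ∈ C, (l.1 ∈ S ↔ l.2 = true)}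

def InW1 (P : ParamProblem) : Prop :=
  ∃ d, FPTReducible P (WSat d)

def W1Hard (Q : ParamProblem) : Prop :=
  ∀ P, InW1 P → FPTReducible P Q

/-! ### Boolean constraint languages -/

/-- A Boolean relation `tuples ⊆ {0,1}^arity`. -/
structure BoolRel where
  arity : ℕ
  tuples : Set (Fin arity → Bool)

/-- A constraint `R(x₁, …, x_r)` with `R ∈ Γ`. Variables are natural numbers; they may be repeated
in the scope. -/
structure Constraint (Γ : Set BoolRel) where
  rel : BoolRel
  rel_mem : rel ∈ Γ
  scope : Fin rel.arity → ℕ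

def Constraint.Sat {Γ : Set BoolRel} (c : Constraint Γ) (α : ℕ → Bool) : Prop :=
  (fun i => α (c.scope i)) ∈ c.rel.tuples

/-- A formula is a finite multiset of constraints, listed in some order. -/
abbrev Formula (Γ : Set BoolRel) : Type := List (Constraint Γ)

open Classical in
/-- The number of constraints (with multiplicity) that `α` violates. -/
noncomputable def cost {Γ : Set BoolRel} (F : Formula Γ) (α : ℕ → Bool) : ℕ :=
  F.countP fun c => ¬ c.Sat α

open Classical in
/-- The truth table of a relation: entry `i` is `1` iff the tuple of the binary digits of `i`
belongs to the relation. -/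
noncomputable def BoolRel.table (R : BoolRel) : List ℕ :=
  List.ofFn fun i : Fin (2 ^ R.arity) =>
    if (fun j : Fin R.arity => Nat.testBit i j) ∈ R.tuples then 1 else 0

/-- A constraint is written as arity, truth table, scope. -/
noncomputable def Constraint.code {Γ : Set BoolRel} (c : Constraint Γ) : List ℕ :=
  c.rel.arity :: (c.rel.table ++ List.ofFn c.scope)

theorem Constraint.code_prefix {Γ : Set BoolRel} (a b : Constraint Γ) (s t : List ℕ)
    (h : a.code ++ s = b.code ++ t) : a = b ∧ s = t := by
  obtain ⟨⟨r, T⟩, hR, x⟩ := a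
  obtain ⟨⟨r', T'⟩, hR', x'⟩ := b
  simp only [Constraint.code, List.cons_append, List.cons.injEq, List.append_assoc] at h
  obtain ⟨rfl, h⟩ := h
  obtain ⟨h1, h2⟩ := List.append_inj h (by simp [BoolRel.table])
  obtain ⟨h3, h4⟩ := List.append_inj h2 (by simp)
  have hx : x = x' := List.ofFn_injective h3
  have hT : T = T' := by
    ext u
    have h5 := congrFun (List.ofFn_injective h1) ⟨Nat.ofBits u, Nat.ofBits_lt_two_pow u⟩
    have h6 : (fun j : Fin r => Nat.testBit (Nat.ofBits u) j) = u := by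
      funext j
      simp [Nat.testBit_ofBits_lt]
    simp only [h6] at h5
    by_cases hu : u ∈ T <;> by_cases hu' : u ∈ T' <;> simp_all
  subst hx hT
  exact ⟨rfl, h4⟩

theorem minSAT_code_injective (Γ : Set BoolRel) :
    Function.Injective fun I : Formula Γ × ℕ => I.2 :: I.1.flatMap Constraint.code := by
  rintro ⟨F, k⟩ ⟨F', k'⟩ h
  simp only [List.cons.injEq] at h
  obtain ⟨rfl, h⟩ := h
  have := flatMap_injective_of_prefix Constraint.code (by simp [Constraint.code])
    Constraint.code_prefix h
  subst this
  rfl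

/-- Min SAT(Γ): given a formula over `Γ` and `k`, is there an assignment that violates at most `k`
constraints? The parameter is `k`. -/
noncomputable def MinSAT (Γ : Set BoolRel) : ParamProblem where
  Inst := Formula Γ × ℕ
  enc I := encNats (I.2 :: I.1.flatMap Constraint.code)
  enc_injective := encNats_injective.comp (minSAT_code_injective Γ)
  param I := I.2
  yes := {I | ∃ α, cost I.1 α ≤ I.2}

/-- Min SAT(Γ) is trivial: either every formula is satisfiable, or no nonempty formula is
satisfiable, or every formula is satisfied by the all-0 assignment, or every formula is satisfied
by the all-1 assignment. -/
def MinSATTrivial (Γ : Set BoolRel) : Prop :=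
  (∀ F : Formula Γ, ∃ α, ∀ c ∈ F, c.Sat α) ∨
  (∀ F : Formula Γ, F ≠ [] → ¬ ∃ α, ∀ c ∈ F, c.Sat α) ∨
  (∀ F : Formula Γ, ∀ c ∈ F, c.Sat fun _ => false) ∨
  (∀ F : Formula Γ, ∀ c ∈ F, c.Sat fun _ => true)

/-- Min SAT(Γ) supports crisp `R(x₀, …, x_{r-1})`: for every `k` there is a formula over `Γ` on the
variables `0, …, r-1` and, possibly, auxiliary variables, whose least cost over all values of the
auxiliary variables is `0` on the tuples of `R` and greater than `k` on all other tuples. -/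
def SupportsCrisp (Γ : Set BoolRel) (R : BoolRel) : Prop :=
  ∀ k : ℕ, ∃ F : Formula Γ, ∀ t : Fin R.arity → Bool,
    (t ∈ R.tuples → ∃ α : ℕ → Bool, (∀ i : Fin R.arity, α i = t i) ∧ cost F α = 0) ∧
    (t ∉ R.tuples → ∀ α : ℕ → Bool, (∀ i : Fin R.arity, α i = t i) → k < cost F α)

/-- The relation `x ≠ y`. -/
def neqRel : BoolRel where
  arity := 2
  tuples := {t | t 0 ≠ t 1}

/-- The Gaifman graph of `R`: two distinct coordinates are adjacent iff some pair of values for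
them occurs in no tuple of `R`. -/
def gaifmanGraph (R : BoolRel) : SimpleGraph (Fin R.arity) where
  Adj i j := i ≠ j ∧ ∃ a b : Bool, ∀ t ∈ R.tuples, ¬ (t i = a ∧ t j = b)
  symm := by
    constructor
    rintro i j ⟨hij, a, b, h⟩
    exact ⟨hij.symm, b, a, fun t ht hc => h t ht hc.symm⟩
  loopless := by
    constructor
    rintro i ⟨h, -⟩
    exact h rfl

/-- The graph `2K₂`, two disjoint edges. -/
def twoK2 : SimpleGraph (Fin 2 ⊕ Fin 2) :=
  (⊤ : SimpleGraph (Fin 2)) ⊕g (⊤ : SimpleGraph (Fin 2))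

end MinSat

/-! The second alternative always holds. Since W[1] is defined through weighted `d`-CNF
satisfiability, it suffices to reduce that problem, for each fixed `d`, in polynomial time and with
a new parameter bounded in terms of the old one, and to compose with a given fpt-reduction.

Gadgets. Crisp `x ≠ y` provides negations of nodes and then crisp equalities, `u = v` being `u ≠
¬v`. An edge of the Gaifman graph is a forbidden pair of values, which is an implication between
signed coordinates; non-adjacent coordinates take all pairs of values. An induced `2K₂` therefore
yields a projection to four signed coordinates that lies in `(x₀ → x₁) ∧ (x₂ → x₃)` and contains
`(x₀ = x₁) ∧ (x₂ = x₃)` (`exists_paired_frame`). A soft constraint of this kind is a bundle of two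
edges: violating it, at cost one, allows both edges to be cut, and otherwise neither is.

Cuts. Take a CSP with `M` constraints of arity `D`, each given by a list of `T` tuples. Constraint
`m` gets a path `A m` with one edge per tuple, variable `i` a path `B i` with one edge per value,
all leading from a source to a sink of opposite value. The path `P m j` subdivides each edge of `B
(idx m j)` into `T` edges, and a bundle ties edge `t` of `A m` to edge `t` within the block of the
value `digit t j` of `P m j`. All other edges of `P m j`, and edges of `A m` for forbidden tuples,
are crisp equalities. A cut of `A m` violates a bundle for each `j`, so the budget `M * D` leaves
exactly one violated bundle per `(m, j)`. The cuts then agree on one tuple per constraint and one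
value per variable (`TupleCSP.solvable_of_cuts`, `TupleCSP.exists_nodes_of_solvable`).

Weighted satisfiability. The `k` true variables in increasing order, with sentinels at both ends,
are the CSP variables. A literal is false iff some gap between consecutive entries witnesses it, so
a clause with at most `d` literals is checked on the ends of at most `d` gaps. There is one
constraint for each choice of `d + 1` gaps (`WSatInst.solvable_tupleCSP_iff`), hence `M` and `D`
depend on `k` and `d` only.

Complexity. The reduction is written in a small language of unary arithmetic and bounded loops. Its
programs compile to Turing machines with polynomial time bounds and can be run after any given
machine (`FPTReducible.trans_cmd`). -/

namespace MinSat

/-! ### Register programs and their translation into Turing machines -/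

open Turing Function

/-- Programs acting on registers, each of which holds a list of bits. `loop k body cont` pops the
register `k`, runs the body chosen by the popped symbol, and repeats if `cont` tells so. -/
inductive Prog
  | skip
  | push (k : ℕ) (b : Bool)
  | seq (p q : Prog)
  | loop (k : ℕ) (body : Option Bool → Prog) (cont : Option Bool → Bool)

namespace Prog

/-- A bound on the registers that a program uses. -/
def width : Prog → ℕ
  | skip => 0
  | push k _ => k + 1
  | seq p q => max p.width q.width
  | loop k body _ =>
    max (k + 1) (max (body none).width (max (body (some false)).width (body (some true)).width))

theorem width_body_le (k : ℕ) (body : Option Bool → Prog) (cont : Option Bool → Bool)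
    (o : Option Bool) : (body o).width ≤ (loop k body cont).width := by
  rcases o with _ | _ | _ <;> simp [width]

/-- The labels of the machine code of a program. -/
@[reducible]
def Lab : Prog → Type
  | skip => Unit
  | push _ _ => Unit
  | seq p q => p.Lab ⊕ q.Lab
  | loop _ body _ => Option (Σ o, (body o).Lab)

@[reducible]
noncomputable def labFintype : ∀ p : Prog, Fintype p.Lab
  | skip => inferInstanceAs (Fintype Unit)
  | push _ _ => inferInstanceAs (Fintype Unit)
  | seq p q =>
    letI := labFintype p
    letI := labFintype q
    inferInstanceAs (Fintype (p.Lab ⊕ q.Lab))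
  | loop _ body _ =>
    letI := fun o => labFintype (body o)
    inferInstanceAs (Fintype (Option (Σ o, (body o).Lab)))

noncomputable instance (p : Prog) : Fintype p.Lab := labFintype p

def entry : ∀ p : Prog, p.Lab
  | skip => ()
  | push _ _ => ()
  | seq p _ => Sum.inl p.entry
  | loop _ _ _ => none

/-- Execution of a program, with an upper bound on the number of steps. -/
inductive Exec : Prog → (ℕ → List Bool) → ℕ → (ℕ → List Bool) → Prop
  | skip (s) : Exec skip s 1 s
  | push (k b s) : Exec (push k b) s 1 (update s k (b :: s k))
  | seq {p q s s' s'' t t'} :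
      Exec p s t s' → Exec q s' t' s'' → Exec (seq p q) s (t + t') s''
  | exit {k body cont s s' t} : cont (s k).head? = false →
      Exec (body (s k).head?) (update s k (s k).tail) t s' →
      Exec (loop k body cont) s (1 + t) s'
  | cont {k body cont s s' s'' t t'} : cont (s k).head? = true →
      Exec (body (s k).head?) (update s k (s k).tail) t s' →
      Exec (loop k body cont) s' t' s'' →
      Exec (loop k body cont) s (1 + t + t') s''
  | mono {p s s' t t'} : Exec p s t s' → t ≤ t' → Exec p s t' s'

end Prog

/-! ### Machine code -/

section Machine

variable {K₀ : Type} [DecidableEq K₀] {Γ₀ : K₀ → Type} {σ₀ : Type} {B : ℕ} [NeZero B]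

/-- The stack alphabets of a machine with `B` additional stacks of bits. -/
@[reducible]
def AddStacks (Γ₀ : K₀ → Type) (B : ℕ) : K₀ ⊕ Fin B → Type
  | Sum.inl k => Γ₀ k
  | Sum.inr _ => Bool

/-- Combined contents of the stacks. -/
def combine (S : ∀ k, List (Γ₀ k)) (s : ℕ → List Bool) : ∀ k, List (AddStacks Γ₀ B k)
  | Sum.inl k => S k
  | Sum.inr i => s i

omit [NeZero B] in
theorem update_combine_inl (S : ∀ k, List (Γ₀ k)) (s : ℕ → List Bool) (k : K₀)
    (x : List (Γ₀ k)) :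
    update (combine (B := B) S s) (Sum.inl k) x = combine (update S k x) s := by
  funext j
  rcases j with j | j
  · by_cases h : j = k
    · subst h; simp [combine]
    · have h' : (Sum.inl j : K₀ ⊕ Fin B) ≠ Sum.inl k := by simpa using h
      rw [update_of_ne h']
      simp [combine, h]
  · rw [update_of_ne (by simp)]
    rfl

/-- Registers are numbered by `ℕ` and enter `Fin B` modulo `B`; the bound on `k` rules out a
wraparound. -/
theorem update_combine_inr (S : ∀ k, List (Γ₀ k)) (s : ℕ → List Bool) (k : ℕ) (hk : k < B)
    (x : List Bool) :
    update (combine (B := B) S s) (Sum.inr (Fin.ofNat B k)) x = combine S (update s k x) := by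
  funext j
  rcases j with j | j
  · rw [update_of_ne (by simp)]
    rfl
  · by_cases h : j = Fin.ofNat B k
    · subst h
      simp [combine, Nat.mod_eq_of_lt hk]
    · have h' : (Sum.inr j : K₀ ⊕ Fin B) ≠ Sum.inr (Fin.ofNat B k) := by simpa using h
      rw [update_of_ne h']
      have h2 : (j : ℕ) ≠ k := by
        rintro rfl
        apply h
        ext
        simp
      simp [combine, h2]

omit [DecidableEq K₀] in
theorem combine_inr (S : ∀ k, List (Γ₀ k)) (s : ℕ → List Bool) (k : ℕ) (hk : k < B) :
    combine (B := B) S s (Sum.inr (Fin.ofNat B k)) = s k := by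
  simp [combine, Nat.mod_eq_of_lt hk]

/-- The machine code of a program, where `ι` embeds its labels and `exit` is executed at its
end. -/
def Prog.machineCode {Λ : Type} :
    ∀ p : Prog, (p.Lab → Λ) → TM2.Stmt (AddStacks Γ₀ B) Λ (σ₀ × Option Bool) →
      p.Lab → TM2.Stmt (AddStacks Γ₀ B) Λ (σ₀ × Option Bool)
  | skip, _, exit, _ => exit
  | push k b, _, exit, _ => TM2.Stmt.push (Sum.inr (Fin.ofNat B k)) (fun _ => b) exit
  | seq p q, ι, exit, l => match l with
    | Sum.inl l => p.machineCode (fun l => ι (Sum.inl l))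
        (TM2.Stmt.goto fun _ => ι (Sum.inr q.entry)) l
    | Sum.inr l => q.machineCode (fun l => ι (Sum.inr l)) exit l
  | loop k body cont, ι, exit, l => match l with
    | none => TM2.Stmt.pop (Sum.inr (Fin.ofNat B k)) (fun v x => (v.1, x))
        (TM2.Stmt.goto fun v => ι (some ⟨v.2, (body v.2).entry⟩))
    | some ⟨o, l⟩ => (body o).machineCode (fun l => ι (some ⟨o, l⟩))
        (if cont o then TM2.Stmt.goto fun _ => ι none else exit) l

end Machine

/-- `c'` is reached from `c` in exactly `t` steps. -/
def ReachesIn {α : Type} (f : α → Option α) (t : ℕ) (c c' : α) : Prop :=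
  (flip bind f)^[t] (some c) = some c'

theorem ReachesIn.trans {α : Type} {f : α → Option α} {t t' : ℕ} {a b c : α}
    (h : ReachesIn f t a b) (h' : ReachesIn f t' b c) : ReachesIn f (t + t') a c := by
  unfold ReachesIn at *
  rw [add_comm, iterate_add_apply, h, h']

theorem ReachesIn.single {α : Type} {f : α → Option α} {a b : α} (h : f a = some b) :
    ReachesIn f 1 a b := by
  simpa [ReachesIn, flip] using h

theorem iterate_bind_none {α : Type} (f : α → Option α) (t : ℕ) :
    (flip bind f)^[t] (none : Option α) = none := by
  induction t with
  | zero => rfl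
  | succ t ih => rw [iterate_succ_apply]; exact ih

theorem ReachesIn.succ_inv {α : Type} {f : α → Option α} {t : ℕ} {a c : α}
    (h : ReachesIn f (t + 1) a c) : ∃ b, f a = some b ∧ ReachesIn f t b c := by
  unfold ReachesIn at h
  rw [iterate_succ_apply] at h
  have h1 : flip bind f (some a) = f a := by simp [flip]
  rw [h1] at h
  cases hb : f a with
  | none => rw [hb, iterate_bind_none] at h; cases h
  | some b => exact ⟨b, rfl, by rw [hb] at h; exact h⟩

section Machine

variable {K₀ : Type} [DecidableEq K₀] {Γ₀ : K₀ → Type} {σ₀ : Type} {B : ℕ} [NeZero B]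

/-- Induction on the execution. The endpoint is the result of `exit` and not a label, because `exit`
is carried out within the last step of the program. The extra bit `o` of the internal state only
transports popped symbols, so its values before and after are irrelevant. -/
theorem Prog.Exec.reaches {Λ : Type}
    (m : Λ → TM2.Stmt (AddStacks Γ₀ B) Λ (σ₀ × Option Bool)) (S : ∀ k, List (Γ₀ k)) (v : σ₀)
    {p : Prog} {s s' : ℕ → List Bool} {t : ℕ} (h : p.Exec s t s') (hw : p.width ≤ B) :
    ∀ (ι : p.Lab → Λ) (exit : TM2.Stmt (AddStacks Γ₀ B) Λ (σ₀ × Option Bool)),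
      (∀ l, m (ι l) = p.machineCode ι exit l) → ∀ o : Option Bool, ∃ n ≤ t, ∃ o' : Option Bool,
      ReachesIn (TM2.step m) n ⟨some (ι p.entry), (v, o), combine S s⟩
        (TM2.stepAux exit (v, o') (combine S s')) := by
  induction h with
  | skip s =>
    intro ι exit hι o
    exact ⟨1, le_rfl, o, ReachesIn.single (by simp [hι, machineCode])⟩
  | push k b s =>
    intro ι exit hι o
    have hk : k < B := by simpa [width] using hw
    refine ⟨1, le_rfl, o, ReachesIn.single ?_⟩
    simp only [TM2.step, hι, machineCode, TM2.stepAux]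
    rw [update_combine_inr S s k hk, combine_inr S s k hk]
  | seq _ _ ih1 ih2 =>
    intro ι exit hι o
    simp only [width, max_le_iff] at hw
    obtain ⟨n, hn, o1, h1⟩ := ih1 hw.1 _ _ (fun l => hι (Sum.inl l)) o
    obtain ⟨n', hn', o2, h2⟩ := ih2 hw.2 _ _ (fun l => hι (Sum.inr l)) o1
    exact ⟨n + n', by omega, o2, h1.trans h2⟩
  | @exit k body cont s s' t hc _ ih =>
    intro ι exit hι o
    have hk : k < B := lt_of_lt_of_le (by simp [width]) hw
    obtain ⟨n, hn, o1, h1⟩ := ih ((width_body_le k body cont _).trans hw) _ _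
      (fun l => hι (some ⟨_, l⟩)) (s k).head?
    refine ⟨1 + n, by omega, o1, ReachesIn.trans (ReachesIn.single ?_) (by simpa [hc] using h1)⟩
    simp only [TM2.step, hι, machineCode, TM2.stepAux, entry]
    rw [update_combine_inr S s k hk, combine_inr S s k hk]
  | @cont k body cont s s' s'' t t' hc _ _ ih1 ih2 =>
    intro ι exit hι o
    have hk : k < B := lt_of_lt_of_le (by simp [width]) hw
    obtain ⟨n, hn, o1, h1⟩ := ih1 ((width_body_le k body cont _).trans hw) _ _
      (fun l => hι (some ⟨_, l⟩)) (s k).head?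
    obtain ⟨n', hn', o2, h2⟩ := ih2 hw _ _ hι o1
    refine ⟨1 + n + n', by omega, o2,
      ReachesIn.trans (ReachesIn.trans (ReachesIn.single ?_) (by simpa [hc, entry] using h1)) h2⟩
    simp only [TM2.step, hι, machineCode, TM2.stepAux, entry]
    rw [update_combine_inr S s k hk, combine_inr S s k hk]
  | mono _ hle ih =>
    intro ι exit hι o
    obtain ⟨n, hn, h⟩ := ih hw ι exit hι o
    exact ⟨n, hn.trans hle, h⟩

/-! ### Embedding of a machine into a machine with more stacks -/

/-- A statement of a machine as a statement of a larger machine that jumps to `l₀` instead of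
halting. -/
def liftStmt {Λ₀ Λ : Type} (ι : Λ₀ → Λ) (l₀ : Λ) :
    TM2.Stmt Γ₀ Λ₀ σ₀ → TM2.Stmt (AddStacks Γ₀ B) Λ (σ₀ × Option Bool)
  | .push k f q => .push (Sum.inl k) (fun v => f v.1) (liftStmt ι l₀ q)
  | .peek k f q => .peek (Sum.inl k) (fun v x => (f v.1 x, v.2)) (liftStmt ι l₀ q)
  | .pop k f q => .pop (Sum.inl k) (fun v x => (f v.1 x, v.2)) (liftStmt ι l₀ q)
  | .load f q => .load (fun v => (f v.1, v.2)) (liftStmt ι l₀ q)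
  | .branch f q q' => .branch (fun v => f v.1) (liftStmt ι l₀ q) (liftStmt ι l₀ q')
  | .goto f => .goto fun v => ι (f v.1)
  | .halt => .goto fun _ => l₀

def liftCfg {Λ₀ Λ : Type} (ι : Λ₀ → Λ) (l₀ : Λ) (c : TM2.Cfg Γ₀ Λ₀ σ₀) :
    TM2.Cfg (AddStacks Γ₀ B) Λ (σ₀ × Option Bool) :=
  ⟨some (c.l.elim l₀ ι), (c.var, none), combine c.stk fun _ => []⟩

omit [NeZero B] in
theorem stepAux_liftStmt {Λ₀ Λ : Type} (ι : Λ₀ → Λ) (l₀ : Λ) (q : TM2.Stmt Γ₀ Λ₀ σ₀) (v : σ₀)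
    (S : ∀ k, List (Γ₀ k)) :
    TM2.stepAux (liftStmt (B := B) ι l₀ q) (v, none) (combine S fun _ => []) =
      liftCfg ι l₀ (TM2.stepAux q v S) := by
  induction q generalizing v S with
  | push k f q ih =>
    simp only [liftStmt, TM2.stepAux]
    rw [update_combine_inl, ← ih]
    rfl
  | peek k f q ih => simp only [liftStmt, TM2.stepAux]; rw [← ih]; rfl
  | pop k f q ih =>
    simp only [liftStmt, TM2.stepAux]
    rw [update_combine_inl, ← ih]
    rfl
  | load f q ih => simp only [liftStmt, TM2.stepAux]; rw [← ih]
  | branch f q q' ih ih' =>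
    simp only [liftStmt, TM2.stepAux]
    cases f v <;> simp [ih, ih']
  | goto f => rfl
  | halt => rfl

-- A halted configuration is sent to the label `l₀`, so halting costs no additional step and the
-- step count is preserved exactly.
omit [NeZero B] in
theorem ReachesIn.lift {Λ₀ Λ : Type} (ι : Λ₀ → Λ) (l₀ : Λ) (m₀ : Λ₀ → TM2.Stmt Γ₀ Λ₀ σ₀)
    (m : Λ → TM2.Stmt (AddStacks Γ₀ B) Λ (σ₀ × Option Bool))
    (hm : ∀ l, m (ι l) = liftStmt ι l₀ (m₀ l)) {t : ℕ} {c c' : TM2.Cfg Γ₀ Λ₀ σ₀}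
    (h : ReachesIn (TM2.step m₀) t c c') :
    ReachesIn (TM2.step m) t (liftCfg ι l₀ c) (liftCfg ι l₀ c') := by
  induction t generalizing c with
  | zero =>
    simp only [ReachesIn, iterate_zero, id_eq, Option.some.injEq] at h ⊢
    rw [h]
  | succ t ih =>
    obtain ⟨b, hb, hbc⟩ := h.succ_inv
    rw [add_comm]
    refine ReachesIn.trans (ReachesIn.single ?_) (ih hbc)
    obtain ⟨_ | l, v, S⟩ := c
    · cases hb
    · simp only [TM2.step, Option.some.injEq] at hb
      subst hb
      simp only [liftCfg, Option.elim_some, TM2.step, hm]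
      exact congrArg some (stepAux_liftStmt ι l₀ _ _ _)

/-! ### The length of the output of a machine -/

def pushCount {K : Type} {Γ : K → Type} {Λ σ : Type} : TM2.Stmt Γ Λ σ → ℕ
  | .push _ _ q => pushCount q + 1
  | .peek _ _ q => pushCount q
  | .pop _ _ q => pushCount q
  | .load _ q => pushCount q
  | .branch _ q q' => max (pushCount q) (pushCount q')
  | .goto _ => 0
  | .halt => 0

omit [NeZero B] in
theorem length_stepAux_le {Λ : Type} (q : TM2.Stmt Γ₀ Λ σ₀) (v : σ₀) (S : ∀ k, List (Γ₀ k))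
    (j : K₀) : ((TM2.stepAux q v S).stk j).length ≤ (S j).length + pushCount q := by
  induction q generalizing v S with
  | push k f q ih =>
    simp only [TM2.stepAux, pushCount]
    refine (ih _ _).trans ?_
    by_cases h : j = k
    · subst h; simp; omega
    · rw [update_of_ne h]; omega
  | peek k f q ih => exact ih _ _
  | pop k f q ih =>
    simp only [TM2.stepAux, pushCount]
    refine (ih _ _).trans ?_
    by_cases h : j = k
    · subst h; simp
    · rw [update_of_ne h]
  | load f q ih => exact ih _ _
  | branch f q q' ih ih' =>
    simp only [TM2.stepAux, pushCount]
    cases f v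
    · exact (ih' _ _).trans (by simp)
    · exact (ih _ _).trans (by simp)
  | goto f => simp [TM2.stepAux, pushCount]
  | halt => simp [TM2.stepAux, pushCount]

omit [NeZero B] in
theorem ReachesIn.length_le {Λ : Type} (m : Λ → TM2.Stmt Γ₀ Λ σ₀) (C : ℕ)
    (hC : ∀ l, pushCount (m l) ≤ C) {t : ℕ} {c c' : TM2.Cfg Γ₀ Λ σ₀}
    (h : ReachesIn (TM2.step m) t c c') (j : K₀) :
    (c'.stk j).length ≤ (c.stk j).length + C * t := by
  induction t generalizing c with
  | zero =>
    simp only [ReachesIn, iterate_zero, id_eq, Option.some.injEq] at h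
    simp [h]
  | succ t ih =>
    obtain ⟨b, hb, hbc⟩ := h.succ_inv
    refine (ih hbc).trans ?_
    obtain ⟨_ | l, v, S⟩ := c
    · cases hb
    · simp only [TM2.step, Option.some.injEq] at hb
      subst hb
      have := length_stepAux_le (m l) v S j
      have := hC l
      simp only [mul_add, mul_one]
      omega

end Machine


/-! ### A machine followed by a program -/

/-- The code of a machine that runs `M`, moves its output to an additional stack (which reverses
it), and then executes `p`. -/
def thenProgCode (M : FinTM2) (e : M.Γ M.k₁ ≃ Bool) (p : Prog) : M.Λ ⊕ Option p.Lab →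
    TM2.Stmt (AddStacks M.Γ (p.width + 2)) (M.Λ ⊕ Option p.Lab) (M.σ × Option Bool)
  | Sum.inl l => liftStmt Sum.inl (Sum.inr none) (M.m l)
  | Sum.inr none =>
    .pop (Sum.inl M.k₁) (fun v x => (v.1, x.map e)) <|
      .branch (fun v => v.2.isSome)
        (.push (Sum.inr (Fin.ofNat (p.width + 2) 0)) (fun v => v.2.getD false) <|
          .goto fun _ => Sum.inr none)
        (.goto fun _ => Sum.inr (some p.entry))
  | Sum.inr (some l) =>
    p.machineCode (fun l => Sum.inr (some l)) (.load (fun _ => (M.initialState, none)) .halt) l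

noncomputable def thenProg (M : FinTM2) (e : M.Γ M.k₁ ≃ Bool) (p : Prog) : FinTM2 :=
  letI := M.kFin
  letI := M.ΛFin
  letI := M.σFin
  { K := M.K ⊕ Fin (p.width + 2)
    k₀ := Sum.inl M.k₀
    k₁ := Sum.inr (Fin.ofNat (p.width + 2) 1)
    Γ := AddStacks M.Γ (p.width + 2)
    Λ := M.Λ ⊕ Option p.Lab
    main := Sum.inl M.main
    σ := M.σ × Option Bool
    initialState := (M.initialState, none)
    Γk₀Fin := M.Γk₀Fin
    m := thenProgCode M e p }

theorem stk_initList (M : FinTM2) (x : List (M.Γ M.k₀)) :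
    (initList M x).stk = update (fun _ => []) M.k₀ x := by
  funext k
  by_cases h : k = M.k₀
  · subst h; simp [initList]
  · simp [initList, h]

theorem stk_haltList (M : FinTM2) (x : List (M.Γ M.k₁)) :
    (haltList M x).stk = update (fun _ => []) M.k₁ x := by
  funext k
  by_cases h : k = M.k₁
  · subst h; simp [haltList]
  · simp [haltList, h]

theorem initList_eq (M : FinTM2) (x : List (M.Γ M.k₀)) :
    initList M x = (⟨some M.main, M.initialState, update (fun _ => []) M.k₀ x⟩ : TM2.Cfg _ _ _) := by
  rw [← stk_initList]; rfl

theorem haltList_eq (M : FinTM2) (x : List (M.Γ M.k₁)) :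
    haltList M x = (⟨none, M.initialState, update (fun _ => []) M.k₁ x⟩ : TM2.Cfg _ _ _) := by
  rw [← stk_haltList]; rfl

theorem combine_nil {K₀ : Type} {Γ₀ : K₀ → Type} {B : ℕ} :
    combine (Γ₀ := Γ₀) (B := B) (fun _ => []) (fun _ => []) = fun _ => [] := by
  funext k
  rcases k with k | k <;> rfl

/-- One step per symbol and one more to find the stack empty. The contents `z` and the bit `o` are
arbitrary to make the induction go through. -/
theorem reachesIn_transfer (M : FinTM2) (e : M.Γ M.k₁ ≃ Bool) (p : Prog) (y z : List Bool)
    (o : Option Bool) :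
    ∃ o', ReachesIn (TM2.step (thenProgCode M e p)) (y.length + 1)
      ⟨some (Sum.inr none), (M.initialState, o),
        combine (update (fun _ => []) M.k₁ (y.map e.symm)) (update (fun _ => []) 0 z)⟩
      ⟨some (Sum.inr (some p.entry)), (M.initialState, o'),
        combine (fun _ => []) (update (fun _ => []) 0 (y.reverse ++ z))⟩ := by
  induction y generalizing z o with
  | nil =>
    refine ⟨none, ReachesIn.single ?_⟩
    simp only [TM2.step, thenProgCode, TM2.stepAux]
    rw [update_combine_inl]
    simp [combine]
  | cons b y ih =>
    obtain ⟨o', ih⟩ := ih (b :: z) (some b)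
    refine ⟨o', ?_⟩
    rw [List.length_cons, add_comm (y.length + 1)]
    rw [show (b :: y).reverse ++ z = y.reverse ++ b :: z by simp]
    refine ReachesIn.trans (ReachesIn.single ?_) ih
    simp only [TM2.step, thenProgCode, TM2.stepAux]
    rw [update_combine_inl, update_combine_inr _ _ _ (by omega), combine_inr _ _ _ (by omega)]
    simp [combine]

theorem thenProg_outputs (M : FinTM2) (e : M.Γ M.k₁ ≃ Bool) (p : Prog) {x : List (M.Γ M.k₀)}
    {y z : List Bool} {T t : ℕ}
    (h : Nonempty (TM2OutputsInTime M x (some (y.map e.symm)) T))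
    (hp : p.Exec (update (fun _ => []) 0 y.reverse) t (update (fun _ => []) 1 z)) :
    Nonempty (TM2OutputsInTime (thenProg M e p) x (some z) (T + (y.length + 1) + t)) := by
  obtain ⟨⟨⟨n, hn⟩, hnT⟩⟩ := h
  have h1 : ReachesIn (TM2.step M.m) n
      ⟨some M.main, M.initialState, update (fun _ => []) M.k₀ x⟩
      ⟨none, M.initialState, update (fun _ => []) M.k₁ (y.map e.symm)⟩ := by
    rw [← initList_eq, ← haltList_eq]
    exact hn
  have h2 := h1.lift (B := p.width + 2) (Sum.inl : M.Λ → M.Λ ⊕ Option p.Lab) (Sum.inr none)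
    M.m (thenProgCode M e p) (fun _ => rfl)
  obtain ⟨o, h3⟩ := reachesIn_transfer M e p y [] none
  obtain ⟨n', hn', o', h4⟩ := hp.reaches (B := p.width + 2) (thenProgCode M e p) (fun _ => [])
    M.initialState (by omega) (fun l => Sum.inr (some l)) _ (fun _ => rfl) o
  rw [List.append_nil] at h3
  simp only [liftCfg, Option.elim_some, Option.elim_none] at h2
  have h0 : update (fun _ => []) 0 [] = fun _ : ℕ => ([] : List Bool) := update_eq_self _ _
  rw [h0] at h3
  have h5 := (h2.trans h3).trans h4
  simp only [TM2.stepAux] at h5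
  -- The halting configuration must have the initial internal state and no contents outside the
  -- output stack, which is why the exit statement reloads the state and the program leaves only
  -- register `1` filled.
  rw [← update_combine_inr _ _ _ (by omega), ← update_combine_inl, combine_nil] at h5
  have h6 : n + (y.length + 1) + n' ≤ T + (y.length + 1) + t :=
    Nat.add_le_add (Nat.add_le_add_right hnT _) hn'
  refine ⟨⟨⟨n + (y.length + 1) + n', ?_⟩, h6⟩⟩
  exact (congrArg (fun c => (flip bind (thenProg M e p).step)^[n + (y.length + 1) + n'] (some c))
    (initList_eq (thenProg M e p) x)).trans
      (Eq.trans h5 (congrArg some (haltList_eq (thenProg M e p) z).symm))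

/-- A step pushes a bounded number of symbols. This controls the length of the intermediate word, in
terms of which the running time of the subsequent program is measured. -/
theorem exists_output_length_le (M : FinTM2) : ∃ C : ℕ, ∀ (x : List (M.Γ M.k₀))
    (y : List (M.Γ M.k₁)) (T : ℕ), Nonempty (TM2OutputsInTime M x (some y) T) →
      y.length ≤ x.length + C * T := by
  let := M.ΛFin
  refine ⟨Finset.univ.sup fun l => pushCount (M.m l), fun x y T ⟨⟨⟨n, hn⟩, hnT⟩⟩ => ?_⟩
  rw [Option.map_some, initList_eq, haltList_eq] at hn
  have := ReachesIn.length_le M.m _ (fun l => Finset.le_sup (f := fun l => pushCount (M.m l))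
    (Finset.mem_univ l)) hn M.k₁
  simp only [update_self] at this
  refine this.trans (Nat.add_le_add ?_ (Nat.mul_le_mul_left _ hnT))
  generalize M.k₁ = j
  by_cases h : j = M.k₀
  · subst h; simp
  · rw [update_of_ne h]; simp

end MinSat

/-! ### Unary arithmetic and list access on registers -/

namespace MinSat

open Function

/-! ### Basic programs -/

/-- The number `n` in unary, as the contents of a register. -/
abbrev unary (n : ℕ) : List Bool := List.replicate n true

theorem unary_succ_eq_append (n : ℕ) (l : List Bool) : unary (n + 1) ++ l = unary n ++ true :: l := by
  rw [unary, List.replicate_succ', List.append_assoc]; rfl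

namespace Prog

theorem Exec.congr {p : Prog} {s s' s₁ s₁' : ℕ → List Bool} {t t' : ℕ} (h : p.Exec s t s')
    (hs : s₁ = s) (ht : t ≤ t') (hs' : s₁' = s') : p.Exec s₁ t' s₁' := by
  subst hs hs'; exact h.mono ht

/-- While a `1` can be popped from the register `k`, execute `p`. -/
def whileTrue (k : ℕ) (p : Prog) : Prog :=
  loop k (fun o => match o with | some true => p | _ => skip) (fun o => o == some true)

/-- `inv i` is the state after `i` rounds up to register `k`, which holds the rounds still to come;
the body must therefore work for every content `c` of it. The final 2 pays for the unsuccessful pop.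
-/
theorem exec_whileTrue (k : ℕ) (p : Prog) (T n : ℕ) (inv : ℕ → ℕ → List Bool)
    (h : ∀ i < n, ∀ c, p.Exec (update (inv i) k c) T (update (inv (i + 1)) k c)) :
    (whileTrue k p).Exec (update (inv 0) k (unary n)) (n * (T + 1) + 2)
      (update (inv n) k []) := by
  induction n generalizing inv with
  | zero =>
    refine (Exec.exit (t := 1) ?_ ?_).mono (by omega)
    · simp
    · simpa using Exec.skip (update (inv 0) k [])
  | succ n ih =>
    have h2 := ih (fun i => inv (i + 1)) fun i hi c => h (i + 1) (by omega) c
    refine (Exec.cont (t := T) (s' := update (inv 1) k (unary n)) ?_ ?_ h2).mono ?_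
    · simp [List.replicate_succ]
    · simpa [List.replicate_succ] using h 0 (by omega) (unary n)
    · rw [add_mul]; omega

theorem exec_pop (k : ℕ) (s : ℕ → List Bool) :
    (loop k (fun _ => skip) (fun _ => false)).Exec s 2 (update s k (s k).tail) :=
  Exec.exit (t := 1) rfl (Exec.skip _)

/-- Add the number in register `a` to that in register `b`. -/
theorem exec_move {a b : ℕ} (hab : a ≠ b) (s : ℕ → List Bool) (n : ℕ) (hs : s a = unary n) :
    (whileTrue a (push b true)).Exec s (n * 2 + 2)
      (update (update s a []) b (unary n ++ s b)) := by
  refine (exec_whileTrue a _ 1 n (fun i => update s b (unary i ++ s b)) fun i _ c => ?_).congr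
    ?_ le_rfl ?_
  · refine (Exec.push b true _).congr rfl le_rfl ?_
    funext k
    simp only [update_apply]
    split_ifs <;> simp_all [List.replicate_succ]
  · simp [← hs]
  · rw [update_comm hab]

theorem exec_clear (a : ℕ) (s : ℕ → List Bool) (n : ℕ) (hs : s a = unary n) :
    (whileTrue a skip).Exec s (n * 2 + 2) (update s a []) := by
  refine (exec_whileTrue a _ 1 n (fun _ => s) fun i _ c => Exec.skip _).congr ?_ le_rfl rfl
  simp [← hs]

/-- Copy the number in register `a` to the empty register `r`, using the empty register `r + 1`. -/
def copy (a r : ℕ) : Prog :=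
  seq (whileTrue a (seq (push r true) (push (r + 1) true))) (whileTrue (r + 1) (push a true))

theorem exec_copy {a r : ℕ} (har : a < r) (s : ℕ → List Bool) (n : ℕ) (hs : s a = unary n)
    (hr : s r = []) (hr' : s (r + 1) = []) :
    (copy a r).Exec s (n * 5 + 4) (update s r (unary n)) := by
  have h1 : (whileTrue a (seq (push r true) (push (r + 1) true))).Exec s (n * 3 + 2)
      (update (update (update s (r + 1) (unary n)) r (unary n)) a []) := by
    refine (exec_whileTrue a _ 2 n
      (fun i => update (update s (r + 1) (unary i)) r (unary i)) fun i _ c => ?_).congr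
      ?_ le_rfl rfl
    · refine ((Exec.push r true _).seq (Exec.push (r + 1) true _)).congr rfl le_rfl ?_
      funext k
      simp only [update_apply]
      split_ifs <;> first | omega | simp_all [List.replicate_succ]
    · funext k
      simp only [update_apply]
      split_ifs <;> simp_all
  refine (h1.seq (exec_move (by omega) _ n (by simp [update_apply]; omega))).congr rfl
    (by omega) ?_
  funext k
  simp only [update_apply]
  split_ifs <;> first | omega | simp_all

/-- Move the bits of register `a` to register `b`, in reverse order. -/
def moveBits (a b : ℕ) : Prog :=
  loop a (fun o => match o with | none => skip | some x => push b x) Option.isSome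

theorem exec_moveBits {a b : ℕ} (hab : a ≠ b) (l : List Bool) (s : ℕ → List Bool)
    (hs : s a = l) :
    (moveBits a b).Exec s (l.length * 2 + 2) (update (update s a []) b (l.reverse ++ s b)) := by
  induction l generalizing s with
  | nil =>
    refine (Exec.exit (t := 1) (s' := update s a []) (by simp [hs]) ?_).congr rfl (by simp) ?_
    · simpa [hs] using Exec.skip (update s a [])
    · funext k
      simp only [update_apply]
      split_ifs <;> simp_all
  | cons x l ih =>
    have h1 : (push b x).Exec (update s a l) 1 (update (update s a l) b (x :: s b)) := by
      refine (Exec.push b x _).congr rfl le_rfl ?_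
      rw [update_of_ne hab.symm]
    refine (Exec.cont (t := 1) (by simp [hs]) (by simpa [hs] using h1)
      (ih _ (by simp [hab]))).congr rfl (by simp; omega) ?_
    funext k
    simp only [update_apply]
    split_ifs <;> simp_all

end Prog

/-! ### Reading entries of the input -/

theorem encNats_cons (a : ℕ) (w : List ℕ) : encNats (a :: w) = unary a ++ false :: encNats w := by
  simp [encNats]

theorem encNats_append (v w : List ℕ) : encNats (v ++ w) = encNats v ++ encNats w := by
  simp [encNats]

theorem mem_lt_length_encNats {a : ℕ} {w : List ℕ} (h : a ∈ w) : a < (encNats w).length := by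
  induction w with
  | nil => cases h
  | cons b w ih =>
    rw [encNats_cons]
    rcases List.mem_cons.1 h with rfl | h
    · simp
    · have := ih h
      simp; omega

theorem length_le_length_encNats (w : List ℕ) : w.length ≤ (encNats w).length := by
  induction w with
  | nil => simp
  | cons b w ih => rw [encNats_cons]; simp; omega

namespace Prog

/-- Move a block of `1`s and the following `0` from register `0` to register `1`, executing `p`
for each bit. -/
def moveBlock (p : Prog) : Prog :=
  loop 0 (fun o => match o with | none => skip | some x => seq (push 1 x) p)
    (fun o => o == some true)

/-- The body runs for the closing zero as well, hence `a + 1` times. This is why `lookup` produces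
the entry plus one, which leaves `0` for a missing entry. -/
theorem exec_moveBlock (p : Prog) (T a : ℕ) (w : List ℕ) (z : List Bool)
    (inv : ℕ → ℕ → List Bool)
    (h : ∀ i ≤ a, ∀ x y, p.Exec (update (update (inv i) 0 x) 1 y) T
      (update (update (inv (i + 1)) 0 x) 1 y)) :
    (moveBlock p).Exec (update (update (inv 0) 0 (encNats (a :: w))) 1 z) ((a + 1) * (T + 2))
      (update (update (inv (a + 1)) 0 (encNats w)) 1 (false :: unary a ++ z)) := by
  have step (b : Bool) (x) (inv : ℕ → ℕ → List Bool)
      (h : p.Exec (update (update (inv 0) 0 x) 1 (b :: z)) T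
        (update (update (inv 1) 0 x) 1 (b :: z))) :
      (seq (push 1 b) p).Exec (update (update (inv 0) 0 x) 1 z) (1 + T)
        (update (update (inv 1) 0 x) 1 (b :: z)) :=
    Exec.seq ((Exec.push 1 b _).congr rfl le_rfl (by simp)) h
  induction a generalizing inv z with
  | zero =>
    refine (Exec.exit (t := 1 + T)
      (s' := update (update (inv 1) 0 (encNats w)) 1 (false :: unary 0 ++ z)) (by simp [encNats_cons])
      ?_).congr rfl (by omega) rfl
    refine (step false (encNats w) inv (h 0 le_rfl _ _)).congr ?_ le_rfl rfl
    funext k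
    simp only [update_apply]
    split_ifs <;> simp_all [encNats_cons]
  | succ a ih =>
    refine (Exec.cont (t := 1 + T)
      (s' := update (update (inv 1) 0 (encNats (a :: w))) 1 (true :: z))
      (by simp [encNats_cons, List.replicate_succ])
      ?_ (ih (true :: z) (fun i => inv (i + 1)) (fun i hi => h (i + 1) (by omega)) ?_)).congr
      rfl (by rw [add_mul (a + 1)]; omega) ?_
    · refine (step true (encNats (a :: w)) inv (h 0 (by omega) _ _)).congr ?_ le_rfl rfl
      funext k
      simp only [update_apply]
      split_ifs <;> simp_all [encNats_cons, List.replicate_succ]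
    · intro b x inv h
      exact Exec.seq ((Exec.push 1 b _).congr rfl le_rfl (by simp)) h
    · rw [List.cons_append, List.cons_append, unary_succ_eq_append]

/-- Compute `w[y] + 1`, or `0` if `y` is not an index of `w`, where the encoding of `w` is in
register `0`, `y` in register `r`, and the result is put into register `r`. -/
def lookup (r : ℕ) : Prog :=
  seq (whileTrue r (moveBlock skip)) (seq (moveBlock (push r true)) (moveBits 1 0))

theorem exec_moveBlock_nil (p : Prog) (s : ℕ → List Bool) (h : s 0 = []) :
    (moveBlock p).Exec s 2 s := by
  refine (Exec.exit (t := 1) (s' := s) (by simp [h]) ?_).congr rfl le_rfl rfl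
  have : update s 0 [] = s := by rw [← h]; simp
  simpa [h, this] using Exec.skip s

theorem reverse_encNats_take_succ (w : List ℕ) (y : ℕ) (hy : y < w.length) :
    (encNats (w.take (y + 1))).reverse =
      false :: unary w[y] ++ (encNats (w.take y)).reverse := by
  rw [List.take_add_one, List.getElem?_eq_getElem hy, encNats_append]
  simp [encNats]

/-- Registers `0` and `1` are the unread part and the reversed read part of a tape. Beyond the end
nothing moves, in accordance with `take` and `drop`. -/
theorem exec_moveBlock_drop (w : List ℕ) (y : ℕ) (s : ℕ → List Bool) (T : ℕ)
    (hT : (encNats w).length ≤ T) (hs : s 0 = encNats (w.drop y))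
    (hs' : s 1 = (encNats (w.take y)).reverse) :
    (moveBlock skip).Exec s (T * 3 + 2)
      (update (update s 0 (encNats (w.drop (y + 1)))) 1 (encNats (w.take (y + 1))).reverse) := by
  by_cases hy : y < w.length
  · have hlt := mem_lt_length_encNats (List.getElem_mem hy)
    refine (exec_moveBlock skip 1 w[y] (w.drop (y + 1)) (s 1) (fun _ => s)
      fun _ _ _ _ => Exec.skip _).congr ?_ (by omega) ?_
    · rw [List.drop_eq_getElem_cons hy] at hs
      rw [← hs]; simp
    · rw [hs', reverse_encNats_take_succ w y hy]
  · rw [List.drop_eq_nil_of_le (by omega)] at hs ⊢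
    rw [List.take_of_length_le (by omega)] at hs' ⊢
    refine (exec_moveBlock_nil skip s (by simp [hs, encNats])).congr rfl (by omega) ?_
    rw [← hs', ← hs]
    simp

/-- After `y` blocks have been skipped, the next one is counted into `r`; moving the bits back
restores the input. -/
theorem exec_lookup (w : List ℕ) (y r T : ℕ) (hr : 2 ≤ r) (s : ℕ → List Bool)
    (hT : (encNats w).length ≤ T) (hy : y ≤ T) (hs : s 0 = encNats w) (hs' : s 1 = [])
    (hsr : s r = unary y) :
    (lookup r).Exec s (T * (T * 3 + 3) + T * 6 + 10)
      (update s r (unary ((w[y]?.map (· + 1)).getD 0))) := by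
  have h1 : (whileTrue r (moveBlock skip)).Exec s (T * (T * 3 + 3) + 2)
      (update (update (update s 0 (encNats (w.drop y))) 1 (encNats (w.take y)).reverse) r []) := by
    refine (exec_whileTrue r _ (T * 3 + 2) y (fun i =>
      update (update s 0 (encNats (w.drop i))) 1 (encNats (w.take i)).reverse)
      fun i _ c => ?_).congr ?_ (by gcongr) rfl
    · refine (exec_moveBlock_drop w i _ T hT ?_ ?_).congr rfl le_rfl ?_
      · simp [update_apply]; omega
      · simp [update_apply]; omega
      · funext k
        simp only [update_apply]
        split_ifs <;> first | omega | rfl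
    · funext k
      simp only [update_apply]
      split_ifs <;> simp_all [encNats]
  refine (h1.seq (Exec.seq (t := T * 3 + 5) (t' := T * 2 + 2)
    (s' := update (update (update s 0 (encNats (w.drop (y + 1)))) 1
      (encNats (w.take (y + 1))).reverse) r (unary ((w[y]?.map (· + 1)).getD 0))) ?_ ?_)).congr
        rfl (by omega) rfl
  · by_cases hy : y < w.length
    · have hlt := mem_lt_length_encNats (List.getElem_mem hy)
      refine (exec_moveBlock (push r true) 1 w[y] (w.drop (y + 1)) (encNats (w.take y)).reverse
        (fun i => update s r (unary i)) fun i _ x z => ?_).congr ?_ (by omega) ?_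
      · refine (Exec.push r true _).congr rfl le_rfl ?_
        funext k
        simp only [update_apply]
        split_ifs <;> first | omega | simp_all [List.replicate_succ]
      · rw [List.drop_eq_getElem_cons hy]
        funext k
        simp only [update_apply]
        split_ifs <;> first | omega | simp_all
      · rw [reverse_encNats_take_succ w y hy, List.getElem?_eq_getElem hy]
        funext k
        simp only [update_apply]
        split_ifs <;> first | omega | simp
    · rw [List.drop_eq_nil_of_le (by omega), List.drop_eq_nil_of_le (by omega),
        List.take_of_length_le (by omega), List.take_of_length_le (by omega),
        List.getElem?_eq_none (by omega)]
      refine (exec_moveBlock_nil _ _ ?_).congr rfl (by omega) ?_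
      · simp only [update_apply]
        split_ifs <;> first | omega | contradiction | simp [encNats]
      · simp
  · have hl : (encNats (w.take (y + 1))).length ≤ T := by
      refine le_trans ?_ hT
      conv_rhs => rw [← List.take_append_drop (y + 1) w, encNats_append, List.length_append]
      omega
    refine (exec_moveBits (by omega) (encNats (w.take (y + 1))).reverse _ ?_).congr rfl ?_ ?_
    · simp only [update_apply]
      split_ifs <;> first | omega | rfl
    · simp; omega
    · funext k
      simp only [update_apply]
      split_ifs <;> first | omega | simp_all [← encNats_append]

end Prog

end MinSat

/-! ### Expressions evaluated in polynomial time -/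

namespace MinSat

open Function

/-! ### Polynomially bounded functions -/

/-- The base is at least 2, so that constants and sums can be absorbed by a larger exponent. -/
def PolyBdd (f : ℕ → ℕ) : Prop :=
  ∃ c, ∀ B, f B ≤ (B + 2) ^ c

namespace PolyBdd

theorem const (n : ℕ) : PolyBdd fun _ => n :=
  ⟨n, fun B => (Nat.lt_two_pow_self (n := n)).le.trans (Nat.pow_le_pow_left (by omega) n)⟩

theorem id : PolyBdd fun B => B :=
  ⟨1, fun B => by simp⟩

theorem mul {f g : ℕ → ℕ} (hf : PolyBdd f) (hg : PolyBdd g) : PolyBdd fun B => f B * g B := by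
  obtain ⟨c, hc⟩ := hf
  obtain ⟨d, hd⟩ := hg
  exact ⟨c + d, fun B => by rw [pow_add]; exact Nat.mul_le_mul (hc B) (hd B)⟩

theorem add {f g : ℕ → ℕ} (hf : PolyBdd f) (hg : PolyBdd g) : PolyBdd fun B => f B + g B := by
  obtain ⟨c, hc⟩ := hf
  obtain ⟨d, hd⟩ := hg
  refine ⟨c + d + 1, fun B => ?_⟩
  have h1 : (B + 2) ^ c ≤ (B + 2) ^ (c + d) := Nat.pow_le_pow_right (by omega) (by omega)
  have h2 : (B + 2) ^ d ≤ (B + 2) ^ (c + d) := Nat.pow_le_pow_right (by omega) (by omega)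
  have h3 : (B + 2) ^ (c + d) * 2 ≤ (B + 2) ^ (c + d + 1) := by
    rw [pow_succ]
    exact Nat.mul_le_mul_left _ (by omega)
  have h4 := hc B
  have h5 := hd B
  show f B + g B ≤ _
  omega

theorem comp {f g : ℕ → ℕ} (hf : PolyBdd f) (hg : PolyBdd g) : PolyBdd fun B => f (g B) := by
  obtain ⟨c, hc⟩ := hf
  obtain ⟨d, hd⟩ := hg.add (const 2)
  exact ⟨d * c, fun B => (hc _).trans (by rw [pow_mul]; exact Nat.pow_le_pow_left (hd B) c)⟩

end PolyBdd

/-! ### Expressions -/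

/-- Numerical expressions over an input `w : List ℕ` and an environment (a list of numbers, in
which variables are de Bruijn indices). `sum n b` is `∑ i < n, b i`; `get a` is `w[a] + 1` if
`w[a]` exists and `0` otherwise; `size` is the length of the encoding of `w`; `countdown n b` is
the value after `n` steps of a counter that starts at `0`, is set to `b i` in step `i` if it is
`0`, and decreases by `1` otherwise. -/
inductive Expr
  | var (i : ℕ)
  | const (c : ℕ)
  | add (a b : Expr)
  | sub (a b : Expr)
  | sum (n b : Expr)
  | get (a : Expr)
  | countdown (n b : Expr)
  | size

def countdownVal (b : ℕ → ℕ) : ℕ → ℕ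
  | 0 => 0
  | n + 1 => if countdownVal b n = 0 then b n else countdownVal b n - 1

theorem countdownVal_le (b : ℕ → ℕ) (n C : ℕ) (h : ∀ i < n, b i ≤ C) : countdownVal b n ≤ C := by
  induction n with
  | zero => simp [countdownVal]
  | succ n ih =>
    have h1 := ih fun i hi => h i (by omega)
    have h2 := h n (by omega)
    rw [countdownVal]
    split_ifs <;> omega

namespace Expr

def eval (w : List ℕ) : Expr → List ℕ → ℕ
  | var i, env => env[i]?.getD 0
  | const c, _ => c
  | add a b, env => a.eval w env + b.eval w env
  | sub a b, env => a.eval w env - b.eval w env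
  | sum n b, env => ∑ i ∈ Finset.range (n.eval w env), b.eval w (i :: env)
  | get a, env => (w[a.eval w env]?.map (· + 1)).getD 0
  | countdown n b, env => countdownVal (fun i => b.eval w (i :: env)) (n.eval w env)
  | size, _ => (encNats w).length

/-- A bound on the value of an expression if `B` bounds the input length and the variables. -/
def bound : Expr → ℕ → ℕ
  | var _, B => B
  | const c, _ => c
  | add a b, B => a.bound B + b.bound B
  | sub a _, B => a.bound B
  | sum n b, B => n.bound B * b.bound (B + n.bound B)
  | get _, B => B
  | countdown n b, B => b.bound (B + n.bound B)
  | size, B => B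

/-- A variable bound by `sum` or `countdown` stays below `n.bound B`, so the body is estimated with
`B + n.bound B` in place of `B`. -/
theorem eval_le_bound (w : List ℕ) (e : Expr) (env : List ℕ) (B : ℕ)
    (hw : (encNats w).length ≤ B) (henv : ∀ v ∈ env, v ≤ B) : e.eval w env ≤ e.bound B := by
  have hcons (env : List ℕ) (B N i : ℕ) (henv : ∀ v ∈ env, v ≤ B) (hi : i < N) :
      ∀ v ∈ i :: env, v ≤ B + N := by
    intro v hv
    rcases List.mem_cons.1 hv with rfl | hv
    · omega
    · have := henv v hv; omega
  induction e generalizing env B with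
  | var i =>
    simp only [eval, bound]
    cases h : env[i]? with
    | none => simp
    | some v => simpa using henv v (List.mem_of_getElem? h)
  | const c => exact le_rfl
  | add a b iha ihb => exact Nat.add_le_add (iha _ _ hw henv) (ihb _ _ hw henv)
  | sub a b iha _ => exact (Nat.sub_le _ _).trans (iha _ _ hw henv)
  | sum n b ihn ihb =>
    simp only [eval, bound]
    have hn := ihn _ _ hw henv
    refine (Finset.sum_le_card_nsmul _ _ (b.bound (B + n.bound B)) fun i hi => ?_).trans ?_
    · exact ihb _ _ (by omega) (hcons _ _ _ _ henv ((Finset.mem_range.1 hi).trans_le hn))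
    · simpa using Nat.mul_le_mul_right _ hn
  | get a iha =>
    simp only [eval, bound]
    cases h : w[a.eval w env]? with
    | none => simp
    | some v => simpa using (mem_lt_length_encNats (List.mem_of_getElem? h)).trans_le hw
  | countdown n b ihn ihb =>
    simp only [eval, bound]
    have hn := ihn _ _ hw henv
    exact countdownVal_le _ _ _ fun i hi =>
      ihb _ _ (by omega) (hcons _ _ _ _ henv (hi.trans_le hn))
  | size => exact hw

theorem polyBdd_bound (e : Expr) : PolyBdd e.bound := by
  induction e with
  | var i => exact PolyBdd.id
  | const c => exact PolyBdd.const c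
  | add a b iha ihb => exact iha.add ihb
  | sub a b iha _ => exact iha
  | sum n b ihn ihb => exact ihn.mul (ihb.comp (PolyBdd.id.add ihn))
  | get a _ => exact PolyBdd.id
  | countdown n b ihn ihb => exact ihb.comp (PolyBdd.id.add ihn)
  | size => exact PolyBdd.id

/-- A bound on the running time of the compiled expression. -/
def time : Expr → ℕ → ℕ
  | var _, B => B * 5 + 4
  | const c, _ => c + 1
  | add a b, B => a.time B + b.time B + (b.bound B * 2 + 2)
  | sub a b, B => a.time B + b.time B + (b.bound B * 3 + 2)
  | sum n b, B =>
    n.time B + (n.bound B * (b.time (B + n.bound B) + b.bound (B + n.bound B) * 2 + 4) + 2) +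
      (n.bound B * 2 + 2) + (n.bound B * b.bound (B + n.bound B) * 2 + 2)
  | get a, B =>
    a.time B + ((B + a.bound B) * ((B + a.bound B) * 3 + 3) + (B + a.bound B) * 6 + 10)
  | countdown n b, B =>
    n.time B + (n.bound B * (b.time (B + n.bound B) + b.bound (B + n.bound B) * 2 + 5) + 2) +
      (n.bound B * 2 + 2) + (b.bound (B + n.bound B) * 2 + 2)
  | size, B => B * 5 + 4

theorem polyBdd_time (e : Expr) : PolyBdd e.time := by
  have c (n : ℕ) : PolyBdd fun _ => n := PolyBdd.const n
  induction e with
  | var i => exact (PolyBdd.id.mul (c 5)).add (c 4)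
  | const n => exact c _
  | add a b iha ihb => exact (iha.add ihb).add ((b.polyBdd_bound.mul (c 2)).add (c 2))
  | sub a b iha ihb => exact (iha.add ihb).add ((b.polyBdd_bound.mul (c 3)).add (c 2))
  | sum n b ihn ihb =>
    have hB := PolyBdd.id.add n.polyBdd_bound
    exact ((ihn.add ((n.polyBdd_bound.mul (((ihb.comp hB).add
      ((b.polyBdd_bound.comp hB).mul (c 2))).add (c 4))).add (c 2))).add
        ((n.polyBdd_bound.mul (c 2)).add (c 2))).add
          (((n.polyBdd_bound.mul (b.polyBdd_bound.comp hB)).mul (c 2)).add (c 2))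
  | get a iha =>
    have hB := PolyBdd.id.add a.polyBdd_bound
    exact iha.add (((hB.mul ((hB.mul (c 3)).add (c 3))).add (hB.mul (c 6))).add (c 10))
  | countdown n b ihn ihb =>
    have hB := PolyBdd.id.add n.polyBdd_bound
    exact ((ihn.add ((n.polyBdd_bound.mul (((ihb.comp hB).add
      ((b.polyBdd_bound.comp hB).mul (c 2))).add (c 5))).add (c 2))).add
        ((n.polyBdd_bound.mul (c 2)).add (c 2))).add
          (((b.polyBdd_bound.comp hB).mul (c 2)).add (c 2))
  | size => exact (PolyBdd.id.mul (c 5)).add (c 4)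

end Expr

open Prog

def Prog.pushes : ℕ → ℕ → Prog
  | 0, _ => skip
  | c + 1, r => seq (pushes c r) (push r true)

theorem Prog.exec_pushes (c r : ℕ) (s : ℕ → List Bool) (hr : s r = []) :
    (pushes c r).Exec s (c + 1) (update s r (unary c)) := by
  induction c with
  | zero => exact (Exec.skip s).congr rfl le_rfl (by rw [unary, List.replicate_zero, ← hr]; simp)
  | succ c ih => exact (ih.seq (Exec.push r true _)).congr rfl le_rfl
                   (by simp [List.replicate_succ])

/-- Compute the number of bits in register `0`. -/
def Prog.countBits (r : ℕ) : Prog :=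
  seq (loop 0 (fun o => match o with | none => skip | some x => seq (push 1 x) (push r true))
    Option.isSome) (moveBits 1 0)

theorem Prog.exec_countBits {r : ℕ} (hr : 2 ≤ r) (s : ℕ → List Bool) (h1 : s 1 = [])
    (hsr : s r = []) :
    (countBits r).Exec s ((s 0).length * 5 + 4) (update s r (unary (s 0).length)) := by
  have key (l : List Bool) (s : ℕ → List Bool) (h0 : s 0 = l) :
      (loop 0 (fun o => match o with | none => skip | some x => seq (push 1 x) (push r true))
        Option.isSome).Exec s (l.length * 3 + 2)
          (update (update (update s 0 []) 1 (l.reverse ++ s 1)) r (unary l.length ++ s r)) := by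
    induction l generalizing s with
    | nil =>
      refine (Exec.exit (t := 1) (s' := update s 0 []) (by simp [h0]) ?_).congr rfl (by simp) ?_
      · simpa [h0] using Exec.skip (update s 0 [])
      · funext k
        simp only [update_apply]
        split_ifs <;> first | omega | simp_all
    | cons x l ih =>
      have h2 : (seq (push 1 x) (push r true)).Exec (update s 0 l) 2
          (update (update (update s 0 l) 1 (x :: s 1)) r (true :: s r)) := by
        refine ((Exec.push 1 x _).seq (Exec.push r true _)).congr rfl le_rfl ?_
        funext k
        simp only [update_apply]
        split_ifs <;> first | omega | simp_all
      refine (Exec.cont (t := 2) (by simp [h0]) (by simpa [h0] using h2)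
        (ih _ (by simp only [update_apply]; split_ifs <;> first | omega | contradiction | rfl))).congr
          rfl (by simp; omega) ?_
      clear ih h2
      funext k
      simp only [update_apply]
      split_ifs <;> first | omega | simp_all [unary_succ_eq_append]
  refine ((key _ s rfl).seq (exec_moveBits (by omega) (s 0).reverse _ ?_)).congr rfl ?_ ?_
  · simp only [update_apply]
    split_ifs <;> first | omega | simp [h1]
  · simp; omega
  · funext k
    simp only [update_apply]
    split_ifs <;> first | omega | simp_all

namespace Expr

/-- A program that computes the expression into register `r`, where the variables are in the
registers `vars`, and the registers from `r` on are free. -/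
def compile : Expr → List ℕ → ℕ → Prog
  | var i, vars, r => match vars[i]? with
    | none => skip
    | some x => copy x r
  | const c, _, r => pushes c r
  | add a b, vars, r =>
    seq (a.compile vars r) (seq (b.compile vars (r + 1)) (whileTrue (r + 1) (push r true)))
  | sub a b, vars, r =>
    seq (a.compile vars r) (seq (b.compile vars (r + 1))
      (whileTrue (r + 1) (loop r (fun _ => skip) (fun _ => false))))
  | sum n b, vars, r =>
    seq (n.compile vars r) (seq
      (whileTrue r (seq (b.compile ((r + 1) :: vars) (r + 3))
        (seq (whileTrue (r + 3) (push (r + 2) true)) (push (r + 1) true))))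
      (seq (whileTrue (r + 1) skip) (whileTrue (r + 2) (push r true))))
  | get a, vars, r => seq (a.compile vars r) (lookup r)
  | countdown n b, vars, r =>
    seq (n.compile vars r) (seq
      (whileTrue r (seq
        (loop (r + 2) (fun o => match o with
          | none => seq (b.compile ((r + 1) :: vars) (r + 3))
              (whileTrue (r + 3) (push (r + 2) true))
          | some _ => skip) (fun _ => false))
        (push (r + 1) true)))
      (seq (whileTrue (r + 1) skip) (whileTrue (r + 2) (push r true))))
  | size, _, r => countBits r

end Expr

/-- The registers hold the input `w` (in register `0`) and the variables `env` (in the registers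
`vars`), and register `1` and the registers from `r` on are free. -/
structure Ready (w vars env : List ℕ) (r : ℕ) (s : ℕ → List Bool) : Prop where
  input : s 0 = encNats w
  aux : s 1 = []
  free : ∀ k, r ≤ k → s k = []
  three_le : 3 ≤ r
  vars : List.Forall₂ (fun x v => 3 ≤ x ∧ x < r ∧ s x = unary v) vars env

namespace Ready

variable {w vars env : List ℕ} {r : ℕ} {s : ℕ → List Bool}

theorem of_eq (h : Ready w vars env r s) {r' : ℕ} {s' : ℕ → List Bool} (hr : r ≤ r')
    (h1 : ∀ k < r, k ≠ 2 → s' k = s k) (h2 : ∀ k, r' ≤ k → s' k = []) :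
    Ready w vars env r' s' := by
  have h3 := h.three_le
  refine ⟨?_, ?_, h2, by omega, h.vars.imp fun x v hx => ⟨hx.1, by omega, ?_⟩⟩
  · rw [h1 0 (by omega) (by omega), h.input]
  · rw [h1 1 (by omega) (by omega), h.aux]
  · rw [h1 x hx.2.1 (by omega), hx.2.2]

theorem push (h : Ready w vars env r s) (l : List Bool) :
    Ready w vars env (r + 1) (update s r l) := by
  refine h.of_eq (by omega) (fun k hk _ => update_of_ne (by omega) _ _) fun k hk => ?_
  rw [update_of_ne (by omega), h.free k (by omega)]

theorem cons (h : Ready w vars env r s) {x v : ℕ} (hx : 3 ≤ x) (hxr : x < r)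
    (hs : s x = unary v) : Ready w (x :: vars) (v :: env) r s :=
  ⟨h.input, h.aux, h.free, h.three_le, h.vars.cons ⟨hx, hxr, hs⟩⟩

end Ready

/-- The state in the middle of a loop with index `i` and accumulated value `a`. -/
def foldState (s : ℕ → List Bool) (r i a : ℕ) : ℕ → List Bool :=
  update (update s (r + 1) (unary i)) (r + 2) (unary a)

theorem Ready.foldState {w vars env : List ℕ} {r : ℕ} {s : ℕ → List Bool}
    (h : Ready w vars env r s) (i a : ℕ) (c : List Bool) :
    Ready w ((r + 1) :: vars) (i :: env) (r + 3) (update (foldState s r i a) r c) := by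
  have h3 := h.three_le
  refine (h.of_eq (by omega) (fun k hk _ => ?_) (fun k hk => ?_)).cons (by omega) (by omega) ?_
  · simp only [MinSat.foldState, update_apply]; split_ifs <;> first | omega | rfl
  · have := h.free k (by omega)
    simp only [MinSat.foldState, update_apply]; split_ifs <;> omega
  · simp [MinSat.foldState]

theorem foldState_next {s : ℕ → List Bool} {r : ℕ} (hs : s (r + 3) = []) (i a v : ℕ)
    (c : List Bool) :
    update (foldState s r (i + 1) (a + v)) r c =
      update (update (update (update (update (foldState s r i a) r c) (r + 3) (unary v)) (r + 3) [])
        (r + 2) (unary v ++ unary a)) (r + 1) (true :: unary i) := by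
  funext k
  simp only [foldState, update_apply]
  split_ifs <;> first | omega | simp_all [List.replicate_succ, add_comm]

/-- Add the number in register `r + 3` to the accumulated value and increase the index. -/
theorem exec_foldState_next {s : ℕ → List Bool} {r : ℕ} (hs : s (r + 3) = []) (i a v : ℕ)
    (c : List Bool) :
    (seq (whileTrue (r + 3) (Prog.push (r + 2) true)) (Prog.push (r + 1) true)).Exec
      (update (update (foldState s r i a) r c) (r + 3) (unary v)) (v * 2 + 3)
      (update (foldState s r (i + 1) (a + v)) r c) := by
  refine ((exec_move (by omega) _ v (by simp)).seq (Exec.push (r + 1) true _)).congr rfl le_rfl ?_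
  rw [foldState_next hs]
  simp [foldState]

/-- The loop shared by `sum` and `countdown`: register `r` counts the remaining rounds, `r + 1`
holds the index and `r + 2` the accumulated value, which finally moves to `r` while the others are
emptied. -/
theorem exec_fold {s : ℕ → List Bool} {r : ℕ} (h1 : s (r + 1) = []) (h2 : s (r + 2) = [])
    (p : Prog) (N T : ℕ) (F : ℕ → ℕ) (h0 : F 0 = 0)
    (h : ∀ i < N, ∀ c, p.Exec (update (foldState s r i (F i)) r c) T
      (update (foldState s r (i + 1) (F (i + 1))) r c)) :
    (seq (whileTrue r p) (seq (whileTrue (r + 1) skip)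
      (whileTrue (r + 2) (Prog.push r true)))).Exec (update s r (unary N))
      (N * (T + 1) + 2 + (N * 2 + 2) + (F N * 2 + 2)) (update s r (unary (F N))) := by
  have h3 := exec_whileTrue r p T N (fun i => foldState s r i (F i)) h
  have h4 := exec_clear (r + 1) (update (foldState s r N (F N)) r []) N
    (by simp [foldState])
  have h5 := exec_move (a := r + 2) (b := r) (by omega)
    (update (update (foldState s r N (F N)) r []) (r + 1) []) (F N)
    (by simp [foldState])
  refine (h3.seq (h4.seq h5)).congr ?_ (by omega) ?_
  · clear h3 h4 h5 h
    funext k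
    simp only [foldState, update_apply]
    split_ifs <;> first | omega | simp_all
  · clear h3 h4 h5 h
    funext k
    simp only [foldState, update_apply]
    split_ifs <;> first | omega | simp_all

namespace Expr

/-- The compiled expression computes its value within the given time. -/
def Correct (w : List ℕ) (e : Expr) : Prop :=
  ∀ (vars env : List ℕ) (r B : ℕ) (s : ℕ → List Bool), Ready w vars env r s →
    (encNats w).length ≤ B → (∀ v ∈ env, v ≤ B) →
      (e.compile vars r).Exec s (e.time B) (update s r (unary (e.eval w env)))

variable {w : List ℕ}

theorem correct_var (i : ℕ) : (var i).Correct w := by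
  intro vars env r B s h hw henv
  rcases List.forall₂_iff_get.1 h.vars with ⟨hl, hv⟩
  by_cases hi : i < vars.length
  · obtain ⟨h1, h2, h3⟩ := hv i hi (hl ▸ hi)
    simp only [List.get_eq_getElem] at h1 h2 h3
    have hle := henv _ (List.getElem_mem (hl ▸ hi : i < env.length))
    simp only [compile, List.getElem?_eq_getElem hi, eval,
      List.getElem?_eq_getElem (hl ▸ hi : i < env.length), Option.getD_some]
    exact (exec_copy h2 s _ h3 (h.free r le_rfl) (h.free _ (by omega))).mono
      (by simp only [time]; omega)
  · simp only [compile, List.getElem?_eq_none (not_lt.1 hi), eval,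
      List.getElem?_eq_none (hl ▸ not_lt.1 hi : env.length ≤ i), Option.getD_none]
    refine (Exec.skip s).congr rfl (by simp only [time]; omega) ?_
    rw [unary, List.replicate_zero, ← h.free r le_rfl, update_eq_self]

theorem Correct.add {a b : Expr} (ha : a.Correct w) (hb : b.Correct w) :
    (add a b).Correct w := by
  intro vars env r B s h hw henv
  have hle := eval_le_bound w b env B hw henv
  have h1 := ha vars env r B s h hw henv
  have h2 := hb vars env (r + 1) B (update s r (unary (a.eval w env))) (h.push _) hw henv
  refine (h1.seq (h2.seq (exec_move (by omega) _ (b.eval w env) (by simp)))).congr rfl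
    (by simp only [time]; omega) ?_
  have := h.free (r + 1) (by omega)
  clear h1 h2 ha hb
  funext k
  simp only [update_apply, eval]
  split_ifs <;> first | omega | simp_all [add_comm]

theorem Correct.sub {a b : Expr} (ha : a.Correct w) (hb : b.Correct w) :
    (sub a b).Correct w := by
  intro vars env r B s h hw henv
  have hle := eval_le_bound w b env B hw henv
  have h1 := ha vars env r B s h hw henv
  have h2 := hb vars env (r + 1) B (update s r (unary (a.eval w env))) (h.push _) hw henv
  have h3 := exec_whileTrue (r + 1) (loop r (fun _ => skip) (fun _ => false)) 2 (b.eval w env)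
    (fun i => update s r (unary (a.eval w env - i))) fun i _ c => (exec_pop r _).congr rfl le_rfl
      (by
        clear h1 h2 ha hb
        funext k
        simp only [update_apply]
        split_ifs <;> first | omega | simp_all [Nat.sub_sub])
  refine (h1.seq (h2.seq h3)).congr rfl (by simp only [time]; omega) ?_
  have := h.free (r + 1) (by omega)
  clear h1 h2 h3 ha hb
  funext k
  simp only [update_apply, eval]
  split_ifs <;> first | omega | simp_all

theorem mem_cons_le {env : List ℕ} {B N i : ℕ} (henv : ∀ v ∈ env, v ≤ B) (hi : i < N) :
    ∀ v ∈ i :: env, v ≤ B + N := by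
  intro v hv
  rcases List.mem_cons.1 hv with rfl | hv
  · omega
  · have := henv v hv; omega

theorem Correct.sum {n b : Expr} (hn : n.Correct w) (hb : b.Correct w) :
    (sum n b).Correct w := by
  intro vars env r B s h hw henv
  have hle := eval_le_bound w n env B hw henv
  have hsum : _ ≤ n.bound B * b.bound (B + n.bound B) := eval_le_bound w (Expr.sum n b) env B hw henv
  refine ((hn vars env r B s h hw henv).seq (exec_fold (h.free _ (by omega)) (h.free _ (by omega)) _
    (n.eval w env) (b.time (B + n.bound B) + b.bound (B + n.bound B) * 2 + 3)
    (fun i => ∑ j ∈ Finset.range i, b.eval w (j :: env)) rfl fun i hi c => ?_)).congr rfl ?_ rfl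
  · have hlei := eval_le_bound w b (i :: env) (B + n.bound B) (by omega)
      (mem_cons_le henv (hi.trans_le hle))
    refine ((hb ((r + 1) :: vars) (i :: env) (r + 3) (B + n.bound B) _ (h.foldState i _ c)
      (by omega) (mem_cons_le henv (hi.trans_le hle))).seq
        (exec_foldState_next (h.free _ (by omega)) i _ _ c)).congr rfl (by omega) ?_
    rw [Finset.sum_range_succ]
  · have h1 : n.eval w env * (b.time (B + n.bound B) + b.bound (B + n.bound B) * 2 + 3 + 1) ≤
        n.bound B * (b.time (B + n.bound B) + b.bound (B + n.bound B) * 2 + 4) :=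
      Nat.mul_le_mul_right _ hle
    simp only [time, eval] at hsum ⊢
    omega

theorem Correct.get {a : Expr} (ha : a.Correct w) : (get a).Correct w := by
  intro vars env r B s h hw henv
  have hle := eval_le_bound w a env B hw henv
  have h1 := ha vars env r B s h hw henv
  have h3 := h.three_le
  have h2 := exec_lookup w (a.eval w env) r (B + a.bound B) (by omega)
    (update s r (unary (a.eval w env))) (by omega) (by omega)
    (by rw [update_of_ne (by omega), h.input]) (by rw [update_of_ne (by omega), h.aux]) (by simp)
  exact (h1.seq h2).congr rfl (by simp only [time]; omega) (by simp [eval])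

/-- A single pop from `r + 2` is both the test for zero and the decrement, as popping an empty
register changes nothing. -/
theorem exec_countdown_step {s : ℕ → List Bool} {r : ℕ} (hs : s (r + 3) = []) (p : Prog)
    (i a v T : ℕ) (c : List Bool)
    (h : p.Exec (update (foldState s r i 0) r c) T
      (update (update (foldState s r i 0) r c) (r + 3) (unary v))) :
    (seq (loop (r + 2) (fun o => match o with
        | none => seq p (whileTrue (r + 3) (push (r + 2) true))
        | some _ => skip) (fun _ => false)) (push (r + 1) true)).Exec
      (update (foldState s r i a) r c) (T + v * 2 + 4)
      (update (foldState s r (i + 1) (if a = 0 then v else a - 1)) r c) := by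
  cases a with
  | zero =>
    have h0 : update (foldState s r i 0) r c (r + 2) = [] := by simp [foldState]
    have h2 : update (update (foldState s r i 0) r c) (r + 2) [] =
        update (foldState s r i 0) r c := by rw [← h0, update_eq_self]
    have h1 : (whileTrue (r + 3) (push (r + 2) true)).Exec
        (update (update (foldState s r i 0) r c) (r + 3) (unary v)) (v * 2 + 2)
        (update (update (update (update (foldState s r i 0) r c) (r + 3) (unary v)) (r + 3) [])
          (r + 2) (unary v ++ unary 0)) := by
      refine (exec_move (by omega) _ v (by simp)).congr rfl le_rfl ?_
      simp [foldState]
    refine ((Exec.exit (t := T + (v * 2 + 2)) (s' := update (update (update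
      (update (foldState s r i 0) r c) (r + 3) (unary v)) (r + 3) []) (r + 2) (unary v ++ unary 0))
      rfl ?_).seq (Exec.push (r + 1) true _)).congr rfl (by omega) ?_
    · rw [h0, List.tail_nil, h2]
      exact h.seq h1
    · have := foldState_next hs i 0 v c
      rw [if_pos rfl]
      rw [zero_add] at this
      rw [this]
      congr 1
      simp [foldState]
  | succ a =>
    refine ((Exec.exit (t := 1) (s' := update (foldState s r i a) r c) rfl ?_).seq
      (Exec.push (r + 1) true _)).congr rfl (by omega) ?_
    · have h0 : update (foldState s r i (a + 1)) r c (r + 2) = unary (a + 1) := by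
        simp [foldState]
      rw [h0]
      refine (Exec.skip _).congr rfl le_rfl ?_
      clear h
      funext k
      simp only [foldState, update_apply]
      split_ifs <;> first | omega | simp_all
    · clear h
      funext k
      simp only [foldState, update_apply]
      split_ifs <;> first | omega | simp_all [List.replicate_succ]

theorem Correct.countdown {n b : Expr} (hn : n.Correct w) (hb : b.Correct w) :
    (countdown n b).Correct w := by
  intro vars env r B s h hw henv
  have hle := eval_le_bound w n env B hw henv
  have hsum : _ ≤ b.bound (B + n.bound B) := eval_le_bound w (Expr.countdown n b) env B hw henv
  refine ((hn vars env r B s h hw henv).seq (exec_fold (h.free _ (by omega)) (h.free _ (by omega)) _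
    (n.eval w env) (b.time (B + n.bound B) + b.bound (B + n.bound B) * 2 + 4)
    (countdownVal fun i => b.eval w (i :: env)) rfl fun i hi c => ?_)).congr rfl ?_ rfl
  · have hlei := eval_le_bound w b (i :: env) (B + n.bound B) (by omega)
      (mem_cons_le henv (hi.trans_le hle))
    exact (exec_countdown_step (h.free _ (by omega)) _ i _ _ _ c
      (hb ((r + 1) :: vars) (i :: env) (r + 3) (B + n.bound B) _ (h.foldState i _ c)
      (by omega) (mem_cons_le henv (hi.trans_le hle)))).mono (by omega)
  · have h1 : n.eval w env * (b.time (B + n.bound B) + b.bound (B + n.bound B) * 2 + 4 + 1) ≤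
        n.bound B * (b.time (B + n.bound B) + b.bound (B + n.bound B) * 2 + 5) :=
      Nat.mul_le_mul_right _ hle
    simp only [time, eval] at hsum ⊢
    omega

theorem correct (w : List ℕ) (e : Expr) : e.Correct w := by
  induction e with
  | var i => exact correct_var i
  | const c => exact fun vars env r B s h _ _ => exec_pushes c r s (h.free r le_rfl)
  | add a b iha ihb => exact iha.add ihb
  | sub a b iha ihb => exact iha.sub ihb
  | sum n b ihn ihb => exact ihn.sum ihb
  | get a iha => exact iha.get
  | countdown n b ihn ihb => exact ihn.countdown ihb
  | size =>
    intro vars env r B s h hw _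
    have h3 := h.three_le
    exact (exec_countBits (by omega) s h.aux (h.free r le_rfl)).congr rfl
      (by rw [h.input]; simp only [time]; omega) (by rw [h.input]; rfl)

end Expr
end MinSat

/-! ### Commands that write lists of numbers -/

namespace MinSat

open Function Prog

/-! ### Commands -/

/-- Commands that output lists of numbers. `forLt n c` executes `c` for `i = 0, …, n - 1`, where
`i` is added to the environment. -/
inductive Cmd
  | skip
  | emit (e : Expr)
  | seq (c d : Cmd)
  | forLt (n : Expr) (c : Cmd)

namespace Cmd

def run (w : List ℕ) : Cmd → List ℕ → List ℕ
  | skip, _ => []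
  | emit e, env => [e.eval w env]
  | seq c d, env => c.run w env ++ d.run w env
  | forLt n c, env => (List.range (n.eval w env)).flatMap fun i => c.run w (i :: env)

/-- A bound on the length of the encoded output. -/
def bound : Cmd → ℕ → ℕ
  | skip, _ => 0
  | emit e, B => e.bound B + 1
  | seq c d, B => c.bound B + d.bound B
  | forLt n c, B => n.bound B * c.bound (B + n.bound B)

/-- A bound on the running time of the compiled command. -/
def time : Cmd → ℕ → ℕ
  | skip, _ => 1
  | emit e, B => e.time B + (e.bound B * 2 + 3)
  | seq c d, B => c.time B + d.time B
  | forLt n c, B =>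
    n.time B + (n.bound B * (c.time (B + n.bound B) + 2) + 2) + (n.bound B * 2 + 2)

theorem polyBdd_bound (c : Cmd) : PolyBdd c.bound := by
  induction c with
  | skip => exact PolyBdd.const 0
  | emit e => exact e.polyBdd_bound.add (PolyBdd.const 1)
  | seq c d ihc ihd => exact ihc.add ihd
  | forLt n c ih => exact n.polyBdd_bound.mul (ih.comp (PolyBdd.id.add n.polyBdd_bound))

theorem polyBdd_time (c : Cmd) : PolyBdd c.time := by
  have k (n : ℕ) : PolyBdd fun _ => n := PolyBdd.const n
  induction c with
  | skip => exact k 1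
  | emit e => exact e.polyBdd_time.add ((e.polyBdd_bound.mul (k 2)).add (k 3))
  | seq c d ihc ihd => exact ihc.add ihd
  | forLt n c ih =>
    have hB := PolyBdd.id.add n.polyBdd_bound
    exact (n.polyBdd_time.add ((n.polyBdd_bound.mul ((ih.comp hB).add (k 2))).add (k 2))).add
      ((n.polyBdd_bound.mul (k 2)).add (k 2))

theorem length_encNats_run_le (w : List ℕ) (c : Cmd) (env : List ℕ) (B : ℕ)
    (hw : (encNats w).length ≤ B) (henv : ∀ v ∈ env, v ≤ B) :
    (encNats (c.run w env)).length ≤ c.bound B := by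
  induction c generalizing env B with
  | skip => simp [run, encNats, bound]
  | emit e => simpa [run, encNats, bound] using e.eval_le_bound w env B hw henv
  | seq c d ihc ihd =>
    simp only [run, encNats_append, List.length_append, bound]
    exact Nat.add_le_add (ihc _ _ hw henv) (ihd _ _ hw henv)
  | forLt n c ih =>
    have hn := n.eval_le_bound w env B hw henv
    have key : ∀ N ≤ n.bound B, (encNats ((List.range N).flatMap fun i =>
        c.run w (i :: env))).length ≤ N * c.bound (B + n.bound B) := by
      intro N hN
      induction N with
      | zero => simp [encNats]
      | succ N ihN =>
        rw [List.range_succ, List.flatMap_append, encNats_append, List.length_append, add_mul]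
        refine Nat.add_le_add (ihN (by omega)) ?_
        simpa using ih (N :: env) (B + n.bound B) (by omega) (Expr.mem_cons_le henv hN)
    exact (key _ hn).trans (Nat.mul_le_mul_right _ hn)

def compile : Cmd → List ℕ → ℕ → Prog
  | skip, _, _ => Prog.skip
  | emit e, vars, r =>
    .seq (e.compile vars r) (.seq (whileTrue r (push 2 true)) (push 2 false))
  | seq c d, vars, r => .seq (c.compile vars r) (d.compile vars r)
  | forLt n c, vars, r =>
    .seq (n.compile vars r) (.seq
      (whileTrue r (.seq (c.compile ((r + 1) :: vars) (r + 2)) (push (r + 1) true)))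
      (whileTrue (r + 1) Prog.skip))

theorem exec_compile (w : List ℕ) (c : Cmd) (vars env : List ℕ) (r B : ℕ) (s : ℕ → List Bool)
    (h : Ready w vars env r s) (hw : (encNats w).length ≤ B) (henv : ∀ v ∈ env, v ≤ B) :
    (c.compile vars r).Exec s (c.time B)
      (update s 2 ((encNats (c.run w env)).reverse ++ s 2)) := by
  induction c generalizing vars env r B s with
  | skip => exact (Exec.skip s).congr rfl le_rfl (by simp [run, encNats])
  | emit e =>
    have h3 := h.three_le
    have hr := h.free r le_rfl
    have hle := e.eval_le_bound w env B hw henv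
    have h1 := e.correct w vars env r B s h hw henv
    refine (h1.seq ((exec_move (by omega) _ (e.eval w env) (by simp)).seq
      (Exec.push 2 false _))).congr rfl (by simp only [time]; omega) ?_
    clear h1
    funext k
    simp only [update_apply, run]
    split_ifs <;> first | omega | simp_all [encNats]
  | seq c d ihc ihd =>
    have h1 := ihc vars env r B s h hw henv
    have h3 := h.three_le
    have h2 := ihd vars env r B (update s 2 ((encNats (c.run w env)).reverse ++ s 2))
      (h.of_eq le_rfl (fun k _ hk => update_of_ne hk _ _)
        (fun k hk => by rw [update_of_ne (by omega), h.free k hk])) hw henv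
    refine (h1.seq h2).congr rfl le_rfl ?_
    simp [run, encNats_append]
  | forLt n c ih =>
    have h3 := h.three_le
    have hle := n.eval_le_bound w env B hw henv
    have h1 := n.correct w vars env r B s h hw henv
    set out := fun i => (encNats ((List.range i).flatMap fun i => c.run w (i :: env))).reverse ++ s 2
      with hout
    have hout0 : out 0 = s 2 := by simp [hout, encNats]
    have houtS (i : ℕ) : out (i + 1) = (encNats (c.run w (i :: env))).reverse ++ out i := by
      simp [hout, List.range_succ, encNats_append]
    have hfree := h.free
    have h2 := exec_whileTrue r (.seq (c.compile ((r + 1) :: vars) (r + 2)) (push (r + 1) true))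
      (c.time (B + n.bound B) + 1) (n.eval w env)
      (fun i => update (update s (r + 1) (unary i)) 2 (out i)) fun i hi k => by
        have h4 := ih ((r + 1) :: vars) (i :: env) (r + 2) (B + n.bound B)
          (update (update (update s (r + 1) (unary i)) 2 (out i)) r k)
          ((h.of_eq (by omega)
            (fun k hk hk2 => by
              simp only [update_apply]; split_ifs <;> first | omega | rfl)
            (fun k hk => by
              have := hfree k (by omega)
              simp only [update_apply]; split_ifs <;> omega)).cons
              (by omega) (by omega)
              (by simp only [update_apply]; split_ifs <;> first | omega | rfl))
          (by omega) (Expr.mem_cons_le henv (hi.trans_le hle))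
        refine (h4.seq (Exec.push (r + 1) true _)).congr rfl le_rfl ?_
        rw [houtS]
        clear h4 ih h1 hout
        clear_value out
        funext j
        simp only [update_apply]
        split_ifs <;> first | omega | simp_all [List.replicate_succ]
    have h5 := exec_clear (r + 1) (update (update (update s (r + 1) (unary (n.eval w env))) 2
      (out (n.eval w env))) r []) (n.eval w env)
      (by simp only [update_apply]; split_ifs <;> first | omega | rfl)
    refine (h1.seq ((h2.congr ?_ le_rfl rfl).seq h5)).congr rfl ?_ ?_
    · have := hfree (r + 1) (by omega)
      clear h1 h2 h5 ih hout houtS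
      clear_value out
      funext j
      simp only [update_apply]
      split_ifs <;> first | omega | simp_all
    · have : n.eval w env * (c.time (B + n.bound B) + 1 + 1) ≤
        n.bound B * (c.time (B + n.bound B) + 2) := Nat.mul_le_mul_right _ hle
      simp only [time]
      omega
    · have h6 := hfree (r + 1) (by omega)
      have h7 := hfree r (by omega)
      clear h1 h2 h5 ih houtS hfree
      funext j
      simp only [update_apply, run, hout]
      split_ifs <;> first | omega | simp_all

/-- The program that reads the reversed encoded input from register `0`, executes the command, and
leaves the encoded output in register `1`. -/
def program (c : Cmd) : Prog :=
  .seq (moveBits 0 1) (.seq (moveBits 1 2) (.seq (moveBits 2 0) (.seq (c.compile [] 3)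
    (.seq (moveBits 0 3) (.seq (loop 3 (fun _ => Prog.skip) Option.isSome) (moveBits 2 1))))))

theorem exec_clearBits (a : ℕ) (l : List Bool) (s : ℕ → List Bool) (hs : s a = l) :
    (loop a (fun _ => Prog.skip) Option.isSome).Exec s (l.length * 2 + 2) (update s a []) := by
  induction l generalizing s with
  | nil =>
    exact (Exec.exit (t := 1) (by simp [hs]) (Exec.skip _)).congr rfl (by simp) (by simp [hs])
  | cons x l ih =>
    refine (Exec.cont (t := 1) (by simp [hs]) (Exec.skip _) (ih _ ?_)).congr rfl
      (by simp; omega) (by simp)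
    simp [hs]

/-- The transfer from the preceding machine reverses the input, and three reversing moves undo this.
The output is accumulated in reverse in register `2` and set right by the last move; the input is
erased because all other registers have to end up empty. -/
theorem exec_program (c : Cmd) (w : List ℕ) :
    c.program.Exec (update (fun _ => []) 0 (encNats w).reverse)
      (c.time (encNats w).length + (encNats w).length * 10 + c.bound (encNats w).length * 2 + 12)
      (update (fun _ => []) 1 (encNats (c.run w []))) := by
  have hlen := c.length_encNats_run_le w [] _ le_rfl (by simp)
  have h1 := exec_moveBits (a := 0) (b := 1) (by omega) (encNats w).reverse
    (update (fun _ => []) 0 (encNats w).reverse) (by simp)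
  have h2 := exec_moveBits (a := 1) (b := 2) (by omega) (encNats w)
    (update (fun _ => []) 1 (encNats w)) (by simp)
  have h3 := exec_moveBits (a := 2) (b := 0) (by omega) (encNats w).reverse
    (update (fun _ => []) 2 (encNats w).reverse) (by simp)
  have h4 := c.exec_compile w [] [] 3 _ (update (fun _ => []) 0 (encNats w))
    ⟨by simp, by simp, fun k hk => update_of_ne (by omega) _ _, le_rfl, .nil⟩ le_rfl (by simp)
  have h5 := exec_moveBits (a := 0) (b := 3) (by omega) (encNats w)
    (update (update (fun _ => []) 0 (encNats w)) 2 (encNats (c.run w [])).reverse) (by simp)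
  have h6 := exec_clearBits 3 (encNats w).reverse
    (update (update (fun _ => []) 3 (encNats w).reverse) 2 (encNats (c.run w [])).reverse) (by simp)
  have h7 := exec_moveBits (a := 2) (b := 1) (by omega) (encNats (c.run w [])).reverse
    (update (fun _ => []) 2 (encNats (c.run w [])).reverse) (by simp)
  simp only [List.length_reverse] at h1 h3 h6 h7
  refine (h1.seq ((h2.congr ?_ le_rfl rfl).seq ((h3.congr ?_ le_rfl rfl).seq
    ((h4.congr ?_ le_rfl rfl).seq ((h5.congr ?_ le_rfl rfl).seq
      ((h6.congr ?_ le_rfl rfl).seq (h7.congr ?_ le_rfl rfl))))))).congr rfl (by omega) ?_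
  all_goals
    clear h1 h2 h3 h4 h5 h6 h7
    funext k
    simp only [update_apply]
    split_ifs <;> first | omega | simp_all

end Cmd

end MinSat

/-! ### Composition of an fpt-reduction with a command -/

namespace MinSat

open Function

theorem primrec_pow_const {f : ℕ → ℕ} (hf : Primrec f) (e : ℕ) : Primrec fun k => f k ^ e := by
  induction e with
  | zero => simpa using Primrec.const (α := ℕ) 1
  | succ e ih => simpa [pow_succ] using Primrec.nat_mul.comp ih hf

theorem computable_add_pow {f : ℕ → ℕ} (hf : Computable f) (C e : ℕ) :
    Computable fun k => f k + (C * f k + 2) ^ e := by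
  have h : Primrec fun m : ℕ => m + (C * m + 2) ^ e :=
    Primrec.nat_add.comp Primrec.id (primrec_pow_const
      (Primrec.nat_add.comp (Primrec.nat_mul.comp (Primrec.const C) Primrec.id) (Primrec.const 2)) e)
  exact h.to_comp.comp hf

/-- An fpt-reduction to `Q` followed by a reduction that is given by a command is an
fpt-reduction. -/
theorem FPTReducible.trans_cmd {P Q Q' : ParamProblem} (h : FPTReducible P Q) (c : Cmd)
    (code : Q.Inst → List ℕ) (hcode : ∀ y, Q.enc y = encNats (code y)) (ψ : Q.Inst → Q'.Inst)
    (hψ : ∀ y, Q'.enc (ψ y) = encNats (c.run (code y) []))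
    (hyes : ∀ y, y ∈ Q.yes ↔ ψ y ∈ Q'.yes) (g' : ℕ → ℕ) (hg' : Computable g')
    (hmono : Monotone g') (hparam : ∀ y, Q'.param (ψ y) ≤ g' (Q.param y)) :
    FPTReducible P Q' := by
  obtain ⟨φ, f, g, a, M, hf, hg, hφ, hφp, hM⟩ := h
  obtain ⟨C, hC⟩ := exists_output_length_le M.tm
  have k (n : ℕ) : PolyBdd fun _ => n := PolyBdd.const n
  obtain ⟨e, he⟩ : PolyBdd fun L => L + 1 + (c.time L + L * 10 + c.bound L * 2 + 12) :=
    (PolyBdd.id.add (k 1)).add (((c.polyBdd_time.add (PolyBdd.id.mul (k 10))).add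
      (c.polyBdd_bound.mul (k 2))).add (k 12))
  -- With `F = f k`, the intermediate word has length `L ≤ n + C * F * (n + 1) ^ a`, so `L + 2 ≤ (C
  -- * F + 2) * (n + 1) ^ (a + 1)`. The second phase takes at most `(L + 2) ^ e` steps, whence the
  -- new factor and exponent.
  refine ⟨fun x => ψ (φ x), fun k => f k + (C * f k + 2) ^ e, fun k => g' (g k), a + (a + 1) * e,
    ⟨thenProg M.tm M.outputAlphabet c.program, M.inputAlphabet, Equiv.refl Bool⟩,
    computable_add_pow hf C e, hg'.comp hg, fun x => (hφ x).trans (hyes _),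
    fun x => (hparam _).trans (hmono (hφp x)), fun x => ?_⟩
  have hlen := hC _ _ _ (hM x)
  simp only [List.length_map] at hlen
  have h1 : Nonempty (Turing.TM2OutputsInTime M.tm ((P.enc x).map M.inputAlphabet.symm)
    (some ((encNats (code (φ x))).map M.outputAlphabet.symm))
    (f (P.param x) * ((P.enc x).length + 1) ^ a)) := by
    rw [← hcode]; exact hM x
  have h2 := thenProg_outputs M.tm M.outputAlphabet c.program h1 (c.exec_program (code (φ x)))
  obtain ⟨⟨h3, h4⟩⟩ := h2
  have h5 : (Q'.enc (ψ (φ x))).map (Equiv.refl Bool).symm = encNats (c.run (code (φ x)) []) := by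
    rw [hψ]; simp
  have h6 : ∀ T' z, z = encNats (c.run (code (φ x)) []) → h3.steps ≤ T' →
      Nonempty (Turing.TM2OutputsInTime (thenProg M.tm M.outputAlphabet c.program)
        ((P.enc x).map M.inputAlphabet.symm) (some z) T') := by
    rintro T' z rfl hT'
    exact ⟨⟨h3, hT'⟩⟩
  refine h6 _ _ h5 (h4.trans ?_)
  have h7 := he (encNats (code (φ x))).length
  rw [hcode] at hlen
  set n := (P.enc x).length
  set L := (encNats (code (φ x))).length
  set F := f (P.param x)
  have hn1 : 1 ≤ (n + 1) ^ a := Nat.one_le_pow _ _ (by omega)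
  have h8 : L + 2 ≤ (C * F + 2) * (n + 1) ^ (a + 1) := by
    have h9 : C * (F * (n + 1) ^ a) ≤ (C * F) * (n + 1) ^ (a + 1) := by
      rw [← mul_assoc]
      exact Nat.mul_le_mul_left _ (Nat.pow_le_pow_right (by omega) (by omega))
    have h10 : n + 1 ≤ (n + 1) ^ (a + 1) := by
      rw [pow_succ]; exact Nat.le_mul_of_pos_left _ hn1
    rw [add_mul]
    omega
  have h11 : (L + 2) ^ e ≤ (C * F + 2) ^ e * (n + 1) ^ ((a + 1) * e) := by
    rw [pow_mul, ← mul_pow]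
    exact Nat.pow_le_pow_left h8 e
  have h12 : F * (n + 1) ^ a ≤ F * (n + 1) ^ (a + (a + 1) * e) :=
    Nat.mul_le_mul_left _ (Nat.pow_le_pow_right (by omega) (by omega))
  have h13 : (C * F + 2) ^ e * (n + 1) ^ ((a + 1) * e) ≤
      (C * F + 2) ^ e * (n + 1) ^ (a + (a + 1) * e) :=
    Nat.mul_le_mul_left _ (Nat.pow_le_pow_right (by omega) (by omega))
  have h14 : L + 1 + (c.time L + L * 10 + c.bound L * 2 + 12) ≤ (L + 2) ^ e := h7
  change F * (n + 1) ^ a + (L + 1) + (c.time L + L * 10 + c.bound L * 2 + 12) ≤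
    (F + (C * F + 2) ^ e) * (n + 1) ^ (a + (a + 1) * e)
  rw [add_mul]
  omega

end MinSat

/-! ### Formulas with negations, crisp constraints and projected relations -/

namespace MinSat

open Function

/-! ### Costs of formulas -/

section Cost

variable {Γ : Set BoolRel}

theorem cost_append (F G : Formula Γ) (α : ℕ → Bool) : cost (F ++ G) α = cost F α + cost G α := by
  simp [cost, List.countP_append]

theorem cost_eq_zero_iff (F : Formula Γ) (α : ℕ → Bool) : cost F α = 0 ↔ ∀ c ∈ F, c.Sat α := by
  simp [cost, List.countP_eq_zero]

theorem cost_flatMap_range (f : ℕ → Formula Γ) (n : ℕ) (α : ℕ → Bool) :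
    cost ((List.range n).flatMap f) α = ∑ i ∈ Finset.range n, cost (f i) α := by
  induction n with
  | zero => simp [cost]
  | succ n ih => rw [List.range_succ, List.flatMap_append, cost_append, ih,
      Finset.sum_range_succ]; simp

theorem cost_le_cost_flatMap {β : Type} (f : β → Formula Γ) {l : List β} {b : β} (hb : b ∈ l)
    (α : ℕ → Bool) : cost (f b) α ≤ cost (l.flatMap f) α := by
  obtain ⟨s, t, rfl⟩ := List.append_of_mem hb
  rw [List.flatMap_append, List.flatMap_cons, cost_append, cost_append]
  omega

/-- Rename the variables of a constraint. -/
def Constraint.rename (ρ : ℕ → ℕ) (c : Constraint Γ) : Constraint Γ :=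
  ⟨c.rel, c.rel_mem, fun i => ρ (c.scope i)⟩

theorem cost_rename (F : Formula Γ) (ρ : ℕ → ℕ) (α : ℕ → Bool) :
    cost (F.map (Constraint.rename ρ)) α = cost F (α ∘ ρ) := by
  unfold cost
  rw [List.countP_map]
  rfl

end Cost

/-! ### Variables of the constructed formulas -/

/-- The variable for the node `u` (if `b` is true) or for its negation (if `b` is false). -/
def litVar (u : ℕ) (b : Bool) : ℕ := Nat.pair 0 (Nat.pair u b.toNat)

/-- The variable `z` of the gadget for `u ≠ v`. -/
def gadgetVar (u v z : ℕ) : ℕ :=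
  if z = 0 then u else if z = 1 then v else Nat.pair 1 (Nat.pair (Nat.pair u v) z)

/-- Four nodes. -/
abbrev Quad : Type := Fin 4 → ℕ

/-- The private variable at coordinate `i` of the constraint on the nodes `p`. -/
def privateVar (p : Quad) (i : ℕ) : ℕ :=
  Nat.pair 2 (Nat.pair (Nat.pair (Nat.pair (p 0) (p 1)) (Nat.pair (p 2) (p 3))) i)

/-! ### The projection of a relation to four literals -/

/-- A relation of the language with four distinguished coordinates and signs for them. -/
structure Frame (Γ : Set BoolRel) where
  rel : BoolRel
  rel_mem : rel ∈ Γ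
  coord : Fin 4 → Fin rel.arity
  coord_injective : Injective coord
  sign : Fin 4 → Bool

namespace Frame

variable {Γ : Set BoolRel} (A : Frame Γ)

/-- The projection of the relation to the signed coordinates. -/
def Holds (a : Fin 4 → Bool) : Prop :=
  ∃ t ∈ A.rel.tuples, ∀ c, (t (A.coord c) == A.sign c) = a c

open Classical in
/-- The entries of a tuple that projects to `a`. -/
noncomputable def pick (a : Fin 4 → Bool) (i : ℕ) : Bool :=
  if h : A.Holds a ∧ i < A.rel.arity then h.1.choose ⟨i, h.2⟩ else false

theorem pick_mem {a : Fin 4 → Bool} (h : A.Holds a) :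
    (fun i : Fin A.rel.arity => A.pick a i) ∈ A.rel.tuples ∧
      ∀ c, (A.pick a (A.coord c) == A.sign c) = a c := by
  have h1 : ∀ i : Fin A.rel.arity, A.pick a i = h.choose i := fun i => by simp [pick, h]
  simp only [h1]
  exact h.choose_spec

open Classical in
/-- The constraint on four nodes given by the projection; the other coordinates get private
variables. -/
noncomputable def constraint (p : Quad) : Constraint Γ where
  rel := A.rel
  rel_mem := A.rel_mem
  scope i := if h : ∃ c, A.coord c = i then litVar (p h.choose) (A.sign h.choose)
    else privateVar p i

theorem constraint_scope_coord (p : Quad) (c : Fin 4) :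
    (A.constraint p).scope (A.coord c) = litVar (p c) (A.sign c) := by
  have h : ∃ c', A.coord c' = A.coord c := ⟨c, rfl⟩
  have h2 : h.choose = c := A.coord_injective h.choose_spec
  simp only [constraint, dif_pos h, h2]

theorem constraint_scope_of_ne (p : Quad) (i : Fin A.rel.arity) (h : ∀ c, A.coord c ≠ i) :
    (A.constraint p).scope i = privateVar p i := by
  have h : ¬ ∃ c, A.coord c = i := by simpa using h
  simp only [constraint, dif_neg h]

/-- If the two variables of a node are opposite, then the variable with sign `s` has value `s`
exactly when the node is true, so comparing with the sign recovers the node. -/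
theorem holds_of_sat (p : Quad) (α : ℕ → Bool) (hsat : (A.constraint p).Sat α)
    (hneg : ∀ c, α (litVar (p c) true) ≠ α (litVar (p c) false)) :
    A.Holds fun c => α (litVar (p c) true) := by
  refine ⟨_, hsat, fun c => ?_⟩
  have h := constraint_scope_coord A p c
  have h2 := hneg c
  simp only [constraint] at h ⊢
  rw [h]
  cases hs : A.sign c
  · cases h3 : α (litVar (p c) true) <;> cases h4 : α (litVar (p c) false) <;> simp_all
  · simp

end Frame

/-! ### Assignments from values of the nodes -/

/-- The assignment given by the values `β` of the nodes, values `W` for the variables of the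
inequality gadgets, and tuples of the relation for the private variables. -/
noncomputable def extend {Γ : Set BoolRel} (A : Frame Γ) (W : Bool → Bool → ℕ → Bool)
    (β : ℕ → Bool) : ℕ → Bool :=
  let base : ℕ → Bool := fun z => β z.unpair.2.unpair.1 == (z.unpair.2.unpair.2 == 1)
  fun z =>
    if z.unpair.1 = 0 then base z
    else if z.unpair.1 = 1 then
      W (base z.unpair.2.unpair.1.unpair.1) (base z.unpair.2.unpair.1.unpair.2) z.unpair.2.unpair.2
    else
      let q := z.unpair.2.unpair.1
      A.pick ![β q.unpair.1.unpair.1, β q.unpair.1.unpair.2, β q.unpair.2.unpair.1,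
        β q.unpair.2.unpair.2] z.unpair.2.unpair.2

section Extend

variable {Γ : Set BoolRel} (A : Frame Γ) (W : Bool → Bool → ℕ → Bool) (β : ℕ → Bool)

theorem extend_litVar (u : ℕ) (b : Bool) : extend A W β (litVar u b) = (β u == b) := by
  cases b <;> simp [extend, litVar]

theorem extend_gadgetVar (hW : ∀ a b, W a b 0 = a ∧ W a b 1 = b) (u v : ℕ) (b b' : Bool) (z : ℕ) :
    extend A W β (gadgetVar (litVar u b) (litVar v b') z) = W (β u == b) (β v == b') z := by
  by_cases h0 : z = 0
  · subst h0
    rw [(hW _ _).1, ← extend_litVar A W β u b]; rfl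
  · by_cases h1 : z = 1
    · subst h1
      rw [(hW _ _).2, ← extend_litVar A W β v b']; rfl
    · cases b <;> cases b' <;> simp [extend, gadgetVar, h0, h1, litVar]

theorem extend_sat (p : Quad) (h : A.Holds fun c => β (p c)) :
    (A.constraint p).Sat (extend A W β) := by
  have hs := A.pick_mem h
  suffices (fun i => extend A W β ((A.constraint p).scope i)) =
      fun i : Fin A.rel.arity => A.pick (fun c => β (p c)) i by
    unfold Constraint.Sat
    rw [this]
    exact hs.1
  funext i
  by_cases hi : ∃ c, A.coord c = i
  · obtain ⟨c, rfl⟩ := hi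
    have h3 := A.constraint_scope_coord p c
    have h4 := extend_litVar A W β (p c) (A.sign c)
    rw [← h3, ← hs.2 c] at h4
    refine h4.trans ?_
    cases A.pick (fun c => β (p c)) (A.coord c) <;> cases A.sign c <;> rfl
  · rw [A.constraint_scope_of_ne p i (by simpa using hi)]
    have heq : (fun c => β (p c)) = ![β (p 0), β (p 1), β (p 2), β (p 3)] := by
      funext c; fin_cases c <;> rfl
    rw [heq]
    simp [extend, privateVar]

end Extend

/-! ### Formulas with crisp inequalities -/

section Assembled

variable {Γ : Set BoolRel}

/-- `K + 1` copies of the gadget `F₀` for each of the given pairs. -/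
def hardFormula (F₀ : Formula Γ) (K : ℕ) (pairs : List (ℕ × ℕ)) : Formula Γ :=
  pairs.flatMap fun p => (List.range (K + 1)).flatMap fun _ =>
    F₀.map (Constraint.rename (gadgetVar p.1 p.2))

/-- The pairs of variables that have to be different if `S ≠ T` and if `u = v` for all `(u, v)` in
`eqs`. -/
def hardPairs (S T : ℕ) (nodes : List ℕ) (eqs : List (ℕ × ℕ)) : List (ℕ × ℕ) :=
  (litVar S true, litVar T true) :: (nodes.map (fun u => (litVar u true, litVar u false)) ++
    eqs.map fun p => (litVar p.1 true, litVar p.2 false))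

/-- The formula with crisp constraints `S ≠ T`, `u = v` for `(u, v)` in `eqs`, and those in `pins`,
and soft constraints `softs`. -/
noncomputable def assembled (F₀ : Formula Γ) (A : Frame Γ) (K S T : ℕ) (nodes : List ℕ)
    (eqs : List (ℕ × ℕ)) (softs pins : List Quad) : Formula Γ :=
  hardFormula F₀ K (hardPairs S T nodes eqs) ++
    (softs.map A.constraint ++
      pins.flatMap fun p => (List.range (K + 1)).flatMap fun _ => [A.constraint p])

variable {F₀ : Formula Γ}

/-- The copies for a pair share their auxiliary variables, so together they cost `K + 1` times the
cost of one copy, which is positive when the ends agree. -/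
theorem ne_of_cost_hardFormula_le
    (hF₀ : ∀ α : ℕ → Bool, α 0 = α 1 → 0 < cost F₀ α) {K : ℕ} {pairs : List (ℕ × ℕ)}
    {α : ℕ → Bool} (h : cost (hardFormula F₀ K pairs) α ≤ K) {p : ℕ × ℕ} (hp : p ∈ pairs) :
    α p.1 ≠ α p.2 := by
  intro he
  have h1 := (cost_le_cost_flatMap (fun p : ℕ × ℕ => (List.range (K + 1)).flatMap fun _ =>
    F₀.map (Constraint.rename (gadgetVar p.1 p.2))) hp α).trans h
  rw [cost_flatMap_range, Finset.sum_const, Finset.card_range, smul_eq_mul, cost_rename] at h1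
  have h2 := hF₀ (α ∘ gadgetVar p.1 p.2) (by simpa [gadgetVar] using he)
  have := Nat.mul_le_mul_left (K + 1) h2
  omega

-- Within budget `K` nothing that is repeated `K + 1` times can be violated, which yields all crisp
-- conditions. Conversely, values of the nodes determine an assignment: gadgets with different ends
-- are satisfied at no cost, and the private variables, named after their quadruple, are filled
-- independently by a tuple with the required projection whenever there is one.
open Classical in
theorem exists_cost_assembled_le_iff
    (hF₀ : ∀ α : ℕ → Bool, α 0 = α 1 → 0 < cost F₀ α)
    (hF₀' : ∀ a b : Bool, a ≠ b → ∃ α : ℕ → Bool, α 0 = a ∧ α 1 = b ∧ cost F₀ α = 0)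
    (A : Frame Γ) (K S T : ℕ) (nodes : List ℕ)
    (eqs : List (ℕ × ℕ)) (softs pins : List Quad)
    (heqs : ∀ p ∈ eqs, p.2 ∈ nodes) (hsofts : ∀ p ∈ softs, ∀ c, p c ∈ nodes)
    (hpins : ∀ p ∈ pins, ∀ c, p c ∈ nodes) :
    (∃ α, cost (assembled F₀ A K S T nodes eqs softs pins) α ≤ K) ↔
      ∃ β : ℕ → Bool, β S ≠ β T ∧ (∀ p ∈ eqs, β p.1 = β p.2) ∧
        (∀ p ∈ pins, A.Holds fun c => β (p c)) ∧
        softs.countP (fun p => ¬ A.Holds fun c => β (p c)) ≤ K := by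
  constructor
  · rintro ⟨α, hα⟩
    rw [assembled, cost_append, cost_append] at hα
    have hne := fun p hp => ne_of_cost_hardFormula_le (p := p) hF₀ (by omega :
      cost (hardFormula F₀ K (hardPairs S T nodes eqs)) α ≤ K) hp
    have hnode : ∀ u ∈ nodes, α (litVar u true) ≠ α (litVar u false) := fun u hu =>
      hne (litVar u true, litVar u false) (by simp [hardPairs]; right; left; exact ⟨u, hu, rfl, rfl⟩)
    refine ⟨fun u => α (litVar u true), hne (litVar S true, litVar T true) (by simp [hardPairs]),
      fun p hp => ?_, fun p hp => ?_, ?_⟩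
    -- The gadget says that `p.1` differs from the negation of `p.2`; as `p.2` is among the nodes,
    -- its negation is the true one.
    · have h1 := hne (litVar p.1 true, litVar p.2 false)
        (by simp [hardPairs]; right; right; exact ⟨p.1, p.2, hp, rfl, rfl⟩)
      have h2 := hnode p.2 (heqs p hp)
      simp only at h1
      cases h3 : α (litVar p.1 true) <;> cases h4 : α (litVar p.2 true) <;>
        cases h5 : α (litVar p.2 false) <;> simp_all
    · refine A.holds_of_sat p α ?_ fun c => hnode _ (hpins p hp c)
      by_contra hns
      have h1 := cost_le_cost_flatMap (fun p => (List.range (K + 1)).flatMap fun _ =>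
        [A.constraint p]) hp α
      rw [cost_flatMap_range, Finset.sum_const, Finset.card_range, smul_eq_mul] at h1
      have h2 : cost [A.constraint p] α = 1 := by simp [cost, hns]
      rw [h2] at h1
      omega
    · refine le_trans ?_ (by omega : cost (softs.map A.constraint) α ≤ K)
      unfold cost
      rw [List.countP_map]
      refine List.countP_mono_left fun p hp h => ?_
      simp only [decide_eq_true_eq, comp_apply] at h ⊢
      exact fun hs => h (A.holds_of_sat p α hs fun c => hnode _ (hsofts p hp c))
  · rintro ⟨β, hβ, heq, hpin, hsoft⟩
    have hW : ∀ a b : Bool, ∃ α : ℕ → Bool, (α 0 = a ∧ α 1 = b) ∧ (a ≠ b → cost F₀ α = 0) := by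
      intro a b
      by_cases hab : a = b
      -- For equal ends no gadget needs to be satisfied, and only the values at `0` and `1` matter.
      · exact ⟨fun z => if z = 0 then a else b, by simp [hab]⟩
      · obtain ⟨α, h1, h2, h3⟩ := hF₀' a b hab
        exact ⟨α, ⟨h1, h2⟩, fun _ => h3⟩
    choose W hW01 hW using hW
    refine ⟨extend A W β, ?_⟩
    have hgadget (u v : ℕ) (b b' : Bool) (h : (β u == b) ≠ (β v == b')) :
        cost (F₀.map (Constraint.rename (gadgetVar (litVar u b) (litVar v b')))) (extend A W β)
          = 0 := by
      rw [cost_rename, ← hW _ _ h]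
      congr 1
      funext z
      exact extend_gadgetVar A W β hW01 u v b b' z
    have h1 : cost (hardFormula F₀ K (hardPairs S T nodes eqs)) (extend A W β) = 0 := by
      rw [cost_eq_zero_iff]
      intro c hc
      simp only [hardFormula, List.mem_flatMap] at hc
      obtain ⟨p, hp, _, -, hc⟩ := hc
      refine (cost_eq_zero_iff _ _).1 ?_ c hc
      simp only [hardPairs, List.mem_cons, List.mem_append, List.mem_map] at hp
      rcases hp with rfl | ⟨u, -, rfl⟩ | ⟨q, hq, rfl⟩
      · exact hgadget _ _ _ _ (by simpa using hβ)
      · exact hgadget _ _ _ _ (by cases β u <;> simp)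
      · exact hgadget _ _ _ _ (by rw [heq q hq]; cases β q.2 <;> simp)
    have h2 : cost (pins.flatMap fun p => (List.range (K + 1)).flatMap fun _ => [A.constraint p])
        (extend A W β) = 0 := by
      rw [cost_eq_zero_iff]
      intro c hc
      simp only [List.mem_flatMap, List.mem_singleton] at hc
      obtain ⟨p, hp, _, -, rfl⟩ := hc
      exact extend_sat A W β p (hpin p hp)
    rw [assembled, cost_append, cost_append, h1, h2, zero_add, add_zero]
    refine le_trans ?_ hsoft
    unfold cost
    rw [List.countP_map]
    refine List.countP_mono_left fun p hp h => ?_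
    simp only [decide_eq_true_eq, comp_apply] at h ⊢
    exact fun hs => h (extend_sat A W β p hs)

end Assembled

end MinSat

/-! ### Paired implications and cuts of bundled paths -/

namespace MinSat

open Function

/-! ### Frames from induced copies of `2K₂` -/

/-- The projection is contained in `(x₀ → x₁) ∧ (x₂ → x₃)` and contains `(x₀ = x₁) ∧ (x₂ = x₃)`. -/
structure Frame.Paired {Γ : Set BoolRel} (A : Frame Γ) : Prop where
  imp : ∀ a, A.Holds a → (a 0 = true → a 1 = true) ∧ (a 2 = true → a 3 = true)
  diag : ∀ x y : Bool, A.Holds ![x, x, y, y]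

theorem exists_of_not_gaifmanGraph_adj {R : BoolRel} {i j : Fin R.arity} (hij : i ≠ j)
    (h : ¬ (gaifmanGraph R).Adj i j) (a b : Bool) : ∃ t ∈ R.tuples, t i = a ∧ t j = b := by
  by_contra hc
  exact h ⟨hij, a, b, fun t ht h2 => hc ⟨t, ht, h2⟩⟩

/-- If an edge forbids the values `(a, b)`, then the signs `a` and `!b` turn this into an
implication. A true premise and a false conclusion each determine both ends of it, so a single
coordinate of either edge suffices to prescribe a diagonal value. Coordinates of different edges are
not adjacent and may be prescribed simultaneously. -/
theorem exists_paired_frame {Γ : Set BoolRel} {R : BoolRel} (hR : R ∈ Γ)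
    (h : twoK2.IsIndContained (gaifmanGraph R)) : ∃ A : Frame Γ, A.Paired := by
  obtain ⟨f⟩ := h
  have hinj := f.injective
  have hadj : ∀ x y, (gaifmanGraph R).Adj (f x) (f y) ↔ twoK2.Adj x y := fun x y => f.map_rel_iff
  obtain ⟨-, a, b, hab⟩ := (hadj (.inl 0) (.inl 1)).2 (by simp [twoK2])
  obtain ⟨-, a', b', hab'⟩ := (hadj (.inr 0) (.inr 1)).2 (by simp [twoK2])
  have hcross (x y : Fin 2) (u v : Bool) :=
    exists_of_not_gaifmanGraph_adj (i := f (.inl x)) (j := f (.inr y)) (hinj.ne (by simp))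
      (by rw [hadj]; simp [twoK2]) u v
  let g : Fin 4 → Fin 2 ⊕ Fin 2 := ![.inl 0, .inl 1, .inr 0, .inr 1]
  have hg : Injective g := by decide
  let A : Frame Γ := ⟨R, hR, f ∘ g, hinj.comp hg, ![a, !b, a', !b']⟩
  have himp : ∀ x, A.Holds x → (x 0 = true → x 1 = true) ∧ (x 2 = true → x 3 = true) := by
    rintro x ⟨t, ht, hx⟩
    have h0 : (t (f (.inl 0)) == a) = x 0 := hx 0
    have h1 : (t (f (.inl 1)) == !b) = x 1 := hx 1
    have h2 : (t (f (.inr 0)) == a') = x 2 := hx 2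
    have h3 : (t (f (.inr 1)) == !b') = x 3 := hx 3
    have h4 := hab t ht
    have h5 := hab' t ht
    rw [← h0, ← h1, ← h2, ← h3]
    refine ⟨fun h => ?_, fun h => ?_⟩
    · have h6 : t (f (.inl 1)) ≠ b := fun h7 => h4 ⟨by simpa using h, h7⟩
      cases h8 : t (f (.inl 1)) <;> cases b <;> simp_all
    · have h6 : t (f (.inr 1)) ≠ b' := fun h7 => h5 ⟨by simpa using h, h7⟩
      cases h8 : t (f (.inr 1)) <;> cases b' <;> simp_all
  refine ⟨A, himp, fun x y => ?_⟩
  -- The premise is prescribed to obtain the value true on an edge, the conclusion to obtain false.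
  obtain ⟨t, ht, h1, h2⟩ := hcross (if x then 0 else 1) (if y then 0 else 1)
    (if x then a else b) (if y then a' else b')
  refine ⟨t, ht, ?_⟩
  have h3 := himp (fun c => t (A.coord c) == A.sign c) ⟨t, ht, fun _ => rfl⟩
  have e0 : (t (A.coord 0) == A.sign 0) = (t (f (.inl 0)) == a) := rfl
  have e1 : (t (A.coord 1) == A.sign 1) = (t (f (.inl 1)) == !b) := rfl
  have e2 : (t (A.coord 2) == A.sign 2) = (t (f (.inr 0)) == a') := rfl
  have e3 : (t (A.coord 3) == A.sign 3) = (t (f (.inr 1)) == !b') := rfl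
  simp only [e0, e1, e2, e3] at h3
  intro c
  fin_cases c
  · change (t (f (.inl 0)) == a) = x
    cases x
    · simp only [Bool.false_eq_true, if_false] at h1
      rw [h1] at h3
      cases h8 : t (f (.inl 0)) <;> cases a <;> cases b <;> simp_all
    · simpa using h1
  · change (t (f (.inl 1)) == !b) = x
    cases x
    · simp only [Bool.false_eq_true, if_false] at h1
      rw [h1]; cases b <;> rfl
    · simp only [if_true] at h1
      simp_all
  · change (t (f (.inr 0)) == a') = y
    cases y
    · simp only [Bool.false_eq_true, if_false] at h2
      rw [h2] at h3
      cases h8 : t (f (.inr 0)) <;> cases a' <;> cases b' <;> simp_all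
    · simpa using h2
  · change (t (f (.inr 1)) == !b') = y
    cases y
    · simp only [Bool.false_eq_true, if_false] at h2
      rw [h2]; cases b' <;> rfl
    · simp only [if_true] at h2
      simp_all

/-! ### Cuts of bundled paths -/

theorem exists_cut {f : ℕ → Prop} {n : ℕ} (h0 : f 0) (hn : ¬ f n) : ∃ t < n, f t ∧ ¬ f (t + 1) := by
  by_contra hc
  push Not at hc
  have : ∀ t ≤ n, f t := by
    intro t
    induction t with
    | zero => exact fun _ => h0
    | succ t ih => exact fun ht => hc t (by omega) (ih (by omega))
  exact hn (this n le_rfl)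

/-- Monotonicity is not assumed: a return from false to true would be followed by another drop
before `n`. -/
theorem iff_le_of_unique_cut {f : ℕ → Prop} {n c : ℕ} (h0 : f 0) (hn : ¬ f n)
    (h : ∀ q < n, q ≠ c → f q → f (q + 1)) {q : ℕ} (hq : q ≤ n) : f q ↔ q ≤ c := by
  constructor
  · intro hf
    by_contra hc
    obtain ⟨k, rfl⟩ := Nat.exists_eq_add_of_le hq
    obtain ⟨t, ht, h1, h2⟩ := exists_cut (f := fun t => f (q + t)) hf hn
    exact h2 (h (q + t) (by omega) (by omega) h1)
  · intro hc
    by_contra hf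
    obtain ⟨t, ht, h1, h2⟩ := exists_cut h0 hf
    exact h2 (h t (by omega) (by omega) h1)

theorem sum_eq_one_of_le {ι : Type} (s : Finset ι) (f : ι → ℕ) (h1 : ∀ i ∈ s, 1 ≤ f i)
    (h : ∑ i ∈ s, f i ≤ s.card) {i : ι} (hi : i ∈ s) : f i = 1 := by
  have h2 : ∑ i ∈ s, f i = ∑ i ∈ s, 1 :=
    le_antisymm (by simpa using h) (Finset.sum_le_sum h1)
  exact ((Finset.sum_eq_sum_iff_of_le h1).1 h2.symm i hi).symm

/-- A constraint satisfaction problem with `V` variables, with values less than `N`, and `M`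
constraints of arity `D`. Constraint `m` is on the variables `idx m 0, …, idx m (D - 1)`, and one of
the tuples `t < T` with `ok m t`, with entries `digit t 0, …`, has to be chosen. -/
structure TupleCSP where
  (M D T N V : ℕ)
  idx : ℕ → ℕ → ℕ
  digit : ℕ → ℕ → ℕ
  ok : ℕ → ℕ → Prop
  idx_lt : ∀ m < M, ∀ j < D, idx m j < V
  digit_lt : ∀ t < T, ∀ j < D, digit t j < N
  N_pos : 0 < N

namespace TupleCSP

def Solvable (Q : TupleCSP) : Prop :=
  ∃ x : ℕ → ℕ, ∀ m < Q.M, ∃ t < Q.T, Q.ok m t ∧ ∀ j < Q.D, Q.digit t j = x (Q.idx m j)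

variable (Q : TupleCSP)

open Classical in
/-- If the paths `A m`, `P m j` and `B i` lead from `true` to `false` and only `M * D` bundles
`(m, j, t)` are violated, then the cuts describe a solution. -/
theorem solvable_of_cuts (a : ℕ → ℕ → Prop) (b : ℕ → ℕ → Prop) (p : ℕ → ℕ → ℕ → Prop)
    (viol : ℕ → ℕ → ℕ → Prop)
    (ha0 : ∀ m < Q.M, a m 0) (haT : ∀ m < Q.M, ¬ a m Q.T)
    (hb0 : ∀ i < Q.V, b i 0) (hbN : ∀ i < Q.V, ¬ b i Q.N)
    (hpb : ∀ m < Q.M, ∀ j < Q.D, ∀ v ≤ Q.N, b (Q.idx m j) v ↔ p m j (v * Q.T))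
    (hok : ∀ m < Q.M, ∀ t < Q.T, ¬ Q.ok m t → (a m t ↔ a m (t + 1)))
    (hp : ∀ m < Q.M, ∀ j < Q.D, ∀ v < Q.N, ∀ t < Q.T, Q.digit t j ≠ v →
      (p m j (v * Q.T + t) ↔ p m j (v * Q.T + t + 1)))
    (hviol : ∀ m < Q.M, ∀ j < Q.D, ∀ t < Q.T, ¬ viol m j t → (a m t → a m (t + 1)) ∧
      (p m j (Q.digit t j * Q.T + t) → p m j (Q.digit t j * Q.T + t + 1)))
    (hcount : ∑ m ∈ Finset.range Q.M, ∑ j ∈ Finset.range Q.D,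
      ((Finset.range Q.T).filter fun t => viol m j t).card ≤ Q.M * Q.D) : Q.Solvable := by
  choose! t ht hat using fun m hm => exists_cut (ha0 m hm) (haT m hm)
  -- Edge `t m` of `A m` is cut, and it belongs to one bundle for every `j < D`.
  have hvt : ∀ m < Q.M, ∀ j < Q.D, viol m j (t m) := fun m hm j hj => by
    by_contra hv
    exact (hat m hm).2 ((hviol m hm j hj _ (ht m hm) hv).1 (hat m hm).1)
  -- Each of the `M * D` pairs `(m, j)` has a violated bundle, so the budget leaves no room for a
  -- second one.
  have hcard : ∀ m < Q.M, ∀ j < Q.D,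
      ((Finset.range Q.T).filter fun t => viol m j t).card = 1 := by
    intro m hm j hj
    rw [← Finset.sum_product'] at hcount
    refine sum_eq_one_of_le (Finset.range Q.M ×ˢ Finset.range Q.D)
      (fun x => ((Finset.range Q.T).filter fun t => viol x.1 x.2 t).card) ?_
      (by simpa using hcount) (i := (m, j)) (by simp [hm, hj])
    rintro ⟨m, j⟩ hmj
    simp only [Finset.mem_product, Finset.mem_range] at hmj
    exact Finset.card_pos.2 ⟨t m, by simp [ht m hmj.1, hvt m hmj.1 j hmj.2]⟩
  have huniq : ∀ m < Q.M, ∀ j < Q.D, ∀ t' < Q.T, viol m j t' → t' = t m := by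
    intro m hm j hj t' ht' hv
    exact Finset.card_le_one.1 (hcard m hm j hj).le t' (by simp [ht', hv]) (t m)
      (by simp [ht m hm, hvt m hm j hj])
  have hTpos : ∀ m < Q.M, 0 < Q.T := fun m hm => (Nat.zero_le _).trans_lt (ht m hm)
  -- An edge of `P m j` that can be cut lies in a violated bundle `(m, j, t')`, hence `t' = t m`.
  -- This leaves one possible edge, and the path has to be cut somewhere.
  have hpq : ∀ m < Q.M, ∀ j < Q.D, ∀ q ≤ Q.N * Q.T,
      p m j q ↔ q ≤ Q.digit (t m) j * Q.T + t m := by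
    intro m hm j hj q hq
    have hidx := Q.idx_lt m hm j hj
    refine iff_le_of_unique_cut (n := Q.N * Q.T) ?_ ?_ ?_ hq
    · have := (hpb m hm j hj 0 (Nat.zero_le _)).1 (hb0 _ hidx)
      rwa [zero_mul] at this
    · exact fun h => hbN _ hidx ((hpb m hm j hj Q.N le_rfl).2 h)
    · intro q hq hne hpq
      have hqT : q / Q.T * Q.T + q % Q.T = q := Nat.div_add_mod' q Q.T
      have h1 : q / Q.T < Q.N := by
        rw [Nat.div_lt_iff_lt_mul (hTpos m hm)]; exact hq
      have h2 : q % Q.T < Q.T := Nat.mod_lt _ (hTpos m hm)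
      by_cases hd : Q.digit (q % Q.T) j = q / Q.T
      · have hv : ¬ viol m j (q % Q.T) := fun hv => by
          have h3 := huniq m hm j hj _ h2 hv
          apply hne
          rw [← h3, hd, hqT]
        have h3 := (hviol m hm j hj _ h2 hv).2
        rw [hd, hqT] at h3
        exact h3 hpq
      · have h3 := hp m hm j hj _ h1 _ h2 hd
        rw [hqT] at h3
        exact h3.1 hpq
  have hbv : ∀ m < Q.M, ∀ j < Q.D, ∀ v ≤ Q.N, b (Q.idx m j) v ↔ v ≤ Q.digit (t m) j := by
    intro m hm j hj v hv
    rw [hpb m hm j hj v hv, hpq m hm j hj _ (Nat.mul_le_mul_right _ hv)]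
    have h1 := ht m hm
    constructor
    · intro h
      by_contra hc
      have h2 : (Q.digit (t m) j + 1) * Q.T ≤ v * Q.T := Nat.mul_le_mul_right _ (by omega)
      rw [add_mul] at h2
      omega
    · intro h
      have := Nat.mul_le_mul_right Q.T h
      omega
  -- The value of variable `i` is the last position of `B i` before its cut; for variables in a
  -- scope this is the digit of the chosen tuple.
  refine ⟨fun i => Nat.findGreatest (b i) Q.N, fun m hm => ⟨t m, ht m hm, ?_, fun j hj => ?_⟩⟩
  · by_contra hc
    exact (hat m hm).2 ((hok m hm _ (ht m hm) hc).1 (hat m hm).1)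
  · symm
    have hd := (Q.digit_lt (t m) (ht m hm) j hj).le
    rw [Nat.findGreatest_eq_iff]
    refine ⟨hd, fun _ => (hbv m hm j hj _ hd).2 le_rfl, fun v hv hvN hb => ?_⟩
    exact absurd ((hbv m hm j hj v hvN).1 hb) (by omega)

end TupleCSP

end MinSat

/-! ### The Min SAT formula of a tuple CSP -/

namespace MinSat

open Function

/-! ### The bundled paths of a tuple CSP as a formula -/

def nodeS : ℕ := Nat.pair 0 0
def nodeT : ℕ := Nat.pair 0 1
def freeNode (i : ℕ) : ℕ := Nat.pair 0 (i + 2)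
def nodeA (m t : ℕ) : ℕ := Nat.pair 1 (Nat.pair m t)
def nodeB (i v : ℕ) : ℕ := Nat.pair 2 (Nat.pair i v)
def nodeP (m j q : ℕ) : ℕ := Nat.pair 3 (Nat.pair (Nat.pair m j) q)

/-- Concatenation of the lists `f 0, …, f (n - 1)`. -/
abbrev concat {α : Type} (n : ℕ) (f : ℕ → List α) : List α := (List.range n).flatMap f

theorem mem_concat {α : Type} {n : ℕ} {f : ℕ → List α} {a : α} :
    a ∈ concat n f ↔ ∃ i < n, a ∈ f i := by
  simp [concat]

theorem countP_concat {α : Type} (p : α → Bool) (n : ℕ) (f : ℕ → List α) :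
    (concat n f).countP p = ∑ i ∈ Finset.range n, (f i).countP p := by
  induction n with
  | zero => simp [concat]
  | succ n ih =>
    simp only [concat] at ih ⊢
    rw [List.range_succ, List.flatMap_append, List.countP_append, ih, Finset.sum_range_succ]
    simp

theorem countP_concat_singleton {α : Type} (p : α → Bool) (n : ℕ) (f : ℕ → α) :
    (concat n fun i => [f i]).countP p = ((Finset.range n).filter fun i => p (f i)).card := by
  rw [countP_concat, Finset.card_filter]
  exact Finset.sum_congr rfl fun i _ => by simp [List.countP_singleton]

namespace TupleCSP

variable (Q : TupleCSP)

def nodes : List ℕ :=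
  [nodeS, nodeT, freeNode 0, freeNode 1] ++
    (concat Q.M (fun m => concat (Q.T + 1) fun t => [nodeA m t]) ++
      (concat Q.V (fun i => concat (Q.N + 1) fun v => [nodeB i v]) ++
        concat Q.M fun m => concat Q.D fun j => concat (Q.N * Q.T + 1) fun q => [nodeP m j q]))

-- The five groups fix the ends of the paths `A` and `B`, let `P m j` refine `B (idx m j)` with `T`
-- edges in place of one, and make uncuttable the edges of forbidden tuples and those edges of `P m
-- j` whose value is not the digit of their tuple.
open Classical in
noncomputable def eqs : List (ℕ × ℕ) :=
  concat Q.M (fun m => [(nodeA m 0, nodeS), (nodeA m Q.T, nodeT)]) ++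
    (concat Q.V (fun i => [(nodeB i 0, nodeS), (nodeB i Q.N, nodeT)]) ++
      (concat Q.M (fun m => concat Q.D fun j => concat (Q.N + 1) fun v =>
          [(nodeB (Q.idx m j) v, nodeP m j (v * Q.T))]) ++
        (concat Q.M (fun m => concat Q.T fun t =>
            if Q.ok m t then [] else [(nodeA m t, nodeA m (t + 1))]) ++
          concat Q.M fun m => concat Q.D fun j => concat Q.N fun v => concat Q.T fun t =>
            if Q.digit t j = v then []
            else [(nodeP m j (v * Q.T + t), nodeP m j (v * Q.T + t + 1))])))

/-- The factor `T` keeps apart tuples with the same digit: every edge of `P m j` occurs in at most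
one bundle, so that one cut costs only one violation. -/
def bundle (m j t : ℕ) : Quad :=
  ![nodeA m t, nodeA m (t + 1), nodeP m j (Q.digit t j * Q.T + t),
    nodeP m j (Q.digit t j * Q.T + t + 1)]

def bundles : List Quad :=
  concat Q.M fun m => concat Q.D fun j => concat Q.T fun t => [Q.bundle m j t]

end TupleCSP

/-- Four values given by a function on nodes. -/
theorem comp_quad (β : ℕ → Bool) (a b c d : ℕ) :
    (fun i => β ((![a, b, c, d] : Quad) i)) = ![β a, β b, β c, β d] := by
  funext i
  fin_cases i <;> rfl

namespace Frame

variable {Γ : Set BoolRel} (A : Frame Γ)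

open Classical in
/-- Constraints that force `S` to be true if the relation distinguishes true and false. -/
noncomputable def pins : List Quad :=
  if ∃ y z, A.Holds ![false, true, y, z] then [![nodeT, nodeS, freeNode 0, freeNode 1]]
  else if ∃ y z, A.Holds ![y, z, false, true] then [![freeNode 0, freeNode 1, nodeT, nodeS]]
  else []

variable {A}

theorem exists_pins_hold (A : Frame Γ) : ∃ y z : Bool, ∀ β : ℕ → Bool, β nodeS = true →
    β nodeT = false → β (freeNode 0) = y → β (freeNode 1) = z →
      ∀ p ∈ A.pins, A.Holds fun c => β (p c) := by
  unfold pins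
  split_ifs with h1 h2
  · obtain ⟨y, z, h⟩ := h1
    refine ⟨y, z, fun β hS hT h0 h1 p hp => ?_⟩
    rw [List.mem_singleton] at hp
    rw [hp, comp_quad, hS, hT, h0, h1]
    exact h
  · obtain ⟨y, z, h⟩ := h2
    refine ⟨y, z, fun β hS hT h0 h1 p hp => ?_⟩
    rw [List.mem_singleton] at hp
    rw [hp, comp_quad, hS, hT, h0, h1]
    exact h
  · exact ⟨true, true, fun β _ _ _ _ p hp => by cases hp⟩

/-- Implications carry the value of the source along a path only if that value is true. A pin, the
constraint applied to the sink and the source, excludes the opposite orientation, and it is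
satisfiable in the desired one if some tuple of the projection has entries false, true on one of the
pairs. -/
theorem Paired.propagate (hA : A.Paired) {β : ℕ → Bool} (hne : β nodeS ≠ β nodeT)
    (hpins : ∀ p ∈ A.pins, A.Holds fun c => β (p c)) {a : Fin 4 → Bool} (ha : A.Holds a) :
    (a 0 = β nodeS → a 1 = β nodeS) ∧ (a 2 = β nodeS → a 3 = β nodeS) := by
  have himp := hA.imp a ha
  have hS : β nodeS = true → (a 0 = β nodeS → a 1 = β nodeS) ∧ (a 2 = β nodeS → a 3 = β nodeS) := by
    intro h
    rw [h]
    exact himp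
  unfold pins at hpins
  split_ifs at hpins with h1 h2
  · have h3 := (hA.imp _ (hpins ![nodeT, nodeS, freeNode 0, freeNode 1] (by simp))).1
    apply hS
    simp only [Matrix.cons_val_zero, Matrix.cons_val_one] at h3
    cases h4 : β nodeS <;> cases h5 : β nodeT <;> simp_all
  · have h3 := (hA.imp _ (hpins ![freeNode 0, freeNode 1, nodeT, nodeS] (by simp))).2
    apply hS
    simp only [Matrix.cons_val] at h3
    cases h4 : β nodeS <;> cases h5 : β nodeT <;> simp_all
  -- Without such a tuple both implications are equalities on the projection, so that either value
  -- of the source is carried along.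
  · have heq : a = ![a 0, a 1, a 2, a 3] := by funext i; fin_cases i <;> rfl
    have h3 : ¬ (a 0 = false ∧ a 1 = true) := by
      rintro ⟨e0, e1⟩
      rw [heq, e0, e1] at ha
      exact h1 ⟨_, _, ha⟩
    have h4 : ¬ (a 2 = false ∧ a 3 = true) := by
      rintro ⟨e0, e1⟩
      rw [heq, e0, e1] at ha
      exact h2 ⟨_, _, ha⟩
    have key : ∀ b c : Bool, (b = true → c = true) → ¬ (b = false ∧ c = true) → c = b := by decide
    have h5 := key _ _ himp.1 h3
    have h6 := key _ _ himp.2 h4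
    rw [h5, h6]
    exact ⟨fun h => h, fun h => h⟩

end Frame

namespace TupleCSP

variable {Γ : Set BoolRel} {A : Frame Γ} (Q : TupleCSP)

-- Reachability is expressed as having the value of `nodeS`, since without pins that value may be
-- false.
open Classical in
theorem solvable_of_nodes (hA : A.Paired) (β : ℕ → Bool) (hne : β nodeS ≠ β nodeT)
    (heqs : ∀ p ∈ Q.eqs, β p.1 = β p.2) (hpins : ∀ p ∈ A.pins, A.Holds fun c => β (p c))
    (hsoft : Q.bundles.countP (fun p => ¬ A.Holds fun c => β (p c)) ≤ Q.M * Q.D) :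
    Q.Solvable := by
  simp only [eqs, List.forall_mem_append] at heqs
  obtain ⟨h1, h2, h3, h4, h5⟩ := heqs
  simp only [mem_concat] at h1 h2 h3 h4 h5
  have hiff {u v : ℕ} (h : β u = β v) : (β u = β nodeS ↔ β v = β nodeS) := by rw [h]
  refine Q.solvable_of_cuts (fun m t => β (nodeA m t) = β nodeS)
    (fun i v => β (nodeB i v) = β nodeS) (fun m j q => β (nodeP m j q) = β nodeS)
    (fun m j t => ¬ A.Holds fun c => β (Q.bundle m j t c))
    (fun m hm => h1 (nodeA m 0, nodeS) ⟨m, hm, by simp⟩)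
    (fun m hm h => hne (h.symm.trans (h1 (nodeA m Q.T, nodeT) ⟨m, hm, by simp⟩)))
    (fun i hi => h2 (nodeB i 0, nodeS) ⟨i, hi, by simp⟩)
    (fun i hi h => hne (h.symm.trans (h2 (nodeB i Q.N, nodeT) ⟨i, hi, by simp⟩)))
    (fun m hm j hj v hv => hiff (h3 (nodeB (Q.idx m j) v, nodeP m j (v * Q.T))
      ⟨m, hm, j, hj, v, by omega, by simp⟩))
    (fun m hm t ht hok => hiff (h4 (nodeA m t, nodeA m (t + 1)) ⟨m, hm, t, ht, by simp [hok]⟩))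
    (fun m hm j hj v hv t ht hd => hiff (h5 (nodeP m j (v * Q.T + t), nodeP m j (v * Q.T + t + 1))
      ⟨m, hm, j, hj, v, hv, t, ht, by simp [hd]⟩))
    (fun m hm j hj t ht hv => ?_) ?_
  · rw [not_not] at hv
    exact hA.propagate hne hpins hv
  · refine le_trans (le_of_eq ?_) hsoft
    simp only [bundles, countP_concat]
    refine Finset.sum_congr rfl fun m _ => Finset.sum_congr rfl fun j _ => ?_
    rw [← countP_concat, countP_concat_singleton]
    simp only [decide_not]
    congr!
    simp

open Classical in
/-- The values of the nodes for a solution `x` with tuples `t`. -/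
noncomputable def nodeValue (x t : ℕ → ℕ) (y z : Bool) (u : ℕ) : Bool :=
  let w := u.unpair.2
  if u.unpair.1 = 0 then
    if w = 0 then true else if w = 1 then false else if w = 2 then y else z
  else if u.unpair.1 = 1 then w.unpair.2 ≤ t w.unpair.1
  else if u.unpair.1 = 2 then w.unpair.2 ≤ x w.unpair.1 ∧ w.unpair.2 < Q.N
  else w.unpair.2 ≤ x (Q.idx w.unpair.1.unpair.1 w.unpair.1.unpair.2) * Q.T + t w.unpair.1.unpair.1

-- Every path is cut at the position prescribed by the solution. In a bundle with `s ≠ t m` neither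
-- edge is cut, so it is a diagonal tuple of the projection; what remains is one bundle for each
-- `(m, j)`.
open Classical in
theorem exists_nodes_of_solvable (hA : A.Paired) (h : Q.Solvable) :
    ∃ β : ℕ → Bool, β nodeS ≠ β nodeT ∧ (∀ p ∈ Q.eqs, β p.1 = β p.2) ∧
      (∀ p ∈ A.pins, A.Holds fun c => β (p c)) ∧
      Q.bundles.countP (fun p => ¬ A.Holds fun c => β (p c)) ≤ Q.M * Q.D := by
  obtain ⟨x, hx⟩ := h
  choose! t ht hok hdigit using hx
  obtain ⟨y, z, hpins⟩ := A.exists_pins_hold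
  have hS : Q.nodeValue x t y z nodeS = true := by simp [nodeValue, nodeS]
  have hT : Q.nodeValue x t y z nodeT = false := by simp [nodeValue, nodeT]
  have hAv (m s) : Q.nodeValue x t y z (nodeA m s) = decide (s ≤ t m) := by
    simp [nodeValue, nodeA]
  have hB (i v) : Q.nodeValue x t y z (nodeB i v) = decide (v ≤ x i ∧ v < Q.N) := by
    simp [nodeValue, nodeB]
  have hP (m j q) : Q.nodeValue x t y z (nodeP m j q) =
      decide (q ≤ x (Q.idx m j) * Q.T + t m) := by
    simp [nodeValue, nodeP]
  have hxN : ∀ m < Q.M, ∀ j < Q.D, x (Q.idx m j) < Q.N := fun m hm j hj =>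
    hdigit m hm j hj ▸ Q.digit_lt _ (ht m hm) j hj
  refine ⟨Q.nodeValue x t y z, by rw [hS, hT]; simp, ?_, hpins _ hS hT
    (by simp [nodeValue, freeNode]) (by simp [nodeValue, freeNode]), ?_⟩
  · simp only [eqs, List.forall_mem_append]
    refine ⟨?_, ?_, ?_, ?_, ?_⟩
    all_goals simp only [mem_concat]
    · rintro p ⟨m, hm, hp⟩
      simp only [List.mem_cons, List.not_mem_nil, or_false] at hp
      have := ht m hm
      rcases hp with rfl | rfl
      · simp [hAv, hS]
      · simpa [hAv, hT] using this
    · rintro p ⟨i, hi, hp⟩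
      simp only [List.mem_cons, List.not_mem_nil, or_false] at hp
      rcases hp with rfl | rfl
      · simp [hB, hS, Q.N_pos]
      -- A variable outside all scopes may have a value `N` or more; the conjunct `v < Q.N` in
      -- `nodeValue` still makes the end of its path false.
      · simp [hB, hT]
    · rintro p ⟨m, hm, j, hj, v, hv, hp⟩
      rw [List.mem_singleton] at hp
      subst hp
      rw [hB, hP, decide_eq_decide]
      have h1 := hxN m hm j hj
      have h2 := ht m hm
      constructor
      · rintro ⟨h3, -⟩
        have := Nat.mul_le_mul_right Q.T h3
        omega
      · intro h3
        have h4 : v ≤ x (Q.idx m j) := by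
          by_contra hc
          have h5 : (x (Q.idx m j) + 1) * Q.T ≤ v * Q.T := Nat.mul_le_mul_right _ (by omega)
          rw [add_mul] at h5
          omega
        exact ⟨h4, by omega⟩
    · rintro p ⟨m, hm, s, hs, hp⟩
      split_ifs at hp with h1
      · cases hp
      · rw [List.mem_singleton] at hp
        subst hp
        rw [hAv, hAv, decide_eq_decide]
        have : s ≠ t m := fun h => h1 (h ▸ hok m hm)
        omega
    · rintro p ⟨m, hm, j, hj, v, hv, s, hs, hp⟩
      split_ifs at hp with h1
      · cases hp
      · rw [List.mem_singleton] at hp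
        subst hp
        rw [hP, hP, decide_eq_decide]
        have h2 := ht m hm
        have h3 : v * Q.T + s ≠ x (Q.idx m j) * Q.T + t m := by
          intro h
          have hTpos : 0 < Q.T := by omega
          have h4 : s = t m := by
            have := congrArg (· % Q.T) h
            simpa [Nat.mul_add_mod', Nat.mod_eq_of_lt hs, Nat.mod_eq_of_lt h2] using this
          have h5 : v = x (Q.idx m j) := by
            rw [h4] at h
            exact Nat.eq_of_mul_eq_mul_right hTpos (by omega)
          apply h1
          rw [h4, h5]
          exact hdigit m hm j hj
        omega
  · simp only [bundles, countP_concat]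
    refine (Finset.sum_le_sum fun m hm => Finset.sum_le_sum (g := fun _ => 1) fun j hj => ?_).trans
      (by simp)
    rw [Finset.mem_range] at hm hj
    beta_reduce
    rw [← countP_concat, countP_concat_singleton, Finset.card_le_one]
    have key : ∀ s < Q.T, (¬ A.Holds fun c => Q.nodeValue x t y z (Q.bundle m j s c)) →
        s = t m := by
      intro s hs hns
      by_contra hne
      apply hns
      have h2 := ht m hm
      rw [bundle, comp_quad, hAv, hAv, hP, hP]
      have e1 : decide (s + 1 ≤ t m) = decide (s ≤ t m) := by
        rw [decide_eq_decide]; omega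
      have e2 : decide (Q.digit s j * Q.T + s + 1 ≤ x (Q.idx m j) * Q.T + t m) =
          decide (Q.digit s j * Q.T + s ≤ x (Q.idx m j) * Q.T + t m) := by
        rw [decide_eq_decide]
        have h3 : Q.digit s j * Q.T + s ≠ x (Q.idx m j) * Q.T + t m := by
          intro h
          have := congrArg (· % Q.T) h
          exact hne (by
            simpa [Nat.mul_add_mod', Nat.mod_eq_of_lt hs, Nat.mod_eq_of_lt h2] using this)
        omega
      rw [e1, e2]
      exact hA.diag _ _
    intro s hs s' hs'
    simp only [Finset.mem_filter, Finset.mem_range, decide_eq_true_eq] at hs hs'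
    rw [key s hs.1 hs.2, key s' hs'.1 hs'.2]

/-- The formula of a tuple CSP. -/
noncomputable def formula (Q : TupleCSP) (F₀ : Formula Γ) (A : Frame Γ) : Formula Γ :=
  assembled F₀ A (Q.M * Q.D) nodeS nodeT Q.nodes Q.eqs Q.bundles A.pins

theorem mem_nodes_S : nodeS ∈ Q.nodes := by simp [nodes]

theorem mem_nodes_T : nodeT ∈ Q.nodes := by simp [nodes]

theorem mem_nodes_A {m t : ℕ} (hm : m < Q.M) (ht : t ≤ Q.T) : nodeA m t ∈ Q.nodes := by
  simp only [nodes, List.mem_append, mem_concat]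
  exact Or.inr (Or.inl ⟨m, hm, t, by omega, by simp⟩)

theorem mem_nodes_P {m j q : ℕ} (hm : m < Q.M) (hj : j < Q.D) (hq : q ≤ Q.N * Q.T) :
    nodeP m j q ∈ Q.nodes := by
  simp only [nodes, List.mem_append, mem_concat]
  exact Or.inr (Or.inr (Or.inr ⟨m, hm, j, hj, q, by omega, by simp⟩))

theorem mul_add_lt {v N t T : ℕ} (hv : v < N) (ht : t < T) : v * T + t < N * T := by
  have : (v + 1) * T ≤ N * T := Nat.mul_le_mul_right _ hv
  rw [add_mul] at this
  omega

theorem exists_cost_formula_le_iff {F₀ : Formula Γ}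
    (hF₀ : ∀ α : ℕ → Bool, α 0 = α 1 → 0 < cost F₀ α)
    (hF₀' : ∀ a b : Bool, a ≠ b → ∃ α : ℕ → Bool, α 0 = a ∧ α 1 = b ∧ cost F₀ α = 0)
    (hA : A.Paired) : (∃ α, cost (Q.formula F₀ A) α ≤ Q.M * Q.D) ↔ Q.Solvable := by
  classical
  unfold formula
  rw [exists_cost_assembled_le_iff hF₀ hF₀']
  · exact ⟨fun ⟨β, h1, h2, h3, h4⟩ => Q.solvable_of_nodes hA β h1 h2 h3 h4,
      Q.exists_nodes_of_solvable hA⟩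
  · simp only [eqs, List.forall_mem_append]
    refine ⟨?_, ?_, ?_, ?_, ?_⟩
    all_goals simp only [mem_concat]
    · rintro p ⟨m, hm, hp⟩
      simp only [List.mem_cons, List.not_mem_nil, or_false] at hp
      rcases hp with rfl | rfl
      exacts [Q.mem_nodes_S, Q.mem_nodes_T]
    · rintro p ⟨m, hm, hp⟩
      simp only [List.mem_cons, List.not_mem_nil, or_false] at hp
      rcases hp with rfl | rfl
      exacts [Q.mem_nodes_S, Q.mem_nodes_T]
    · rintro p ⟨m, hm, j, hj, v, hv, hp⟩
      rw [List.mem_singleton] at hp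
      subst hp
      exact Q.mem_nodes_P hm hj (Nat.mul_le_mul_right _ (by omega))
    · rintro p ⟨m, hm, s, hs, hp⟩
      split_ifs at hp with h1
      · cases hp
      · rw [List.mem_singleton] at hp
        subst hp
        exact Q.mem_nodes_A hm hs
    · rintro p ⟨m, hm, j, hj, v, hv, s, hs, hp⟩
      split_ifs at hp with h1
      · cases hp
      · rw [List.mem_singleton] at hp
        subst hp
        exact Q.mem_nodes_P hm hj (mul_add_lt hv hs)
  · simp only [bundles, mem_concat, List.mem_singleton]
    rintro p ⟨m, hm, j, hj, s, hs, rfl⟩ c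
    have h := mul_add_lt (Q.digit_lt s hs j hj) hs
    fin_cases c
    exacts [Q.mem_nodes_A hm hs.le, Q.mem_nodes_A hm hs, Q.mem_nodes_P hm hj h.le,
      Q.mem_nodes_P hm hj h]
  · unfold Frame.pins
    intro p hp c
    split_ifs at hp
    · rw [List.mem_singleton] at hp
      subst hp
      fin_cases c <;> simp [nodes]
    · rw [List.mem_singleton] at hp
      subst hp
      fin_cases c <;> simp [nodes]
    · cases hp

end TupleCSP

end MinSat

/-! ### Weighted satisfiability as a tuple CSP -/

namespace MinSat

open Function

/-! ### Weighted satisfiability as a tuple CSP -/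

/-- The digit of `x` at position `j` in base `b`. -/
def baseDigit (b x j : ℕ) : ℕ := x / b ^ j % b

theorem exists_baseDigit_eq (b D : ℕ) (f : ℕ → ℕ) (hf : ∀ j < D, f j < b) :
    ∃ x < b ^ D, ∀ j < D, baseDigit b x j = f j := by
  let g : Fin D → Fin b := fun j => ⟨f j, hf j j.2⟩
  refine ⟨finFunctionFinEquiv g, (finFunctionFinEquiv g).2, fun j hj => ?_⟩
  have h := finFunctionFinEquiv_symm_apply_val (finFunctionFinEquiv g) ⟨j, hj⟩
  rw [Equiv.symm_apply_apply] at h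
  exact h.symm

/-- If `y < z` are consecutive in the list of all true variables (shifted by one), then they
witness that the literal `(v, b)` is false. -/
def LitFalse (v : ℕ) (b : Bool) (y z : ℕ) : Prop :=
  if b then y < v + 1 ∧ v + 1 < z else y = v + 1

/-- The sequence `x` lists `0`, the elements of `S` shifted by one, and `n + 1`. -/
structure Lists (k n : ℕ) (x : ℕ → ℕ) (S : Finset (Fin n)) : Prop where
  zero : x 0 = 0
  last : x (k + 1) = n + 1
  lt_succ : ∀ g ≤ k, x g < x (g + 1)
  mem_iff : ∀ v : Fin n, v ∈ S ↔ ∃ i, 1 ≤ i ∧ i ≤ k ∧ x i = v + 1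

theorem lt_of_lt_succ {k : ℕ} {x : ℕ → ℕ} (h : ∀ g ≤ k, x g < x (g + 1)) {i j : ℕ} (hij : i < j)
    (hj : j ≤ k + 1) : x i < x j := by
  induction j with
  | zero => omega
  | succ j ih =>
    have h1 := h j (by omega)
    rcases Nat.lt_succ_iff_lt_or_eq.1 hij with h2 | rfl
    · exact (ih h2 (by omega)).trans h1
    · exact h1

theorem Lists.exists_litFalse_iff {k n : ℕ} {x : ℕ → ℕ} {S : Finset (Fin n)}
    (h : Lists k n x S) (v : Fin n) (b : Bool) :
    (∃ g ≤ k, LitFalse v b (x g) (x (g + 1))) ↔ ¬ (v ∈ S ↔ b = true) := by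
  have hlt {i j : ℕ} (hij : i < j) (hj : j ≤ k + 1) : x i < x j := lt_of_lt_succ h.lt_succ hij hj
  cases b with
  | true =>
    simp only [LitFalse, if_true, iff_true, h.mem_iff]
    constructor
    · rintro ⟨g, hg, h1, h2⟩ ⟨i, hi, hik, h3⟩
      rcases lt_trichotomy i g with h4 | rfl | h4
      · have := hlt h4 (by omega); omega
      · omega
      · rcases (show g + 1 ≤ i from h4).lt_or_eq with h5 | rfl
        · have := hlt h5 (by omega); omega
        · omega
    · intro hne
      have h0 := h.zero
      have hv := v.2
      -- The gap around `v + 1` ends at the first entry that is at least `v + 1`; the sentinel `n +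
      -- 1` ensures that there is one. Equality would make `v` an element of `S`.
      have hex : ∃ j, (v : ℕ) + 1 ≤ x j := ⟨k + 1, by rw [h.last]; omega⟩
      have h1 := Nat.find_spec hex
      have h2 : Nat.find hex ≤ k + 1 := Nat.find_le (by rw [h.last]; omega)
      obtain ⟨g, hg⟩ : ∃ g, Nat.find hex = g + 1 := Nat.exists_eq_succ_of_ne_zero (by
        intro h3; rw [h3] at h1; omega)
      have h4 := Nat.find_min hex (m := g) (by omega)
      rw [hg] at h1 h2
      refine ⟨g, by omega, by omega, lt_of_le_of_ne h1 fun h5 => ?_⟩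
      rcases (show g ≤ k by omega).lt_or_eq with h6 | rfl
      · exact hne ⟨g + 1, by omega, by omega, h5.symm⟩
      · rw [h.last] at h5; omega
  | false =>
    simp only [LitFalse, Bool.false_eq_true, if_false, iff_false, not_not, h.mem_iff]
    constructor
    · rintro ⟨g, hg, h1⟩
      refine ⟨g, Nat.one_le_iff_ne_zero.2 ?_, hg, h1⟩
      rintro rfl
      have := h.zero
      omega
    · rintro ⟨i, -, hik, h1⟩
      exact ⟨i, hik, h1⟩

theorem exists_lists (k n : ℕ) (S : Finset (Fin n)) (hS : S.card = k) : ∃ x, Lists k n x S := by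
  let o := S.orderEmbOfFin hS
  let x : ℕ → ℕ := fun i =>
    if i = 0 then 0 else if h : i - 1 < k then (o ⟨i - 1, h⟩ : ℕ) + 1 else n + 1
  have hx (i : ℕ) (hi : i < k) : x (i + 1) = (o ⟨i, hi⟩ : ℕ) + 1 := by simp [x, hi]
  have hlast : x (k + 1) = n + 1 := by simp [x]
  refine ⟨x, rfl, hlast, fun g hg => ?_, fun v => ?_⟩
  · rcases Nat.eq_zero_or_pos g with rfl | hpos
    · show 0 < x 1
      rcases Nat.eq_zero_or_pos k with hk | hk
      · have h1 := hlast
        rw [hk, zero_add] at h1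
        omega
      · rw [hx 0 hk]
        omega
    · obtain ⟨i, rfl⟩ := Nat.exists_eq_succ_of_ne_zero hpos.ne'
      rw [Nat.succ_eq_add_one, hx i hg]
      rcases hg.lt_or_eq with h1 | rfl
      · rw [hx (i + 1) h1]
        have : o ⟨i, hg⟩ < o ⟨i + 1, h1⟩ := o.strictMono (by simp)
        have : (o ⟨i, hg⟩ : ℕ) < o ⟨i + 1, h1⟩ := this
        omega
      · rw [hlast]
        have := (o ⟨i, hg⟩).2
        omega
  · have h1 : v ∈ S ↔ ∃ i, o i = v := by
      rw [← Set.mem_range, Finset.range_orderEmbOfFin, Finset.mem_coe]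
    rw [h1]
    constructor
    · rintro ⟨i, rfl⟩
      exact ⟨i + 1, by omega, i.2, hx i i.2⟩
    · rintro ⟨i, hi, hik, h2⟩
      obtain ⟨i, rfl⟩ := Nat.exists_eq_succ_of_ne_zero (show i ≠ 0 by omega)
      rw [Nat.succ_eq_add_one, hx i hik] at h2
      exact ⟨⟨i, hik⟩, Fin.ext (by omega)⟩

theorem exists_finset_lists (k n : ℕ) (x : ℕ → ℕ) (h0 : x 0 = 0) (hlast : x (k + 1) = n + 1)
    (hlt : ∀ g ≤ k, x g < x (g + 1)) : ∃ S : Finset (Fin n), S.card = k ∧ Lists k n x S := by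
  have hb (i : Fin k) : x (i + 1) - 1 < n := by
    have h1 := lt_of_lt_succ hlt (show (i : ℕ) + 1 < k + 1 by omega) le_rfl
    have h2 := lt_of_lt_succ hlt (show 0 < (i : ℕ) + 1 by omega) (by omega)
    omega
  have hpos (i : Fin k) : 0 < x (i + 1) :=
    (Nat.zero_le _).trans_lt (lt_of_lt_succ hlt (show 0 < (i : ℕ) + 1 by omega) (by omega))
  let f : Fin k → Fin n := fun i => ⟨x (i + 1) - 1, hb i⟩
  have hf : Injective f := by
    intro i j hij
    have h1 : x (i + 1) - 1 = x (j + 1) - 1 := congrArg Fin.val hij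
    have hi := hpos i
    have hj := hpos j
    rcases lt_trichotomy i j with h | h | h
    · have := lt_of_lt_succ hlt (show (i : ℕ) + 1 < j + 1 by simpa using h) (by omega)
      omega
    · exact h
    · have := lt_of_lt_succ hlt (show (j : ℕ) + 1 < i + 1 by simpa using h) (by omega)
      omega
  refine ⟨Finset.univ.map ⟨f, hf⟩, by simp, h0, hlast, hlt, fun v => ?_⟩
  simp only [Finset.mem_map, Finset.mem_univ, true_and, Embedding.coeFn_mk]
  constructor
  · rintro ⟨i, rfl⟩
    exact ⟨i + 1, by omega, i.2, by have := hpos i; show x (i + 1) = x (i + 1) - 1 + 1; omega⟩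
  · rintro ⟨i, hi, hik, h1⟩
    refine ⟨⟨i - 1, by omega⟩, Fin.ext ?_⟩
    show x (i - 1 + 1) - 1 = v
    rw [Nat.sub_add_cancel hi]
    omega

namespace WSatInst

variable {d : ℕ} (I : WSatInst d)

/-- The gaps `G l`, `l ≤ d`, coded by `m`. -/
def gap (m l : ℕ) : ℕ := baseDigit (I.weight + 1) m l

/-- The tuple coded by `t`. -/
def entry (t j : ℕ) : ℕ := baseDigit (I.numVars + 2) t j

/-- The tuple coded by `t` may be assigned to the two ends of each of the gaps coded by `m`. -/
def Allowed (m t : ℕ) : Prop :=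
  (∀ l < d + 1, I.entry t (2 * l) < I.entry t (2 * l + 1) ∧
    (I.gap m l = 0 → I.entry t (2 * l) = 0) ∧
    (I.gap m l = I.weight → I.entry t (2 * l + 1) = I.numVars + 1)) ∧
  ∀ C ∈ I.clauses, ∃ l, ∃ h : l < C.length,
    ¬ LitFalse C[l].1 C[l].2 (I.entry t (2 * l)) (I.entry t (2 * l + 1))

/-- A tuple CSP whose variables are the true variables of a solution. -/
def tupleCSP : TupleCSP where
  M := (I.weight + 1) ^ (d + 1)
  D := 2 * (d + 1)
  T := (I.numVars + 2) ^ (2 * (d + 1))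
  N := I.numVars + 2
  V := I.weight + 2
  idx m j := I.gap m (j / 2) + j % 2
  digit := I.entry
  ok := I.Allowed
  idx_lt m _ j _ := by
    have : I.gap m (j / 2) < I.weight + 1 := Nat.mod_lt _ (by omega)
    omega
  digit_lt t _ j _ := Nat.mod_lt _ (by omega)
  N_pos := by omega

/-- A false clause has a witnessing gap for each of its literals, and the constraint on precisely
these gaps excludes it. Choosing `d + 1` gaps rather than `d` provides a constraint on some gap even
for `d = 0`. -/
theorem solvable_tupleCSP_iff : I.tupleCSP.Solvable ↔ I ∈ (WSat d).yes := by
  constructor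
  · rintro ⟨x, hx⟩
    have hx' (G : ℕ → ℕ) (hG : ∀ l < d + 1, G l < I.weight + 1) : ∃ m t : ℕ, I.Allowed m t ∧
        ∀ l < d + 1, I.gap m l = G l ∧ I.entry t (2 * l) = x (G l) ∧
          I.entry t (2 * l + 1) = x (G l + 1) := by
      obtain ⟨m, hm, hmG⟩ := exists_baseDigit_eq (I.weight + 1) (d + 1) G hG
      obtain ⟨t, -, hok, ht⟩ := hx m hm
      refine ⟨m, t, hok, fun l hl => ⟨hmG l hl, ?_, ?_⟩⟩
      · have := ht (2 * l) (show 2 * l < 2 * (d + 1) by omega)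
        simp only [tupleCSP, Nat.mul_div_cancel_left l two_pos, Nat.mul_mod_right, gap, hmG l hl]
          at this
        exact this
      · have := ht (2 * l + 1) (show 2 * l + 1 < 2 * (d + 1) by omega)
        simp only [tupleCSP, show (2 * l + 1) / 2 = l by omega, show (2 * l + 1) % 2 = 1 by omega,
          gap, hmG l hl] at this
        exact this
    -- Constraints with all gaps equal already force the order and the sentinels.
    have hconst (g : ℕ) (hg : g ≤ I.weight) : x g < x (g + 1) ∧ (g = 0 → x g = 0) ∧
        (g = I.weight → x (g + 1) = I.numVars + 1) := by
      obtain ⟨m, t, hok, h1⟩ := hx' (fun _ => g) (fun _ _ => by omega)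
      obtain ⟨h2, h3, h4⟩ := h1 0 (by omega)
      have h5 := hok.1 0 (by omega)
      rwa [h2, h3, h4] at h5
    obtain ⟨S, hS, hL⟩ := exists_finset_lists I.weight I.numVars x
      ((hconst 0 (by omega)).2.1 rfl) ((hconst _ le_rfl).2.2 rfl) fun g hg => (hconst g hg).1
    refine ⟨S, hS, fun C hC => ?_⟩
    by_contra! hne
    -- Beyond the length of the clause the choice of a gap is arbitrary, and `0` is taken.
    have hgap (l : ℕ) : ∃ g ≤ I.weight, ∀ h : l < C.length,
        LitFalse C[l].1 C[l].2 (x g) (x (g + 1)) := by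
      by_cases h : l < C.length
      · obtain ⟨g, hg, h1⟩ := (hL.exists_litFalse_iff C[l].1 C[l].2).2 (by
          have := hne C[l] (List.getElem_mem h)
          tauto)
        exact ⟨g, hg, fun _ => h1⟩
      · exact ⟨0, by omega, fun h' => absurd h' h⟩
    choose G hG hGl using hgap
    obtain ⟨m, t, hok, h1⟩ := hx' G fun l _ => Nat.lt_succ_of_le (hG l)
    obtain ⟨l, hl, h2⟩ := hok.2 C hC
    obtain ⟨-, h3, h4⟩ := h1 l (by have := I.width_le C hC; omega)
    rw [h3, h4] at h2
    exact h2 (hGl l hl)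
  · rintro ⟨S, hS, hC⟩
    obtain ⟨x, hL⟩ := exists_lists I.weight I.numVars S hS
    refine ⟨x, fun m hm => ?_⟩
    have hgap (l : ℕ) : I.gap m l ≤ I.weight := Nat.le_of_lt_succ (Nat.mod_lt _ (by omega))
    have hbound (j : ℕ) : x (I.gap m (j / 2) + j % 2) < I.numVars + 2 := by
      have h1 := hgap (j / 2)
      have h2 := hL.last
      rcases (show I.gap m (j / 2) + j % 2 ≤ I.weight + 1 by omega).lt_or_eq with h3 | h3
      · have := lt_of_lt_succ hL.lt_succ h3 le_rfl
        omega
      · rw [h3, h2]; omega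
    obtain ⟨t, ht, hd⟩ := exists_baseDigit_eq (I.numVars + 2) (2 * (d + 1))
      (fun j => x (I.gap m (j / 2) + j % 2)) fun j _ => hbound j
    have h2 (l : ℕ) (hl : l < d + 1) : I.entry t (2 * l) = x (I.gap m l) := by
      have := hd (2 * l) (by omega)
      rwa [Nat.mul_div_cancel_left l two_pos, Nat.mul_mod_right, add_zero] at this
    have h3 (l : ℕ) (hl : l < d + 1) : I.entry t (2 * l + 1) = x (I.gap m l + 1) := by
      have := hd (2 * l + 1) (by omega)
      rwa [show (2 * l + 1) / 2 = l by omega, show (2 * l + 1) % 2 = 1 by omega] at this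
    refine ⟨t, ht, ⟨fun l hl => ?_, fun C hCm => ?_⟩, hd⟩
    · rw [h2 l hl, h3 l hl]
      exact ⟨hL.lt_succ _ (hgap l), fun h => by rw [h, hL.zero], fun h => by rw [h, hL.last]⟩
    · obtain ⟨c, hc, h4⟩ := hC C hCm
      obtain ⟨l, hl, rfl⟩ := List.getElem_of_mem hc
      have hld : l < d + 1 := by have := I.width_le C hCm; omega
      refine ⟨l, hl, fun h5 => ?_⟩
      rw [h2 l hld, h3 l hld] at h5
      exact (hL.exists_litFalse_iff _ _).1 ⟨_, hgap l, h5⟩ h4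

end WSatInst

end MinSat

/-! ### Functions and lists definable by expressions and commands -/

namespace MinSat

open Function

/-! ### Definable functions and lists -/

namespace Expr

/-- Insert a variable at position `c` of the environment. -/
def lift : Expr → ℕ → Expr
  | var i, c => var (if i < c then i else i + 1)
  | const a, _ => const a
  | add a b, c => add (a.lift c) (b.lift c)
  | sub a b, c => sub (a.lift c) (b.lift c)
  | sum n b, c => sum (n.lift c) (b.lift (c + 1))
  | get a, c => get (a.lift c)
  | countdown n b, c => countdown (n.lift c) (b.lift (c + 1))
  | size, _ => size

theorem eval_lift (w : List ℕ) (e : Expr) (pre env : List ℕ) (x : ℕ) :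
    (e.lift pre.length).eval w (pre ++ x :: env) = e.eval w (pre ++ env) := by
  induction e generalizing pre with
  | var i =>
    simp only [lift, eval]
    split_ifs with h
    · rw [List.getElem?_append_left h, List.getElem?_append_left h]
    · rw [List.getElem?_append_right (by omega), List.getElem?_append_right (by omega),
        Nat.sub_add_comm (by omega), List.getElem?_cons_succ]
  | const a => rfl
  | add a b iha ihb => simp only [lift, eval, iha, ihb]
  | sub a b iha ihb => simp only [lift, eval, iha, ihb]
  | sum n b ihn ihb =>
    simp only [lift, eval, ihn]
    exact Finset.sum_congr rfl fun i _ => ihb (i :: pre)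
  | get a iha => simp only [lift, eval, iha]
  | countdown n b ihn ihb =>
    simp only [lift, eval, ihn]
    congr 1
    funext i
    exact ihb (i :: pre)
  | size => rfl

end Expr

/-- A family of inputs and environments. -/
structure Ctx (σ : Type) where
  word : σ → List ℕ
  vars : σ → List ℕ

/-- The entry of `w` at position `i`, plus `1`, or `0` if there is no such entry. -/
def entryAt (w : List ℕ) (i : ℕ) : ℕ := (w[i]?.map (· + 1)).getD 0

namespace Ctx

variable {σ : Type}

def push (X : Ctx σ) : Ctx (σ × ℕ) where
  word p := X.word p.1
  vars p := p.2 :: X.vars p.1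

/-- A single expression serves all `s`. Uniformity is what makes it a program; data that do not
depend on `s` may enter as constants. -/
def Def (X : Ctx σ) (f : σ → ℕ) : Prop :=
  ∃ e : Expr, ∀ s, e.eval (X.word s) (X.vars s) = f s

def Emits (X : Ctx σ) (F : σ → List ℕ) : Prop :=
  ∃ c : Cmd, ∀ s, c.run (X.word s) (X.vars s) = F s

open Classical in
def DefP (X : Ctx σ) (p : σ → Prop) : Prop :=
  X.Def fun s => if p s then 1 else 0

variable {X : Ctx σ} {f g h : σ → ℕ} {p q : σ → Prop} {F G : σ → List ℕ}

theorem Def.congr (hf : X.Def f) (h : ∀ s, f s = g s) : X.Def g := by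
  rwa [show g = f from funext fun s => (h s).symm]

theorem Def.lift (hf : X.Def f) : X.push.Def fun p => f p.1 := by
  obtain ⟨e, he⟩ := hf
  exact ⟨e.lift 0, fun p => (e.eval_lift (X.word p.1) [] (X.vars p.1) p.2).trans (he p.1)⟩

theorem def_snd (X : Ctx σ) : X.push.Def fun p => p.2 := ⟨.var 0, fun _ => rfl⟩

theorem def_const (X : Ctx σ) (a : ℕ) : X.Def fun _ => a := ⟨.const a, fun _ => rfl⟩

theorem def_size (X : Ctx σ) : X.Def fun s => (encNats (X.word s)).length := ⟨.size, fun _ => rfl⟩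

theorem Def.add (hf : X.Def f) (hg : X.Def g) : X.Def fun s => f s + g s := by
  obtain ⟨a, ha⟩ := hf
  obtain ⟨b, hb⟩ := hg
  exact ⟨.add a b, fun s => by rw [Expr.eval, ha, hb]⟩

theorem Def.sub (hf : X.Def f) (hg : X.Def g) : X.Def fun s => f s - g s := by
  obtain ⟨a, ha⟩ := hf
  obtain ⟨b, hb⟩ := hg
  exact ⟨.sub a b, fun s => by rw [Expr.eval, ha, hb]⟩

theorem Def.entryAt (hf : X.Def f) : X.Def fun s => entryAt (X.word s) (f s) := by
  obtain ⟨a, ha⟩ := hf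
  exact ⟨.get a, fun s => by rw [Expr.eval, ha]; rfl⟩

theorem Def.sum (hf : X.Def f) {b : σ → ℕ → ℕ} (hb : X.push.Def fun p => b p.1 p.2) :
    X.Def fun s => ∑ i ∈ Finset.range (f s), b s i := by
  obtain ⟨n, hn⟩ := hf
  obtain ⟨e, he⟩ := hb
  exact ⟨.sum n e, fun s => by
    rw [Expr.eval, hn]; exact Finset.sum_congr rfl fun i _ => he (s, i)⟩

theorem Def.countdown (hf : X.Def f) {b : σ → ℕ → ℕ} (hb : X.push.Def fun p => b p.1 p.2) :
    X.Def fun s => countdownVal (b s) (f s) := by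
  obtain ⟨n, hn⟩ := hf
  obtain ⟨e, he⟩ := hb
  refine ⟨.countdown n e, fun s => ?_⟩
  rw [Expr.eval, hn]
  congr 1
  exact funext fun i => he (s, i)

theorem Def.mul (hf : X.Def f) (hg : X.Def g) : X.Def fun s => f s * g s :=
  (hf.sum (b := fun s _ => g s) hg.lift).congr fun s => by simp

theorem Def.pow (hf : X.Def f) (n : ℕ) : X.Def fun s => f s ^ n := by
  induction n with
  | zero => exact (X.def_const 1).congr fun s => by simp
  | succ n ih => exact (ih.mul hf).congr fun s => (pow_succ _ _).symm

theorem DefP.congr (hp : X.DefP p) (h : ∀ s, p s ↔ q s) : X.DefP q := by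
  rwa [show q = p from funext fun s => propext (h s).symm]

theorem DefP.not (hp : X.DefP p) : X.DefP fun s => ¬ p s := by
  classical
  exact ((X.def_const 1).sub hp).congr fun s => by by_cases h : p s <;> simp [h]

theorem DefP.and (hp : X.DefP p) (hq : X.DefP q) : X.DefP fun s => p s ∧ q s := by
  classical
  exact (Def.mul hp hq).congr fun s => by by_cases h : p s <;> simp [h]

theorem DefP.imp (hp : X.DefP p) (hq : X.DefP q) : X.DefP fun s => p s → q s :=
  (hp.and hq.not).not.congr fun s => by tauto

theorem DefP.or (hp : X.DefP p) (hq : X.DefP q) : X.DefP fun s => p s ∨ q s :=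
  (hp.not.and hq.not).not.congr fun s => by tauto

theorem Def.eq_zero (hf : X.Def f) : X.DefP fun s => f s = 0 := by
  classical
  exact ((X.def_const 1).sub hf).congr fun s => by split_ifs <;> omega

theorem Def.le (hf : X.Def f) (hg : X.Def g) : X.DefP fun s => f s ≤ g s :=
  (hf.sub hg).eq_zero.congr fun s => by omega

theorem Def.lt (hf : X.Def f) (hg : X.Def g) : X.DefP fun s => f s < g s :=
  (hg.le hf).not.congr fun s => by omega

theorem Def.eq (hf : X.Def f) (hg : X.Def g) : X.DefP fun s => f s = g s :=
  ((hf.le hg).and (hg.le hf)).congr fun s => by omega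

theorem Def.ite (hp : X.DefP p) [∀ s, Decidable (p s)] (hf : X.Def f) (hg : X.Def g) :
    X.Def fun s => if p s then f s else g s :=
  ((Def.mul hp hf).add (Def.mul hp.not hg)).congr fun s => by by_cases h : p s <;> simp [h]

theorem DefP.indicator (hp : X.DefP p) [∀ s, Decidable (p s)] :
    X.Def fun s => if p s then 1 else 0 :=
  Def.ite hp (X.def_const 1) (X.def_const 0)

/-- The quotient counts the `i < f s` with `(i + 1) * g s ≤ f s`; the divisor `0` is treated
separately. -/
theorem Def.div (hf : X.Def f) (hg : X.Def g) : X.Def fun s => f s / g s := by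
  classical
  have h : X.Def fun s => ∑ i ∈ Finset.range (f s), if (i + 1) * g s ≤ f s then 1 else 0 :=
    hf.sum ((((X.def_snd).add (def_const _ 1)).mul hg.lift).le hf.lift).indicator
  refine (Def.ite hg.eq_zero (X.def_const 0) h).congr fun s => ?_
  split_ifs with h0
  · rw [h0, Nat.div_zero]
  · have hpos : 0 < g s := by omega
    rw [← Finset.card_filter]
    have : ((Finset.range (f s)).filter fun i => (i + 1) * g s ≤ f s) =
        Finset.range (f s / g s) := by
      ext i
      rw [Finset.mem_filter, Finset.mem_range, Finset.mem_range, ← Nat.le_div_iff_mul_le hpos,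
        Nat.add_one_le_iff, and_iff_right_iff_imp]
      exact fun hi => hi.trans_le (Nat.div_le_self _ _)
    rw [this, Finset.card_range]

theorem Def.mod (hf : X.Def f) (hg : X.Def g) : X.Def fun s => f s % g s :=
  (hf.sub (hg.mul (hf.div hg))).congr fun s => by
    have := Nat.div_add_mod (f s) (g s)
    omega

theorem Def.pair (hf : X.Def f) (hg : X.Def g) : X.Def fun s => Nat.pair (f s) (g s) :=
  Def.ite (hf.lt hg) ((hg.mul hg).add hf) (((hf.mul hf).add hf).add hg)

theorem Def.forall_lt (hf : X.Def f) {r : σ → ℕ → Prop} (hr : X.push.DefP fun t => r t.1 t.2) :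
    X.DefP fun s => ∀ i < f s, r s i := by
  classical
  have h : X.Def fun s => ∑ i ∈ Finset.range (f s), if ¬ r s i then 1 else 0 :=
    hf.sum hr.not.indicator
  refine h.eq_zero.congr fun s => ?_
  simp

theorem defP_forall_const {r : σ → ℕ → Prop} (n : ℕ) (hr : ∀ i, X.DefP fun s => r s i) :
    X.DefP fun s => ∀ i < n, r s i := by
  induction n with
  | zero => exact (X.def_const 0).eq_zero.congr fun s => by simp
  | succ n ih =>
    exact (ih.and (hr n)).congr fun s => Nat.forall_lt_succ_right.symm

theorem defP_exists_const {r : σ → ℕ → Prop} (n : ℕ) (hr : ∀ i, X.DefP fun s => r s i) :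
    X.DefP fun s => ∃ i < n, r s i :=
  (defP_forall_const n fun i => (hr i).not).not.congr fun s => by simp

theorem Emits.congr (hF : X.Emits F) (h : ∀ s, F s = G s) : X.Emits G := by
  rwa [show G = F from funext fun s => (h s).symm]

theorem emits_nil (X : Ctx σ) : X.Emits fun _ => [] := ⟨.skip, fun _ => rfl⟩

theorem Def.emits (hf : X.Def f) : X.Emits fun s => [f s] := by
  obtain ⟨e, he⟩ := hf
  exact ⟨.emit e, fun s => by rw [Cmd.run, he]⟩

theorem Emits.append (hF : X.Emits F) (hG : X.Emits G) : X.Emits fun s => F s ++ G s := by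
  obtain ⟨c, hc⟩ := hF
  obtain ⟨d, hd⟩ := hG
  exact ⟨.seq c d, fun s => by rw [Cmd.run, hc, hd]⟩

theorem Def.cons (hf : X.Def f) (hF : X.Emits F) : X.Emits fun s => f s :: F s :=
  hf.emits.append hF

theorem Def.concat (hf : X.Def f) {F : σ → ℕ → List ℕ} (hF : X.push.Emits fun p => F p.1 p.2) :
    X.Emits fun s => concat (f s) (F s) := by
  obtain ⟨n, hn⟩ := hf
  obtain ⟨c, hc⟩ := hF
  refine ⟨.forLt n c, fun s => ?_⟩
  rw [Cmd.run, hn]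
  congr 1
  exact funext fun i => hc (s, i)

theorem emits_concat_const {F : σ → ℕ → List ℕ} (n : ℕ) (hF : ∀ i, X.Emits fun s => F s i) :
    X.Emits fun s => MinSat.concat n (F s) := by
  induction n with
  | zero => exact X.emits_nil
  | succ n ih =>
    exact (ih.append (hF n)).congr fun s => by simp [MinSat.concat, List.range_succ]

theorem emits_flatMap_const {α : Type*} {F : σ → α → List ℕ} (l : List α)
    (hF : ∀ a, X.Emits fun s => F s a) : X.Emits fun s => l.flatMap (F s) := by
  induction l with
  | nil => exact X.emits_nil
  | cons a l ih => exact ((hF a).append ih).congr fun s => by simp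

theorem emits_const (X : Ctx σ) (l : List ℕ) : X.Emits fun _ => l :=
  (emits_flatMap_const (F := fun _ a => [a]) l fun a => (X.def_const a).emits).congr fun s => by simp

theorem emits_ofFn {n : ℕ} {F : σ → Fin n → ℕ} (hF : ∀ i, X.Def fun s => F s i) :
    X.Emits fun s => List.ofFn (F s) :=
  (emits_flatMap_const (F := fun s i => [F s i]) (List.finRange n) fun i => (hF i).emits).congr
    fun s => by rw [List.ofFn_eq_map, List.map_eq_flatMap]

/-- A conditional is a loop with zero or one rounds, which is why `r` is written in a context with
one more variable. -/
theorem DefP.emits_flatMap_ite {α : Type*} {a : σ → α} {r : σ → α → List ℕ} (hp : X.DefP p)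
    [∀ s, Decidable (p s)] (hr : X.push.Emits fun t => r t.1 (a t.1)) :
    X.Emits fun s => (if p s then [] else [a s]).flatMap (r s) := by
  classical
  refine (Def.concat (F := fun s _ => r s (a s)) hp.not.indicator hr).congr fun s => ?_
  by_cases h : p s <;> simp [h, MinSat.concat]

end Ctx

end MinSat

/-! ### Evaluating the constraints of the tuple CSP on an encoded instance -/

namespace MinSat

open Function

/-! ### Reading clauses -/

theorem entryAt_cons_zero (a : ℕ) (w : List ℕ) : entryAt (a :: w) 0 = a + 1 := rfl

theorem entryAt_cons_succ (a : ℕ) (w : List ℕ) (i : ℕ) :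
    entryAt (a :: w) (i + 1) = entryAt w i := rfl

theorem entryAt_append_length_add (v w : List ℕ) (i : ℕ) :
    entryAt (v ++ w) (v.length + i) = entryAt w i := by
  rw [entryAt, entryAt, List.getElem?_append_right (by omega), Nat.add_sub_cancel_left]

theorem entryAt_ne_zero_iff {w : List ℕ} {i : ℕ} : entryAt w i ≠ 0 ↔ i < w.length := by
  by_cases h : i < w.length
  · simp [entryAt, h]
  · simp [entryAt, h]

theorem length_encClause {n : ℕ} (C : List (Fin n × Bool)) :
    (encClause C).length = 2 * C.length + 1 := by
  simp [encClause, mul_comm]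

theorem entryAt_encClause {n : ℕ} (C : List (Fin n × Bool)) (w : List ℕ) (l : ℕ)
    (h : l < C.length) :
    entryAt (encClause C ++ w) (2 * l + 1) = C[l].1 + 1 ∧
      entryAt (encClause C ++ w) (2 * l + 2) = C[l].2.toNat + 1 := by
  simp only [encClause, List.cons_append, entryAt_cons_succ]
  induction C generalizing l with
  | nil => simp at h
  | cons c C ih =>
    cases l with
    | zero => exact ⟨rfl, rfl⟩
    | succ l =>
      simp only [List.flatMap_cons, List.cons_append, List.nil_append,
        List.getElem_cons_succ]
      exact ih l (by simpa using h)

theorem countdownVal_add (b : ℕ → ℕ) (q p : ℕ) (h : countdownVal b q = 0) :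
    countdownVal b (q + p) = countdownVal (fun i => b (q + i)) p := by
  induction p with
  | zero => exact h
  | succ p ih => rw [← add_assoc, countdownVal, countdownVal, ih]

theorem countdownVal_succ (b : ℕ → ℕ) (i : ℕ) (h : i ≤ b 0) :
    countdownVal b (i + 1) = b 0 - i := by
  induction i with
  | zero => rfl
  | succ i ih =>
    rw [countdownVal, ih (by omega), if_neg (by omega)]
    omega

/-- The position `p` of an encoded list of clauses is the start of a clause. -/
def StartsAt (a : ℕ → ℕ) (p : ℕ) : Prop :=
  countdownVal (fun i => 2 * (a i - 1)) p = 0 ∧ a p ≠ 0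

/-- At the start of a clause of length `c` the counter is set to `2 * c`, the number of entries that
follow, and so it is next zero exactly at the following clause. Clauses can thus be found by a loop
over positions. After the end of the list the counter is zero too; there the condition `a p ≠ 0`
fails. -/
theorem forall_clause_iff {n : ℕ} (Φ : List (Fin n × Bool) → Prop) (Ψ : (ℕ → ℕ) → Prop)
    (cs : List (List (Fin n × Bool)))
    (h : ∀ C ∈ cs, ∀ w, Ψ (entryAt (encClause C ++ w)) ↔ Φ C) (B : ℕ)
    (hB : (cs.flatMap encClause).length ≤ B) :
    (∀ p < B, StartsAt (entryAt (cs.flatMap encClause)) p →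
      Ψ fun i => entryAt (cs.flatMap encClause) (p + i)) ↔ ∀ C ∈ cs, Φ C := by
  induction cs generalizing B with
  | nil => simp [StartsAt, entryAt_ne_zero_iff]
  | cons C cs ih =>
    have h0 := length_encClause C
    rw [List.flatMap_cons, List.length_append] at hB
    have ih := ih (fun D hD => h D (List.mem_cons_of_mem _ hD)) (B - (encClause C).length)
      (by omega)
    rw [List.forall_mem_cons, ← ih, ← h C List.mem_cons_self (cs.flatMap encClause),
      List.flatMap_cons]
    set w := cs.flatMap encClause with hw
    set a := entryAt (encClause C ++ w) with ha
    have ha0 : a 0 = C.length + 1 := by rw [ha, encClause, List.cons_append, entryAt_cons_zero]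
    have hadd (i : ℕ) : a ((encClause C).length + i) = entryAt w i :=
      entryAt_append_length_add _ _ _
    have hinner (i : ℕ) (hi : i ≤ 2 * C.length) :
        countdownVal (fun i => 2 * (a i - 1)) (i + 1) = 2 * C.length - i := by
      rw [countdownVal_succ _ _ (by rw [ha0]; exact hi), ha0, Nat.add_sub_cancel]
    have hstart (p : ℕ) : StartsAt a ((encClause C).length + p) ↔ StartsAt (entryAt w) p := by
      unfold StartsAt
      rw [countdownVal_add _ _ _ (by rw [h0, hinner _ le_rfl, Nat.sub_self]), hadd]
      simp only [hadd]
    constructor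
    · intro H
      refine ⟨?_, fun p hp hs => ?_⟩
      · have := H 0 (by omega) ⟨rfl, by rw [ha0]; omega⟩
        simpa only [zero_add] using this
      · have := H ((encClause C).length + p) (by omega) ((hstart p).2 hs)
        simpa only [add_assoc, hadd] using this
    · rintro ⟨H0, H⟩ p hp hs
      by_cases hlt : p < (encClause C).length
      · cases p with
        | zero => simpa only [zero_add] using H0
        | succ p =>
          have h1 := hs.1
          rw [hinner p (by omega)] at h1
          omega
      · obtain ⟨p, rfl⟩ := Nat.exists_eq_add_of_le (not_lt.1 hlt)
        have := H p (by omega) ((hstart p).1 hs)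
        simpa only [add_assoc, hadd] using this

namespace WSatInst

variable {d : ℕ} (I : WSatInst d)

/-- Some literal of the clause with entries `a` is not witnessed to be false by `t`. -/
def ClauseAllowed (t : ℕ) (a : ℕ → ℕ) : Prop :=
  ∃ l < d, l < a 0 - 1 ∧
    ¬ ((a (2 * l + 2) = 2 ∧ I.entry t (2 * l) < a (2 * l + 1) ∧
        a (2 * l + 1) < I.entry t (2 * l + 1)) ∨
      (a (2 * l + 2) ≠ 2 ∧ I.entry t (2 * l) = a (2 * l + 1)))

/-- The offset 2 skips the weight and the number of variables. As `entryAt` adds one, a positive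
sign is read as `2` and the variable `v` as `v + 1`, which is just the shift in `LitFalse`. -/
theorem allowed_iff (m t : ℕ) : I.Allowed m t ↔
    (∀ l < d + 1, I.entry t (2 * l) < I.entry t (2 * l + 1) ∧
      (I.gap m l = 0 → I.entry t (2 * l) = 0) ∧
      (I.gap m l = I.weight → I.entry t (2 * l + 1) = I.numVars + 1)) ∧
    ∀ p < (encNats I.code).length, StartsAt (fun i => entryAt I.code (i + 2)) p →
      I.ClauseAllowed t fun i => entryAt I.code (p + i + 2) := by
  refine and_congr_right fun _ => ?_
  have h1 : (I.clauses.flatMap encClause).length ≤ (encNats I.code).length := by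
    refine le_trans ?_ (length_le_length_encNats _)
    simp only [code, List.length_cons]
    omega
  rw [← forall_clause_iff _ (I.ClauseAllowed t) I.clauses (fun C hC w => ?_) _ h1]
  · rfl
  · have h0 : entryAt (encClause C ++ w) 0 = C.length + 1 := rfl
    have hd := I.width_le C hC
    have key (l : ℕ) (hl : l < C.length) :
        LitFalse C[l].1 C[l].2 (I.entry t (2 * l)) (I.entry t (2 * l + 1)) ↔
        ((entryAt (encClause C ++ w) (2 * l + 2) = 2 ∧
          I.entry t (2 * l) < entryAt (encClause C ++ w) (2 * l + 1) ∧
          entryAt (encClause C ++ w) (2 * l + 1) < I.entry t (2 * l + 1)) ∨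
        (entryAt (encClause C ++ w) (2 * l + 2) ≠ 2 ∧
          I.entry t (2 * l) = entryAt (encClause C ++ w) (2 * l + 1))) := by
      obtain ⟨h2, h3⟩ := entryAt_encClause C w l hl
      rw [h2, h3, LitFalse]
      cases C[l].2 <;> simp
    unfold ClauseAllowed
    rw [h0, Nat.add_sub_cancel]
    constructor
    · rintro ⟨l, -, hl, h2⟩
      exact ⟨l, hl, fun h => h2 ((key l hl).1 h)⟩
    · rintro ⟨l, hl, h2⟩
      exact ⟨l, by omega, hl, fun h => h2 ((key l hl).2 h)⟩

end WSatInst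

/-! ### The program for the reduction -/

namespace Ctx

variable {Γ : Set BoolRel} {σ : Type} {X : Ctx σ} {d : ℕ} {π : σ → WSatInst d}

/-- The inputs are the codes of instances. -/
def Over (X : Ctx σ) (π : σ → WSatInst d) : Prop := ∀ s, X.word s = (π s).code

theorem Over.push (hX : X.Over π) : X.push.Over fun p => π p.1 := fun p => hX p.1

theorem Over.weight (hX : X.Over π) : X.Def fun s => (π s).weight :=
  ((X.def_const 0).entryAt.sub (X.def_const 1)).congr fun s => by rw [hX s]; rfl

theorem Over.numVars (hX : X.Over π) : X.Def fun s => (π s).numVars :=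
  ((X.def_const 1).entryAt.sub (X.def_const 1)).congr fun s => by rw [hX s]; rfl

theorem Over.size (hX : X.Over π) : X.Def fun s => (encNats (π s).code).length :=
  X.def_size.congr fun s => by rw [hX s]

theorem Over.gap (hX : X.Over π) {m : σ → ℕ} (hm : X.Def m) (l : ℕ) :
    X.Def fun s => (π s).gap (m s) l :=
  (hm.div ((hX.weight.add (X.def_const 1)).pow l)).mod (hX.weight.add (X.def_const 1))

theorem Over.entry (hX : X.Over π) {t : σ → ℕ} (ht : X.Def t) (j : ℕ) :
    X.Def fun s => (π s).entry (t s) j :=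
  (ht.div ((hX.numVars.add (X.def_const 2)).pow j)).mod (hX.numVars.add (X.def_const 2))

theorem Over.clauseAllowed (hX : X.Over π) {t p : σ → ℕ} (ht : X.Def t) (hp : X.Def p) :
    X.DefP fun s => (π s).ClauseAllowed (t s) fun i => MinSat.entryAt (π s).code (p s + i + 2) := by
  have ha (i : ℕ) : X.Def fun s => MinSat.entryAt (π s).code (p s + i + 2) :=
    ((hp.add (X.def_const i)).add (X.def_const 2)).entryAt.congr fun s => by rw [hX s]
  refine defP_exists_const d fun l => ?_
  refine ((X.def_const l).lt ((ha 0).sub (X.def_const 1))).and (DefP.not (DefP.or ?_ ?_))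
  · exact ((ha _).eq (X.def_const 2)).and (((hX.entry ht _).lt (ha _)).and
      ((ha _).lt (hX.entry ht _)))
  · exact ((ha _).eq (X.def_const 2)).not.and ((hX.entry ht _).eq (ha _))

/-- Since `d` is fixed, the quantifiers over gaps and literals are unrolled, and digits need only
powers with constant exponents; the clauses are traversed by a loop bounded by the input size. -/
theorem Over.allowed (hX : X.Over π) {m t : σ → ℕ} (hm : X.Def m) (ht : X.Def t) :
    X.DefP fun s => (π s).Allowed (m s) (t s) := by
  refine DefP.congr (DefP.and (defP_forall_const (d + 1) fun l => ?_)
    (Def.forall_lt hX.size (r := fun s p => StartsAt (fun i => entryAt (π s).code (i + 2)) p →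
      (π s).ClauseAllowed (t s) fun i => entryAt (π s).code (p + i + 2)) 
        (DefP.imp (DefP.and ?_ ?_) ?_))) fun s => ((π s).allowed_iff (m s) (t s)).symm
  · exact ((hX.entry ht _).lt (hX.entry ht _)).and
      ((DefP.imp (hX.gap hm l).eq_zero (hX.entry ht _).eq_zero).and
        (DefP.imp ((hX.gap hm l).eq hX.weight)
          ((hX.entry ht _).eq (hX.numVars.add (X.def_const 1)))))
  · refine Def.eq_zero (Def.countdown X.def_snd (b := fun s i =>
      2 * (MinSat.entryAt (π s.1).code (i + 2) - 1)) ?_)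
    refine (def_const _ 2).mul (Def.sub ?_ (def_const _ 1))
    exact ((def_snd _).add (def_const _ 2)).entryAt.congr fun s => by rw [hX.push.push s]
  · exact DefP.not (Def.eq_zero (((def_snd _).add (def_const _ 2)).entryAt.congr fun s => by
      rw [hX.push s]))
  · exact hX.push.clauseAllowed ht.lift X.def_snd

end Ctx

end MinSat

/-! ### Writing the constructed formula -/

namespace MinSat

open Function

namespace Ctx

variable {Γ : Set BoolRel} {σ : Type} {X : Ctx σ} {d : ℕ} {π : σ → WSatInst d}

/-! ### Writing constraints -/

/-- The code of `K + 1` copies of the gadget for `u ≠ v`. -/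
noncomputable def hardBlock (F₀ : Formula Γ) (K u v : ℕ) : List ℕ :=
  concat (K + 1) fun _ => F₀.flatMap fun c => (c.rename (gadgetVar u v)).code

theorem flatMap_code_hardFormula (F₀ : Formula Γ) (K : ℕ) (pairs : List (ℕ × ℕ)) :
    (hardFormula F₀ K pairs).flatMap Constraint.code =
      pairs.flatMap fun p => hardBlock F₀ K p.1 p.2 := by
  simp only [hardFormula, hardBlock, concat, List.flatMap_assoc, List.flatMap_map]

theorem Def.litVar {u : σ → ℕ} (hu : X.Def u) (b : Bool) : X.Def fun s => litVar (u s) b :=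
  (X.def_const 0).pair (hu.pair (X.def_const b.toNat))

theorem Def.gadgetVar {u v : σ → ℕ} (hu : X.Def u) (hv : X.Def v) (z : ℕ) :
    X.Def fun s => gadgetVar (u s) (v s) z := by
  unfold MinSat.gadgetVar
  split_ifs
  exacts [hu, hv, (X.def_const 1).pair ((hu.pair hv).pair (X.def_const z))]

theorem Def.hardBlock (F₀ : Formula Γ) {K u v : σ → ℕ} (hK : X.Def K) (hu : X.Def u)
    (hv : X.Def v) : X.Emits fun s => hardBlock F₀ (K s) (u s) (v s) := by
  refine (hK.add (X.def_const 1)).concat (emits_flatMap_const F₀ fun c => ?_)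
  exact (X.push.def_const c.rel.arity).cons ((X.push.emits_const c.rel.table).append
    (emits_ofFn fun i => hu.lift.gadgetVar hv.lift (c.scope i)))

theorem emits_frame (A : Frame Γ) {p : σ → Quad} (hp : ∀ c, X.Def fun s => p s c) :
    X.Emits fun s => (A.constraint (p s)).code := by
  refine (X.def_const A.rel.arity).cons ((X.emits_const A.rel.table).append
    (emits_ofFn (n := A.rel.arity) (F := fun s i => (A.constraint (p s)).scope i) fun i => ?_))
  by_cases h : ∃ c, A.coord c = i
  · obtain ⟨c, rfl⟩ := h
    exact ((hp c).litVar (A.sign c)).congr fun s => (A.constraint_scope_coord (p s) c).symm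
  · push Not at h
    exact ((X.def_const 2).pair ((((hp 0).pair (hp 1)).pair ((hp 2).pair (hp 3))).pair
      (X.def_const i))).congr fun s => (A.constraint_scope_of_ne (p s) i h).symm

/-! ### Writing the formula of the tuple CSP -/

theorem Def.nodeA {m t : σ → ℕ} (hm : X.Def m) (ht : X.Def t) :
    X.Def fun s => nodeA (m s) (t s) :=
  (X.def_const 1).pair (hm.pair ht)

theorem Def.nodeB {i v : σ → ℕ} (hi : X.Def i) (hv : X.Def v) :
    X.Def fun s => nodeB (i s) (v s) :=
  (X.def_const 2).pair (hi.pair hv)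

theorem Def.nodeP {m q : σ → ℕ} (hm : X.Def m) (j : ℕ) (hq : X.Def q) :
    X.Def fun s => nodeP (m s) j (q s) :=
  (X.def_const 3).pair ((hm.pair (X.def_const j)).pair hq)

theorem Over.M (hX : X.Over π) : X.Def fun s => (π s).tupleCSP.M :=
  (hX.weight.add (X.def_const 1)).pow (d + 1)

theorem Over.N (hX : X.Over π) : X.Def fun s => (π s).tupleCSP.N :=
  hX.numVars.add (X.def_const 2)

theorem Over.T (hX : X.Over π) : X.Def fun s => (π s).tupleCSP.T :=
  hX.N.pow (2 * (d + 1))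

theorem Over.V (hX : X.Over π) : X.Def fun s => (π s).tupleCSP.V :=
  hX.weight.add (X.def_const 2)

theorem Over.idx (hX : X.Over π) {m : σ → ℕ} (hm : X.Def m) (j : ℕ) :
    X.Def fun s => (π s).tupleCSP.idx (m s) j :=
  (hX.gap hm (j / 2)).add (X.def_const (j % 2))

theorem Over.digit (hX : X.Over π) {t : σ → ℕ} (ht : X.Def t) (j : ℕ) :
    X.Def fun s => (π s).tupleCSP.digit (t s) j :=
  hX.entry ht j

theorem Over.budget (hX : X.Over π) : X.Def fun s => (π s).tupleCSP.M * (π s).tupleCSP.D :=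
  hX.M.mul (X.def_const (2 * (d + 1)))

/-- The text `g K u` can be written for given `K` and `u`. -/
def Writable (g : ℕ → ℕ → List ℕ) : Prop :=
  ∀ {τ : Type} (Y : Ctx τ) (K u : τ → ℕ), Y.Def K → Y.Def u → Y.Emits fun s => g (K s) (u s)

theorem Over.emits_nodes (hX : X.Over π) {K : σ → ℕ} (hK : X.Def K) {g : ℕ → ℕ → List ℕ}
    (hg : Writable g) : X.Emits fun s => (π s).tupleCSP.nodes.flatMap (g (K s)) := by
  simp only [TupleCSP.nodes, concat, List.flatMap_append, List.flatMap_assoc,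
    List.flatMap_cons, List.flatMap_nil, List.append_nil]
  have hc (n : ℕ) : X.Emits fun s => g (K s) n := hg X _ _ hK (X.def_const n)
  refine ((hc _).append ((hc _).append ((hc _).append (hc _)))).append (Emits.append ?_
    (Emits.append ?_ ?_))
  · exact hX.M.concat ((hX.push.T.add (def_const _ 1)).concat
      (hg _ _ _ hK.lift.lift (X.def_snd.lift.nodeA (def_snd _))))
  · exact hX.V.concat ((hX.push.N.add (def_const _ 1)).concat
      (hg _ _ _ hK.lift.lift (X.def_snd.lift.nodeB (def_snd _))))
  · exact hX.M.concat (emits_concat_const (2 * (d + 1)) fun j =>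
      ((hX.push.N.mul hX.push.T).add (def_const _ 1)).concat
        (hg _ _ _ hK.lift.lift (X.def_snd.lift.nodeP j (def_snd _))))

/-- The text `g K u v` can be written for given `K`, `u`, and `v`. -/
def Writable₂ (g : ℕ → ℕ × ℕ → List ℕ) : Prop :=
  ∀ {τ : Type} (Y : Ctx τ) (K u v : τ → ℕ), Y.Def K → Y.Def u → Y.Def v →
    Y.Emits fun s => g (K s) (u s, v s)

theorem Over.emits_eqs (hX : X.Over π) {K : σ → ℕ} (hK : X.Def K) {g : ℕ → ℕ × ℕ → List ℕ}
    (hg : Writable₂ g) : X.Emits fun s => (π s).tupleCSP.eqs.flatMap (g (K s)) := by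
  classical
  simp only [TupleCSP.eqs, concat, List.flatMap_append, List.flatMap_assoc,
    List.flatMap_cons, List.flatMap_nil, List.append_nil]
  have hK2 := hK.lift.lift
  have hK3 := hK2.lift
  refine Emits.append ?_ (Emits.append ?_ (Emits.append ?_ (Emits.append ?_ ?_)))
  · exact hX.M.concat ((hg _ _ _ _ hK.lift (X.def_snd.nodeA (def_const _ 0)) (def_const _ _)).append
      (hg _ _ _ _ hK.lift (X.def_snd.nodeA hX.push.T) (def_const _ _)))
  · exact hX.V.concat ((hg _ _ _ _ hK.lift (X.def_snd.nodeB (def_const _ 0)) (def_const _ _)).append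
      (hg _ _ _ _ hK.lift (X.def_snd.nodeB hX.push.N) (def_const _ _)))
  · exact hX.M.concat (emits_concat_const (2 * (d + 1)) fun j =>
      (hX.push.N.add (def_const _ 1)).concat (hg _ _ _ _ hK2
        ((hX.push.push.idx X.def_snd.lift j).nodeB (def_snd _))
        (X.def_snd.lift.nodeP j ((def_snd _).mul hX.push.push.T))))
  · refine hX.M.concat (hX.push.T.concat (DefP.emits_flatMap_ite
      (hX.push.push.allowed X.def_snd.lift (def_snd _)) ?_))
    exact hg _ _ _ _ hK3 (X.def_snd.lift.lift.nodeA (def_snd _).lift)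
      (X.def_snd.lift.lift.nodeA ((def_snd _).lift.add (def_const _ 1)))
  · refine hX.M.concat (emits_concat_const (2 * (d + 1)) fun j =>
      hX.push.N.concat (hX.push.push.T.concat (DefP.emits_flatMap_ite
        ((hX.push.push.push.digit (def_snd _) j).eq (def_snd _).lift) ?_)))
    have hq := ((X.push.def_snd.lift.lift.mul hX.push.push.push.push.T).add
      X.push.push.def_snd.lift)
    exact hg _ _ _ _ hK3.lift (X.def_snd.lift.lift.lift.nodeP j hq)
      (X.def_snd.lift.lift.lift.nodeP j (hq.add (def_const _ 1)))

theorem Over.emits_bundles (hX : X.Over π) (A : Frame Γ) :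
    X.Emits fun s => (π s).tupleCSP.bundles.flatMap fun p => (A.constraint p).code := by
  simp only [TupleCSP.bundles, concat, List.flatMap_assoc, List.flatMap_singleton]
  refine hX.M.concat (emits_concat_const (2 * (d + 1)) fun j => hX.push.T.concat
    (emits_frame A fun c => ?_))
  have hm := X.def_snd.lift (X := X.push)
  have ht := X.push.def_snd
  have hq := ((hX.push.push.digit ht j).mul hX.push.push.T).add ht
  fin_cases c
  exacts [hm.nodeA ht, hm.nodeA (ht.add (def_const _ 1)), hm.nodeP j hq,
    hm.nodeP j (hq.add (def_const _ 1))]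

theorem Over.emits_formula (hX : X.Over π) (F₀ : Formula Γ) (A : Frame Γ) :
    X.Emits fun s => ((π s).tupleCSP.formula F₀ A).flatMap Constraint.code := by
  simp only [TupleCSP.formula, assembled, List.flatMap_append, flatMap_code_hardFormula, hardPairs,
    List.flatMap_cons, List.flatMap_map, List.flatMap_assoc, List.flatMap_nil, List.append_nil]
  have hK := hX.budget
  refine Emits.append (Emits.append ?_ (Emits.append ?_ ?_)) (Emits.append ?_ ?_)
  · exact hK.hardBlock F₀ (def_const _ _) (def_const _ _)
  · exact hX.emits_nodes hK (g := fun K u => hardBlock F₀ K (litVar u true) (litVar u false))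
      fun Y K u hK hu => hK.hardBlock F₀ (hu.litVar true) (hu.litVar false)
  · exact hX.emits_eqs hK (g := fun K p => hardBlock F₀ K (litVar p.1 true) (litVar p.2 false))
      fun Y K u v hK hu hv => hK.hardBlock F₀ (hu.litVar true) (hv.litVar false)
  · exact hX.emits_bundles A
  · exact emits_flatMap_const A.pins fun p => (hK.add (def_const _ 1)).concat
      (emits_const _ _)

end Ctx

/-- The program that writes the instance of Min SAT constructed from an instance of weighted
satisfiability. -/
theorem exists_cmd_formula {Γ : Set BoolRel} (d : ℕ) (F₀ : Formula Γ) (A : Frame Γ) :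
    ∃ c : Cmd, ∀ I : WSatInst d, c.run I.code [] = I.tupleCSP.M * I.tupleCSP.D ::
      (I.tupleCSP.formula F₀ A).flatMap Constraint.code := by
  have hX : (Ctx.mk (σ := WSatInst d) (fun I => I.code) fun _ => []).Over id := fun _ => rfl
  exact hX.budget.cons (hX.emits_formula F₀ A)

/-- The budget `(k + 1) ^ (d + 1) * (2 * (d + 1))` is the new parameter and depends on the old one
only, `d` being constant. -/
theorem fptReducible_minSAT {Γ : Set BoolRel} {P : ParamProblem} {d : ℕ}
    (h : FPTReducible P (WSat d)) {F₀ : Formula Γ} (hF₀ : ∀ α : ℕ → Bool, α 0 = α 1 → 0 < cost F₀ α)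
    (hF₀' : ∀ a b : Bool, a ≠ b → ∃ α : ℕ → Bool, α 0 = a ∧ α 1 = b ∧ cost F₀ α = 0)
    {A : Frame Γ} (hA : A.Paired) : FPTReducible P (MinSAT Γ) := by
  obtain ⟨c, hc⟩ := exists_cmd_formula d F₀ A
  refine h.trans_cmd c WSatInst.code (fun _ => rfl)
    (fun I => (I.tupleCSP.formula F₀ A, I.tupleCSP.M * I.tupleCSP.D))
    (fun I => congrArg encNats (hc I).symm)
    (fun I => I.solvable_tupleCSP_iff.symm.trans
      (I.tupleCSP.exists_cost_formula_le_iff hF₀ hF₀' hA).symm)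
    (fun k => (k + 1) ^ (d + 1) * (2 * (d + 1))) ?_ ?_ fun I => le_rfl
  · exact (Primrec.nat_mul.comp (primrec_pow_const Primrec.succ (d + 1)) (Primrec.const _)).to_comp
  · exact fun a b hab => Nat.mul_le_mul_right _ (Nat.pow_le_pow_left (by omega) _)

end MinSat

/-! ### The hardness theorem -/

theorem mainTheorem8 (Γ : Set MinSat.BoolRel) (hneq : MinSat.SupportsCrisp Γ MinSat.neqRel)
    (R : MinSat.BoolRel) (hR : R ∈ Γ) (h2K2 : MinSat.twoK2.IsIndContained (MinSat.gaifmanGraph R)) :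
    MinSat.MinSATTrivial Γ ∨ MinSat.W1Hard (MinSat.MinSAT Γ) := by
  obtain ⟨A, hA⟩ := MinSat.exists_paired_frame hR h2K2
  -- A gadget that costs at least one when the ends agree is enough: repeating it raises this cost
  -- above any budget.
  obtain ⟨F₀, hF₀⟩ := hneq 0
  refine Or.inr fun P ⟨d, hd⟩ => MinSat.fptReducible_minSAT hd (F₀ := F₀) (fun α h => ?_)
    (fun a b hab => ?_) hA
  · refine (hF₀ fun i => α i).2 (fun hne => hne ?_) α fun i => rfl
    exact h
  · obtain ⟨α, h1, h2⟩ := (hF₀ ![a, b]).1 hab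
    exact ⟨α, h1 (0 : Fin 2), h1 (1 : Fin 2), h2⟩
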